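/- **Setting.** Let $X\subset\mathbb R^m$, $Y\subset\mathbb R^n$ be convex and compact, let $F,G,H_1,\dots,H_p$ be real functions of $(x,y)$, and consider the bilevel problem $\min_{x\in X}F(x,y^*(x))$, where $y^*(x)$ minimizes $G(x,\cdot)$ over $\{y\in Y: H_i(x,y)\le 0,\ i=1,\dots,p\}$. Let $\nabla f(x,y;\zeta)$, $\zeta\sim\mathcal D_\zeta$, and $\nabla g(x,y;\xi)$, $\xi\sim\mathcal D_\xi$, be (measurable) stochastic oracles for $\nabla F$ and $\nabla G$. Fix $\gamma_1,\gamma_2>0$ and $B\ge 0$; put $Z=[0,p^{-1/2}B]^p$, $\mathcal U=X\times Y\times Z$, $\mathbf u=(x,y,z)$, and write $[a]_+=\max\{0,a\}$. Define $$\mathcal L(x,y,\lambda)=G(x,y)+\frac1{2\gamma_1}\sum_{i=1}^p\big([\gamma_1\lambda_i+H_i(x,y)]_+^2-\gamma_1^2\lambda_i^2\big),\qquad \ell(x,z,w,\lambda)=\mathcal L(x,w,\lambda)-\frac{\gamma_2}2\|\lambda-z\|^2,$$ $$E(x,z)=\max_{\lambda\in\mathbb R^p_+}\min_{w\in Y}\ell(x,z,w,\lambda),\qquad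 \mathcal G(\mathbf u)=G(x,y)-E(x,z),\qquad P(x,y)=\frac12\sum_{i=1}^p[H_i(x,y)]_+^2,$$ and, for $c_1,c_2>0$, $\Psi(\mathbf u)=F(x,y)+c_1\mathcal G(\mathbf u)+c_2P(x,y)$. Let $(w^*,\lambda^*)=(w^*(x,z),\lambda^*(x,z))$ be the solution of the max-min problem defining $E(x,z)$. **Assumptions.** (1) $F,G,H_i$ are differentiable on $X\times Y$ and $\nabla F,\nabla G,\nabla H_i$ are Lipschitz there with constants $L_F>0$, $L_G$, $L_H$. (2) For all $x\in X$, $G(x,\cdot)$ is $\mu_G$-strongly convex ($\mu_G>0$) and each $H_i(x,\cdot)$ is convex on $Y$. (3) $\|\nabla G\|\le M_{G,1}$, $|H_i|\le M_{H,0}$, $\|\nabla H_i\|\le M_{H,1}$ on $X\times Y$. (4) At every point of $X\times Y$ the oracles are unbiased, with variances at most $\sigma_f^2$, $\sigma_g^2$. (5) For every $x\in X$ there are $\epsilon>0$ and $y\in Y$ with $H_i(x,y)<-\epsilon$ for all $i$. (6) There is $\sigma_0>0$ such that, for all $(x,y)\in X\times Y$, the matrix $\mathcal C(x,y)$ with rows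 $\nabla_yH_i(x,y)$, $i\in\{i:H_i(x,y)=0\}$, satisfies $\sigma_{\min}(\mathcal C\mathcal C^\top)\ge\sigma_0^2$. **Algorithm SALVF.** Let $\eta\ge 1/\mu_G$, $\rho\ge1/\gamma_2$, step size $\alpha>0$, batch sizes $r,q,s\ge1$, $\mathbf u^0\in\mathcal U$. All samples below are independent. In iteration $k=0,1,\dots$: (a) starting from $\lambda^{k,0}=0$ and any $w^{k,0}\in Y$ (deterministic or depending measurably on the samples of earlier iterations), run for $j=0,\dots,s-1$, with $\xi^k_j\sim\mathcal D_\xi$, $$w^{k,j+1}=\mathrm{Proj}_Y\Big(w^{k,j}-\tfrac{\eta}{j+1}\nabla_w\ell(x^k,z^k,w^{k,j},\lambda^{k,j};\xi^k_j)\Big),\quad \lambda^{k,j+1}=\mathrm{Proj}_{\mathbb R^p_+}\Big(\lambda^{k,j}+\tfrac{\rho}{j+1}\nabla_\lambda\ell(x^k,z^k,w^{k,j},\lambda^{k,j})\Big),$$ and set $(w^k,\lambda^k)=(w^{k,s},\lambda^{k,s})$; here $\nabla\ell(\cdot\,;\xi)$ is $\nabla\ell$ with $\nabla G(x,w)$ replaced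 by $\nabla g(x,w;\xi)$; (b) with $\zeta^k_1,\dots,\zeta^k_r\sim\mathcal D_\zeta$ and $\tilde\xi^k_1,\dots,\tilde\xi^k_q\sim\mathcal D_\xi$, set $$d^k=\frac1r\sum_{j=1}^r\nabla f(x^k,y^k;\zeta^k_j)+\frac{c_1}q\sum_{j=1}^q\big(\nabla g(x^k,y^k;\tilde\xi^k_j)-\nabla_{(x,z)}\ell(x^k,z^k,w^k,\lambda^k;\tilde\xi^k_j)\big)+c_2\sum_{i=1}^p[H_i(x^k,y^k)]_+\nabla H_i(x^k,y^k)$$ (partial gradients being extended by $0$ to the remaining variables), and $\mathbf u^{k+1}=\mathrm{Proj}_{\mathcal U}(\mathbf u^k-\alpha d^k)$. **Conclusion.** $\mathcal G$ is differentiable relative to $\mathcal U$, with gradient $\nabla\mathcal G(\mathbf u)=\nabla G(x,y)-\nabla_{(x,z)}\ell(x,z,w^*,\lambda^*)$, and $\nabla\mathcal G$ on $\mathcal U$ and $\nabla P=\sum_i[H_i]_+\nabla H_i$ on $X\times Y$ are Lipschitz. Let $L_{\mathcal G},L_P>0$ be any Lipschitz constants of these two maps and put $L_\Psi=L_F+c_1L_{\mathcal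 G}+c_2L_P$, which is then a Lipschitz constant of $\nabla\Psi$ on $\mathcal U$. There is a constant $C>0$, independent of $c_1,c_2,\alpha,K,r,q,s$, of the starting points and of the samples, such that for all $c_1,c_2>0$, all $0<\alpha<\frac1{2L_\Psi}$ and all $K,r,q,s\ge1$, $$\mathbb E\Big[\frac1K\sum_{k=0}^{K-1}\frac1\alpha\|\mathbf u^{k+1}-\mathbf u^k\|^2\Big]\le C\Big(\frac1{\alpha K}+\frac1r+\frac{c_1^2}q+\frac{c_1^2}s\Big),$$ and, with the normalization by $\sum_{k<K}\alpha_k=K\alpha$, $$\mathbb E\Big[\frac1{K\alpha}\sum_{k=0}^{K-1}\frac1\alpha\|\mathbf u^{k+1}-\mathbf u^k\|^2\Big]\le \frac4{\alpha K}\,\mathbb E[\Psi(\mathbf u^0)-\Psi(\mathbf u^K)]+C\Big(\frac1r+\frac{c_1^2}q+\frac{c_1^2}s\Big).$$ -/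

import Mathlib

open MeasureTheory ProbabilityTheory
open scoped NNReal Gradient

noncomputable section

namespace SALVF

/-- `ℝ^d` with the Euclidean norm. -/
abbrev Vec (d : ℕ) := EuclideanSpace ℝ (Fin d)

/-- The space of pairs `(x, y) ∈ ℝ^m × ℝ^n` with the Euclidean norm. -/
abbrev XY (m n : ℕ) := WithLp 2 (Vec m × Vec n)

/-- The space of triples `u = (x, y, z) ∈ ℝ^m × ℝ^n × ℝ^p` with the Euclidean norm,
organised as `((x, y), z)`. -/
abbrev XYZ (m n p : ℕ) := WithLp 2 (XY m n × Vec p)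

/-- The pair `(x, y)`. -/
abbrev pair {m n : ℕ} (x : Vec m) (y : Vec n) : XY m n := WithLp.toLp 2 (x, y)

/-- The triple `(x, y, z)`, from `v = (x, y)` and `z`. -/
abbrev triple {m n p : ℕ} (v : XY m n) (z : Vec p) : XYZ m n p := WithLp.toLp 2 (v, z)

/-- A minimiser of `f` over `S` (an arbitrary point if there is none). -/
def argminOn {α : Type*} [Nonempty α] (S : Set α) (f : α → ℝ) : α :=
  Classical.epsilon fun a => a ∈ S ∧ ∀ b ∈ S, f a ≤ f b

/-- Metric projection onto `C`. -/
def proj {E : Type*} [NormedAddCommGroup E] (C : Set E) (a : E) : E :=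
  argminOn C fun b => ‖b - a‖

/-- The nonnegative orthant `ℝ^p_+`. -/
def orthant (p : ℕ) : Set (Vec p) := {l | ∀ i, 0 ≤ l i}

/-- The data of a stochastic lower-level constrained bilevel problem
`min_{x ∈ X} F(x, y*(x))`, `y*(x) ∈ argmin {G(x, y) : y ∈ Y, H_i(x, y) ≤ 0}`,
together with the stochastic first-order oracles `∇f(x, y; ζ)` and `∇g(x, y; ξ)`,
the augmented Lagrangian parameter `γ₁`, the Moreau parameter `γ₂` and the bound `B` that
fixes the box `Z`. -/
structure Problem (m n p : ℕ) (Zt Xi : Type*) where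
  X : Set (Vec m)
  Y : Set (Vec n)
  F : XY m n → ℝ
  G : XY m n → ℝ
  H : Fin p → XY m n → ℝ
  gradf : XY m n → Zt → XY m n
  gradg : XY m n → Xi → XY m n
  γ₁ : ℝ
  γ₂ : ℝ
  B : ℝ

namespace Problem

variable {m n p : ℕ} {Zt Xi : Type*} (P : Problem m n p Zt Xi)

/-- `X × Y`. -/
def domXY : Set (XY m n) := {v | v.fst ∈ P.X ∧ v.snd ∈ P.Y}

/-- `Z = [0, B / √p]^p`. -/
def Z : Set (Vec p) := {z | ∀ i, 0 ≤ z i ∧ z i ≤ P.B / Real.sqrt p}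

/-- `𝒰 = X × Y × Z`. -/
def U : Set (XYZ m n p) := {u | u.fst ∈ P.domXY ∧ u.snd ∈ P.Z}

/-! ### Assumptions -/

/-- `F`, `G`, `H_i` are differentiable on `X × Y`, with gradients that are Lipschitz there. -/
def LipschitzGradients (LF LG LH : ℝ≥0) : Prop :=
  ((∀ v ∈ P.domXY, DifferentiableAt ℝ P.F v) ∧ LipschitzOnWith LF (∇ P.F) P.domXY) ∧
  ((∀ v ∈ P.domXY, DifferentiableAt ℝ P.G v) ∧ LipschitzOnWith LG (∇ P.G) P.domXY) ∧
  ∀ i, (∀ v ∈ P.domXY, DifferentiableAt ℝ (P.H i) v) ∧ LipschitzOnWith LH (∇ (P.H i)) P.domXY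

/-- `G(x, ·)` is `μ`-strongly convex and every `H_i(x, ·)` is convex on `Y`, for all `x ∈ X`. -/
def Convexity (μ : ℝ) : Prop :=
  ∀ x ∈ P.X, StrongConvexOn P.Y μ (fun y => P.G (pair x y)) ∧
    ∀ i, ConvexOn ℝ P.Y (fun y => P.H i (pair x y))

/-- Bounds on `∇G`, `H_i` and `∇H_i` over `X × Y`. -/
def Bounded (MG MH0 MH1 : ℝ) : Prop :=
  ∀ v ∈ P.domXY, ‖∇ P.G v‖ ≤ MG ∧ ∀ i, |P.H i v| ≤ MH0 ∧ ‖∇ (P.H i) v‖ ≤ MH1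

/-- The oracles are measurable, unbiased on `X × Y`, with variances at most `σf²`, `σg²`. -/
def StochasticOracle [MeasurableSpace Zt] [MeasurableSpace Xi]
    (Dζ : Measure Zt) (Dξ : Measure Xi) (σf σg : ℝ) : Prop :=
  Measurable (Function.uncurry P.gradf) ∧ Measurable (Function.uncurry P.gradg) ∧
  ∀ v ∈ P.domXY,
    (MemLp (P.gradf v) 2 Dζ ∧ ∫ ζ, P.gradf v ζ ∂Dζ = ∇ P.F v ∧
      ∫ ζ, ‖P.gradf v ζ - ∇ P.F v‖ ^ 2 ∂Dζ ≤ σf ^ 2) ∧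
    (MemLp (P.gradg v) 2 Dξ ∧ ∫ ξ, P.gradg v ξ ∂Dξ = ∇ P.G v ∧
      ∫ ξ, ‖P.gradg v ξ - ∇ P.G v‖ ^ 2 ∂Dξ ≤ σg ^ 2)

/-- Slater's condition for the lower-level problem at every `x ∈ X`. -/
def Slater : Prop :=
  ∀ x ∈ P.X, ∃ ε > 0, ∃ y ∈ P.Y, ∀ i, P.H i (pair x y) < -ε

/-- Uniform LICQ: with `C(x, y)` the matrix whose rows are the `∇_y H_i(x, y)` with
`H_i(x, y) = 0`, the smallest eigenvalue of `C Cᵀ` is at least `σ₀²` on `X × Y`, that is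
`‖Cᵀ a‖² ≥ σ₀² ‖a‖²` for all vectors `a` indexed by the active constraints. -/
def LICQ (σ₀ : ℝ) : Prop :=
  0 < σ₀ ∧ ∀ v ∈ P.domXY, ∀ a : Fin p → ℝ, (∀ i, P.H i v ≠ 0 → a i = 0) →
    σ₀ ^ 2 * ∑ i, a i ^ 2 ≤ ‖∑ i, a i • (∇ (P.H i) v).snd‖ ^ 2

/-! ### The reformulation -/

/-- The augmented Lagrangian `ℒ(x, y, λ)`. -/
def augLag (x : Vec m) (y : Vec n) (l : Vec p) : ℝ :=
  P.G (pair x y) + 1 / (2 * P.γ₁) *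
    ∑ i, ((max 0 (P.γ₁ * l i + P.H i (pair x y))) ^ 2 - (P.γ₁ * l i) ^ 2)

/-- The augmented dual function `D(x, λ) = min_{y ∈ Y} ℒ(x, y, λ)`. -/
def dual (x : Vec m) (l : Vec p) : ℝ := ⨅ y : P.Y, P.augLag x y l

/-- `E(x, z) = max_{λ ≥ 0} D(x, λ) - γ₂ / 2 ‖λ - z‖²`. -/
def env (x : Vec m) (z : Vec p) : ℝ :=
  ⨆ l : orthant p, (P.dual x l - P.γ₂ / 2 * ‖(l : Vec p) - z‖ ^ 2)

/-- `𝒢(x, y, z) = G(x, y) - E(x, z)`. -/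
def gap (u : XYZ m n p) : ℝ := P.G u.fst - P.env u.fst.fst u.snd

/-- The constraint penalty `½ ∑ [H_i(x, y)]_+²`. -/
def penalty (v : XY m n) : ℝ := 1 / 2 * ∑ i, (max 0 (P.H i v)) ^ 2

/-- `Ψ(x, y, z) = F(x, y) + c₁ 𝒢(x, y, z) + c₂ / 2 ∑ [H_i(x, y)]_+²`. -/
def Psi (c₁ c₂ : ℝ) (u : XYZ m n p) : ℝ :=
  P.F u.fst + c₁ * P.gap u + c₂ * P.penalty u.fst

/-- `λ*(x, z)`, the maximiser over `λ ≥ 0` of `min_{w ∈ Y} ℒ(x, w, λ) - γ₂ / 2 ‖λ - z‖²`. -/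
def lamStar (x : Vec m) (z : Vec p) : Vec p :=
  argminOn (orthant p) fun l => -(P.dual x l - P.γ₂ / 2 * ‖l - z‖ ^ 2)

/-- `w*(x, z)`, the minimiser over `w ∈ Y` of `ℒ(x, w, λ*(x, z))`. -/
def wStar (x : Vec m) (z : Vec p) : Vec n :=
  argminOn P.Y fun w => P.augLag x w (P.lamStar x z)

/-- Gradient in `(x, w)` of `ℒ(x, w, λ)` when `a` is used for `∇G(x, w)`:
`a + (1 / γ₁) ∑ [γ₁ λ_i + H_i]_+ ∇H_i`. -/
def gradLag (a : XY m n) (v : XY m n) (l : Vec p) : XY m n :=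
  a + (1 / P.γ₁) • ∑ i, max 0 (P.γ₁ * l i + P.H i v) • ∇ (P.H i) v

/-- Gradient in `u = (x, y, z)` of `G(x, y) - (ℒ(x, w, λ) - γ₂ / 2 ‖λ - z‖²)`, with `w`, `λ`
held fixed, when `a` is used for `∇G(x, y)` and `b` for `∇G(x, w)`. -/
def gradGap (a b : XY m n) (u : XYZ m n p) (w : Vec n) (l : Vec p) : XYZ m n p :=
  triple (a - pair (P.gradLag b (pair u.fst.fst w) l).fst 0) (-(P.γ₂ • (l - u.snd)))

/-- `∇𝒢(u)`, that is `gradGap` at the exact solution `(w*(x, z), λ*(x, z))`. -/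
def gapGradient (u : XYZ m n p) : XYZ m n p :=
  P.gradGap (∇ P.G u.fst) (∇ P.G (pair u.fst.fst (P.wStar u.fst.fst u.snd))) u
    (P.wStar u.fst.fst u.snd) (P.lamStar u.fst.fst u.snd)

/-- `∑ [H_i(x, y)]_+ ∇H_i(x, y)`, the gradient of `penalty`. -/
def penaltyGradient (v : XY m n) : XY m n := ∑ i, max 0 (P.H i v) • ∇ (P.H i) v

/-! ### The algorithm -/

/-- Inner loop: the pair `(w^j, λ^j)` after `j` projected stochastic gradient descent-ascent
steps at `(x, z)`, from `(w⁰, 0)`, with step sizes `η / (j + 1)`, `ρ / (j + 1)` and samples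
`ξ 0, ξ 1, …`. -/
def salm (η ρ : ℝ) (x : Vec m) (z : Vec p) (w0 : Vec n) (ξ : ℕ → Xi) : ℕ → Vec n × Vec p
  | 0 => (w0, 0)
  | j + 1 =>
    let w := (salm η ρ x z w0 ξ j).1
    let l := (salm η ρ x z w0 ξ j).2
    let gw : Vec n := (P.gradLag (P.gradg (pair x w) (ξ j)) (pair x w) l).snd
    let gl : Vec p := WithLp.toLp 2 (fun i =>
      max 0 (P.γ₁ * l i + P.H i (pair x w)) - P.γ₁ * l i - P.γ₂ * (l i - z i))
    (proj P.Y (w - (η / (j + 1)) • gw), proj (orthant p) (l + (ρ / (j + 1)) • gl))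

/-- Mini-batch average of the first `b` samples. -/
def batch {α : Type*} (b : ℕ) (g : α → XY m n) (s : ℕ → α) : XY m n :=
  (1 / (b : ℝ)) • ∑ j ∈ Finset.range b, g (s j)

/-- The stochastic direction `∇Ψ(u; ζ, ξ, ξ̃)` computed with the inner-loop output `(w, λ)`. -/
def direction (c₁ c₂ : ℝ) (r q : ℕ) (u : XYZ m n p) (w : Vec n) (l : Vec p)
    (ζ : ℕ → Zt) (ξt : ℕ → Xi) : XYZ m n p :=
  triple (batch r (P.gradf u.fst) ζ) 0
    + c₁ • P.gradGap (batch q (P.gradg u.fst) ξt)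
        (batch q (P.gradg (pair u.fst.fst w)) ξt) u w l
    + c₂ • triple (P.penaltyGradient u.fst) 0

/-- Outer loop: the iterates `u^0, u^1, …` for given sample sequences, inner-loop starting points
`w0 k`, constant step size `α` and batch sizes `r`, `q`, `s`. -/
def iterates (η ρ c₁ c₂ α : ℝ) (r q s : ℕ) (u0 : XYZ m n p) (w0 : ℕ → Vec n)
    (ζ : ℕ → ℕ → Zt) (ξ ξt : ℕ → ℕ → Xi) : ℕ → XYZ m n p
  | 0 => u0
  | k + 1 =>
    let u := iterates η ρ c₁ c₂ α r q s u0 w0 ζ ξ ξt k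
    let wl := P.salm η ρ u.fst.fst u.snd (w0 k) (ξ k) s
    proj P.U (u - α • P.direction c₁ c₂ r q u wl.1 wl.2 (ζ k) (ξt k))

end Problem

/-! ### Samples -/

/-- Labels of the random samples: `ζ^k_j`, `ξ^k_j` and `ξ̃^k_j`. -/
inductive Label
  | zeta (k j : ℕ)
  | xi (k j : ℕ)
  | xit (k j : ℕ)

/-- The outer iteration in which a sample is drawn. -/
def Label.iteration : Label → ℕ
  | .zeta k _ => k
  | .xi k _ => k
  | .xit k _ => k

section Samples

variable {Ω Zt Xi : Type*} [MeasurableSpace Zt] [MeasurableSpace Xi]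

/-- The σ-algebra generated by a single sample. -/
@[reducible] def sampleSigma (ζ : ℕ → ℕ → Ω → Zt) (ξ ξt : ℕ → ℕ → Ω → Xi) : Label → MeasurableSpace Ω
  | .zeta k j => MeasurableSpace.comap (ζ k j) inferInstance
  | .xi k j => MeasurableSpace.comap (ξ k j) inferInstance
  | .xit k j => MeasurableSpace.comap (ξt k j) inferInstance

/-- The σ-algebra generated by all samples drawn before outer iteration `k`. -/
@[reducible] def past (ζ : ℕ → ℕ → Ω → Zt) (ξ ξt : ℕ → ℕ → Ω → Xi) (k : ℕ) : MeasurableSpace Ω :=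
  ⨆ i : Label, ⨆ _ : i.iteration < k, sampleSigma ζ ξ ξt i

/-- The samples are jointly independent, `ζ^k_j ∼ D_ζ` and `ξ^k_j, ξ̃^k_j ∼ D_ξ`. -/
def IIDSamples [MeasurableSpace Ω] (μ : Measure Ω) (Dζ : Measure Zt) (Dξ : Measure Xi)
    (ζ : ℕ → ℕ → Ω → Zt) (ξ ξt : ℕ → ℕ → Ω → Xi) : Prop :=
  (∀ k j, Measurable (ζ k j) ∧ μ.map (ζ k j) = Dζ) ∧
  (∀ k j, Measurable (ξ k j) ∧ μ.map (ξ k j) = Dξ) ∧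
  (∀ k j, Measurable (ξt k j) ∧ μ.map (ξt k j) = Dξ) ∧
  iIndep (sampleSigma ζ ξ ξt) μ

end Samples

end SALVF

end

/-!
The regularised Lagrangian `ℓ(x, z, w, λ) = ℒ(x, w, λ) - γ₂ / 2 ‖λ - z‖²` is `μ`-strongly convex in
`w` and `γ₂`-strongly concave in `λ`. Hence the max-min problem that defines `E(x, z)` has a
unique solution `(w*, λ*)`, and it is a saddle point with quadratic growth in both blocks
(`Standing.ell_wStar_add_le`, `Standing.ell_lamStar_add_le`). Everything else rests on these two
growth inequalities.

*Gradient of the gap.* Adding the growth inequalities at two parameters shows that `(w*, λ*)` is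
Lipschitz in `(x, z)` (`Standing.exists_norm_star_sub_le`). Squeezing `E(x', z') - E(x, z)` between
`ℓ(x', z', ·) - ℓ(x, z, ·)` at mixed saddle points then gives the envelope theorem with a quadratic
remainder (`Standing.exists_abs_env_sub_le`), hence the gradient of the gap and its Lipschitz
continuity.

*Inner loop.* The growth inequalities also say that the saddle operator is strongly monotone at
the solution. With step sizes `η / (j + 1)`, `ρ / (j + 1)`, `η ≥ 1 / μ`, `ρ ≥ 1 / γ₂`, the weighted
squared distance to `(w*, λ*)` satisfies `a_{j+1} ≤ (1 - 2 / (j + 1)) a_j + M / (j + 1)²` in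
expectation: each stochastic gradient uses a fresh sample, so its noise is orthogonal to the past
(`IsOracle.integral_inner_noise_eq_zero`), and the multipliers stay bounded
(`Standing.salm_mem`). Therefore `a_s ≤ M / s` (`Standing.exists_integral_salm_le`).

*Outer loop.* The direction `d` errs by the noise of two mini-batches and by a Lipschitz multiple
of the inaccuracy of the inner loop, so its mean squared error is
`O(1 / r + c₁² / q + c₁² / s)` (`Standing.exists_integral_error_le`). A projected step with
`α LΨ ≤ 1 / 2` satisfies `‖u⁺ - u‖² / (4 α) ≤ Ψ(u) - Ψ(u⁺) + α ‖∇Ψ(u) - d‖²`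
(`projected_step_le`), and the sum over the iterations telescopes. In the first bound the factors
depending on `c₁`, `c₂` disappear because `α LF`, `α c₁ Lgap`, `α c₂ Lpen` are all at most
`1 / 2`, so that `α Ψ` has oscillation over `𝒰` bounded by a constant (`Standing.exists_mul_Psi_sub_le`).
-/

noncomputable section

namespace SALVF

open Set Filter Topology
open scoped RealInnerProductSpace

/-! ### Projections, quadratic bounds and strong convexity -/

theorem argminOn_spec {α : Type*} [Nonempty α] {S : Set α} {f : α → ℝ}
    (h : ∃ a ∈ S, ∀ b ∈ S, f a ≤ f b) :
    argminOn S f ∈ S ∧ ∀ b ∈ S, f (argminOn S f) ≤ f b :=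
  Classical.epsilon_spec (p := fun a => a ∈ S ∧ ∀ b ∈ S, f a ≤ f b) h

section InnerProduct

variable {E : Type*} [NormedAddCommGroup E] [InnerProductSpace ℝ E]

section Projection

variable [CompleteSpace E] {C : Set E} (hC : Convex ℝ C) (hCc : IsClosed C) (hne : C.Nonempty)
include hC hCc hne

theorem proj_spec (a : E) : proj C a ∈ C ∧ ∀ b ∈ C, ‖proj C a - a‖ ≤ ‖b - a‖ := by
  refine argminOn_spec (f := fun b => ‖b - a‖) ?_
  obtain ⟨v, hv, h⟩ := exists_norm_eq_iInf_of_complete_convex hne hCc.isComplete hC a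
  refine ⟨v, hv, fun b hb => ?_⟩
  rw [norm_sub_rev v, norm_sub_rev b, h]
  exact ciInf_le (f := fun w : C => ‖a - w‖)
    ⟨0, by rintro _ ⟨w, rfl⟩; exact norm_nonneg _⟩ ⟨b, hb⟩

theorem proj_mem (a : E) : proj C a ∈ C := (proj_spec hC hCc hne a).1

theorem inner_sub_proj_le_zero (a : E) {b : E} (hb : b ∈ C) :
    ⟪a - proj C a, b - proj C a⟫ ≤ 0 := by
  have hs := proj_spec hC hCc hne a
  refine (norm_eq_iInf_iff_real_inner_le_zero hC hs.1).1 ?_ b hb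
  have : Nonempty C := ⟨⟨_, hs.1⟩⟩
  refine le_antisymm (le_ciInf fun w => ?_) (ciInf_le (f := fun w : C => ‖a - w‖)
    ⟨0, by rintro _ ⟨w, rfl⟩; exact norm_nonneg _⟩ ⟨_, hs.1⟩)
  rw [norm_sub_rev a, norm_sub_rev a]
  exact hs.2 w w.2

theorem proj_eq_of_inner_le_zero {a q : E} (hq : q ∈ C) (h : ∀ b ∈ C, ⟪a - q, b - q⟫ ≤ 0) :
    proj C a = q := by
  have h1 := inner_sub_proj_le_zero hC hCc hne a hq
  have h2 := h _ (proj_mem hC hCc hne a)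
  set x := proj C a
  have h3 : ⟪q - x, q - x⟫ = ⟪a - x, q - x⟫ + ⟪a - q, x - q⟫ := by
    simp only [inner_sub_left, inner_sub_right, real_inner_comm]; ring
  rw [real_inner_self_eq_norm_sq] at h3
  have h4 : ‖q - x‖ ^ 2 ≤ 0 := by linarith
  have h5 : ‖q - x‖ = 0 := by nlinarith [norm_nonneg (q - x)]
  exact (sub_eq_zero.1 (norm_eq_zero.1 h5)).symm

theorem norm_proj_sub_proj_le (a b : E) : ‖proj C a - proj C b‖ ≤ ‖a - b‖ := by
  have h1 := inner_sub_proj_le_zero hC hCc hne a (proj_mem hC hCc hne b)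
  have h2 := inner_sub_proj_le_zero hC hCc hne b (proj_mem hC hCc hne a)
  set x := proj C a
  set y := proj C b
  have h3 : ⟪a - b, x - y⟫ = ⟪x - y, x - y⟫ - ⟪a - x, y - x⟫ - ⟪b - y, x - y⟫ := by
    simp only [inner_sub_left, inner_sub_right, real_inner_comm]; ring
  have h4 := real_inner_le_norm (a - b) (x - y)
  rw [real_inner_self_eq_norm_sq] at h3
  by_contra! h
  nlinarith [norm_nonneg (x - y), norm_nonneg (a - b)]

theorem continuous_proj : Continuous (proj C) :=
  (LipschitzWith.of_dist_le_mul (K := 1) fun a b => by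
    simpa [dist_eq_norm] using norm_proj_sub_proj_le hC hCc hne a b).continuous

theorem proj_eq_self {a : E} (ha : a ∈ C) : proj C a = a := by
  have := (proj_spec hC hCc hne a).2 a ha
  simpa [sub_eq_zero] using this

theorem norm_proj_sub_le {b : E} (hb : b ∈ C) (a : E) : ‖proj C a - b‖ ≤ ‖a - b‖ := by
  simpa [proj_eq_self hC hCc hne hb] using norm_proj_sub_proj_le hC hCc hne a b

end Projection

/-- A quadratic bound on the first-order Taylor remainder (with constant `L` instead of the sharp
`L / 2`). -/
theorem abs_sub_sub_inner_le [CompleteSpace E] {S : Set E} (hS : Convex ℝ S) {f : E → ℝ}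
    {g : E → E} (hf : ∀ u ∈ S, HasGradientWithinAt f (g u) S u) {L : ℝ} (hL : 0 ≤ L)
    {u v : E} (hu : u ∈ S) (hv : v ∈ S) (hg : ∀ w ∈ S, ‖g w - g u‖ ≤ L * ‖w - u‖) :
    |f v - f u - ⟪g u, v - u⟫| ≤ L * ‖v - u‖ ^ 2 := by
  have hseg : segment ℝ u v ⊆ S := hS.segment_subset hu hv
  have key := Convex.norm_image_sub_le_of_norm_hasFDerivWithin_le'
    (𝕜 := ℝ) (f := f) (s := segment ℝ u v) (x := u) (y := v) (C := L * ‖v - u‖)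
    (f' := fun w => InnerProductSpace.toDual ℝ E (g w)) (φ := InnerProductSpace.toDual ℝ E (g u))
    (fun w hw => ((hf w (hseg hw)).hasFDerivWithinAt).mono hseg) ?_ (convex_segment u v)
    (left_mem_segment ℝ u v) (right_mem_segment ℝ u v)
  · simp only [InnerProductSpace.toDual_apply_apply, Real.norm_eq_abs] at key
    linarith [key, show L * ‖v - u‖ * ‖v - u‖ = L * ‖v - u‖ ^ 2 by ring]
  · intro w hw
    rw [← map_sub, LinearIsometryEquiv.norm_map]
    refine (hg w (hseg hw)).trans (mul_le_mul_of_nonneg_left ?_ hL)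
    obtain ⟨t, ht, rfl⟩ := (segment_eq_image' ℝ u v ▸ hw :)
    simp only [add_sub_cancel_left, norm_smul, Real.norm_eq_abs, abs_of_nonneg ht.1]
    exact mul_le_of_le_one_left (norm_nonneg _) ht.2

theorem abs_sub_le_of_norm_gradient_le [CompleteSpace E] {S : Set E} (hS : Convex ℝ S)
    {f : E → ℝ} {g : E → E} (hf : ∀ u ∈ S, HasGradientWithinAt f (g u) S u) {C : ℝ}
    (hg : ∀ u ∈ S, ‖g u‖ ≤ C) {u v : E} (hu : u ∈ S) (hv : v ∈ S) :
    |f v - f u| ≤ C * ‖v - u‖ :=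
  hS.norm_image_sub_le_of_norm_hasFDerivWithin_le (𝕜 := ℝ)
    (f' := fun w => InnerProductSpace.toDual ℝ E (g w)) (fun w hw => (hf w hw).hasFDerivWithinAt)
    (fun w hw => by rw [LinearIsometryEquiv.norm_map]; exact hg w hw) hu hv

theorem _root_.HasGradientWithinAt.continuousWithinAt_of_inner [CompleteSpace E] {f : E → ℝ}
    {g u : E} {S : Set E} (h : HasGradientWithinAt f g S u) : ContinuousWithinAt f S u :=
  h.hasFDerivWithinAt.continuousWithinAt

theorem _root_.HasGradientAt.gradientWithinAt [CompleteSpace E] {S : Set E} {f : E → ℝ} {g u : E}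
    (h : HasGradientAt f g u) : HasGradientWithinAt f g S u :=
  h.hasFDerivAt.hasFDerivWithinAt

theorem _root_.HasGradientAt.sub_hasGradientAt [CompleteSpace E] {f₁ f₂ : E → ℝ} {g₁ g₂ u : E}
    (h₁ : HasGradientAt f₁ g₁ u) (h₂ : HasGradientAt f₂ g₂ u) :
    HasGradientAt (fun v => f₁ v - f₂ v) (g₁ - g₂) u := by
  rw [hasGradientAt_iff_hasFDerivAt, map_sub]
  exact h₁.hasFDerivAt.sub h₂.hasFDerivAt

/-- A first-order expansion with quadratic remainder on `S` identifies the gradient within `S`. -/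
theorem hasGradientWithinAt_of_abs_le [CompleteSpace E] {S : Set E} {f : E → ℝ} {g u : E} {C : ℝ}
    (h : ∀ v ∈ S, |f v - f u - ⟪g, v - u⟫| ≤ C * ‖v - u‖ ^ 2) : HasGradientWithinAt f g S u := by
  rw [hasGradientWithinAt_iff_isLittleO]
  have h1 : (fun v => f v - f u - ⟪g, v - u⟫) =O[𝓝[S] u] fun v => ‖v - u‖ ^ 2 := by
    refine Asymptotics.IsBigO.of_bound C ?_
    filter_upwards [self_mem_nhdsWithin] with v hv
    simpa using h v hv
  refine h1.trans_isLittleO ?_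
  have h2 : (fun v : E => ‖v - u‖ ^ 2) =o[𝓝 u] fun v => v - u := by
    have h3 : (fun v : E => v - u) =o[𝓝 u] fun _ => (1 : ℝ) := by
      rw [Asymptotics.isLittleO_one_iff]
      have : Tendsto (fun v : E => v - u) (𝓝 u) (𝓝 (u - u)) :=
        (continuous_id.sub continuous_const).tendsto u
      simpa using this
    have h4 := h3.norm_left.mul_isBigO (Asymptotics.isBigO_refl (fun v : E => ‖v - u‖) (𝓝 u))
    simp only [one_mul, ← pow_two] at h4
    exact h4.norm_right.congr_right (fun v => by simp) |>.of_norm_right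
  exact h2.mono nhdsWithin_le_nhds

/-- The gradient inequality for strongly convex functions. -/
theorem _root_.StrongConvexOn.add_inner_add_le [CompleteSpace E] {S : Set E} {μ : ℝ} {f : E → ℝ}
    (hf : StrongConvexOn S μ f) {x y g : E} (hx : x ∈ S) (hy : y ∈ S)
    (hg : HasGradientAt f g x) : f x + ⟪g, y - x⟫ + μ / 2 * ‖y - x‖ ^ 2 ≤ f y := by
  have hd : HasDerivAt (fun t : ℝ => f (x + t • (y - x))) ⟪g, y - x⟫ 0 := by
    have h1 : HasDerivAt (fun t : ℝ => x + t • (y - x)) (y - x) 0 := by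
      simpa using ((hasDerivAt_id (0 : ℝ)).smul_const (y - x)).const_add x
    have h2 : HasFDerivAt f (InnerProductSpace.toDual ℝ E g) (x + (0 : ℝ) • (y - x)) := by
      simpa using hg.hasFDerivAt
    have h3 := h2.comp_hasDerivAt (0 : ℝ) h1
    rw [InnerProductSpace.toDual_apply_apply] at h3
    exact h3
  have hslope := (hasDerivAt_iff_tendsto_slope.1 hd).mono_left
    (nhdsWithin_mono 0 (fun t (ht : t ∈ Ioi (0 : ℝ)) => ne_of_gt ht))
  have hlim : Tendsto (fun t : ℝ => f y - f x - (1 - t) * (μ / 2 * ‖y - x‖ ^ 2)) (𝓝[>] 0)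
      (𝓝 (f y - f x - (1 - 0) * (μ / 2 * ‖y - x‖ ^ 2))) := by
    refine Tendsto.mono_left (Continuous.tendsto ?_ 0) nhdsWithin_le_nhds
    fun_prop
  have := le_of_tendsto_of_tendsto hslope hlim ?_
  · linarith
  filter_upwards [Ioo_mem_nhdsGT (show (0 : ℝ) < 1 by norm_num)] with t ht
  have h3 := hf.2 hx hy (show 0 ≤ 1 - t by linarith [ht.2]) ht.1.le (by ring)
  have h4 : (1 - t) • x + t • y = x + t • (y - x) := by module
  rw [h4] at h3
  simp only [smul_eq_mul, norm_sub_rev x y] at h3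
  rw [slope_def_field]
  simp only [sub_zero, zero_smul, add_zero]
  rw [div_le_iff₀ ht.1]
  nlinarith [h3]

/-- Quadratic growth of a strongly convex function at a minimiser. -/
theorem _root_.StrongConvexOn.add_le_of_forall_le {S : Set E} {μ : ℝ} {f : E → ℝ}
    (hf : StrongConvexOn S μ f) {x y : E} (hx : x ∈ S) (hy : y ∈ S) (hmin : ∀ z ∈ S, f x ≤ f z) :
    f x + μ / 2 * ‖y - x‖ ^ 2 ≤ f y := by
  have hlim : Tendsto (fun t : ℝ => f x + (1 - t) * (μ / 2 * ‖y - x‖ ^ 2)) (𝓝[>] 0)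
      (𝓝 (f x + (1 - 0) * (μ / 2 * ‖y - x‖ ^ 2))) := by
    refine Tendsto.mono_left (Continuous.tendsto ?_ 0) nhdsWithin_le_nhds
    fun_prop
  have := le_of_tendsto hlim (b := f y) ?_
  · linarith
  filter_upwards [Ioo_mem_nhdsGT (show (0 : ℝ) < 1 by norm_num)] with t ht
  have h3 := hf.2 hx hy (show 0 ≤ 1 - t by linarith [ht.2]) ht.1.le (by ring)
  have h4 := hmin _ (hf.1 hx hy (show 0 ≤ 1 - t by linarith [ht.2]) ht.1.le (by ring))
  simp only [smul_eq_mul, norm_sub_rev x y] at h3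
  have h5 : t * (f x + (1 - t) * (μ / 2 * ‖y - x‖ ^ 2)) ≤ t * f y := by nlinarith
  exact le_of_mul_le_mul_left h5 ht.1

/-- One projected step `u⁺ = Proj_C (u - α d)` on a function with quadratic upper model decreases
it by `‖u⁺ - u‖² / (4 α)`, up to the squared error of the direction `d`. -/
theorem projected_step_le [CompleteSpace E] {C : Set E} (hC : Convex ℝ C) (hCc : IsClosed C)
    {f : E → ℝ} {u d g : E} (hu : u ∈ C) {L α : ℝ} (hα : 0 < α) (hαL : α * L ≤ 1 / 2)
    (hf : ∀ v ∈ C, f v - f u - ⟪g, v - u⟫ ≤ L * ‖v - u‖ ^ 2) :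
    1 / (4 * α) * ‖proj C (u - α • d) - u‖ ^ 2 ≤
      f u - f (proj C (u - α • d)) + α * ‖g - d‖ ^ 2 := by
  have hp := inner_sub_proj_le_zero hC hCc ⟨u, hu⟩ (u - α • d) hu
  have hm := proj_mem hC hCc ⟨u, hu⟩ (u - α • d)
  set v := proj C (u - α • d)
  have h1 := hf v hm
  have h2 : ⟪u - α • d - v, u - v⟫ = ‖v - u‖ ^ 2 + α * ⟪d, v - u⟫ := by
    rw [show u - α • d - v = -(v - u) - α • d by abel, show u - v = -(v - u) by abel,
      inner_sub_left, inner_neg_neg, real_inner_self_eq_norm_sq, inner_smul_left, inner_neg_right]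
    simp
  have h3 : ⟪g, v - u⟫ - ⟪d, v - u⟫ ≤ ‖g - d‖ * ‖v - u‖ := by
    rw [← inner_sub_left]; exact real_inner_le_norm _ _
  rw [h2] at hp
  set a := ‖v - u‖
  set b := ‖g - d‖
  have h4 : 1 / (4 * α) * a ^ 2 = a ^ 2 / (4 * α) := by ring
  rw [h4, div_le_iff₀ (by positivity)]
  have h5 : α * (f v - f u) ≤ α * ⟪g, v - u⟫ + α * L * a ^ 2 := by nlinarith
  have h6 : α * L * a ^ 2 ≤ 1 / 2 * a ^ 2 := by gcongr
  have h7 : α * ⟪g, v - u⟫ ≤ α * ⟪d, v - u⟫ + α * (b * a) := by nlinarith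
  nlinarith [sq_nonneg (2 * α * b - a)]

end InnerProduct

/-! ### The Lagrangian: derivatives, convexity in `w`, concavity in `λ` -/

/-- The squared positive part lies below its quadratic upper model with curvature `2`. -/
theorem sq_max_zero_le (a b : ℝ) :
    max 0 b ^ 2 ≤ max 0 a ^ 2 + 2 * max 0 a * (b - a) + (b - a) ^ 2 := by
  rcases le_total 0 a with ha | ha <;> rcases le_total 0 b with hb | hb <;> simp [ha, hb] <;>
    nlinarith

theorem sq_max_zero_ge (a b : ℝ) : max 0 a ^ 2 + 2 * max 0 a * (b - a) ≤ max 0 b ^ 2 := by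
  rcases le_total 0 a with ha | ha <;> rcases le_total 0 b with hb | hb <;> simp [ha, hb] <;>
    nlinarith [sq_nonneg (b - a)]

theorem hasDerivAt_sq_max_zero (a : ℝ) : HasDerivAt (fun t : ℝ => max 0 t ^ 2) (2 * max 0 a) a := by
  refine HasGradientAt.hasDerivAt' (hasGradientWithinAt_univ.1
    (hasGradientWithinAt_of_abs_le (C := 1) fun b _ => ?_))
  have h1 := sq_max_zero_le a b
  have h2 := sq_max_zero_ge a b
  simp only [Real.inner_apply, Real.norm_eq_abs, sq_abs, one_mul]
  rw [abs_of_nonneg] <;> linarith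

theorem abs_max_zero_sub_le (a b : ℝ) : |max 0 a - max 0 b| ≤ |a - b| := by
  simpa [max_comm] using abs_max_sub_max_le_abs a b 0

theorem convexOn_finset_sum {E ι : Type*} [AddCommGroup E] [Module ℝ E] {S : Set E}
    (t : Finset ι) (hS : Convex ℝ S) {f : ι → E → ℝ} (h : ∀ i ∈ t, ConvexOn ℝ S (f i)) :
    ConvexOn ℝ S fun x => ∑ i ∈ t, f i x := by
  classical
  induction t using Finset.induction_on with
  | empty => simpa using convexOn_const 0 hS
  | insert a t ha ih =>
    simp only [Finset.sum_insert ha]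
    exact (h a (Finset.mem_insert_self a t)).add
      (ih fun i hi => h i (Finset.mem_insert_of_mem hi))

section WithLp

variable {m n : ℕ}

theorem inner_pair (g : XY m n) (x : Vec m) (y : Vec n) :
    ⟪g, pair x y⟫ = ⟪g.fst, x⟫ + ⟪g.snd, y⟫ := rfl

theorem pair_sub_pair (x x' : Vec m) (y y' : Vec n) :
    pair x y - pair x' y' = pair (x - x') (y - y') := rfl

theorem pair_zero_sub {E F : Type*} [AddCommGroup E] [AddCommGroup F] (a b : E) :
    WithLp.toLp 2 (a, (0 : F)) - WithLp.toLp 2 (b, (0 : F)) = WithLp.toLp 2 (a - b, (0 : F)) := by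
  rw [← WithLp.toLp_sub, Prod.mk_sub_mk, sub_zero]

theorem norm_pair_zero_right (x : Vec m) : ‖(pair x 0 : XY m n)‖ = ‖x‖ := by
  have h' : ‖(pair x 0 : XY m n)‖ ^ 2 = ‖x‖ ^ 2 := by simp
  exact (sq_eq_sq₀ (norm_nonneg _) (norm_nonneg _)).1 h'

theorem norm_pair_zero_left (y : Vec n) : ‖(pair 0 y : XY m n)‖ = ‖y‖ := by
  have h' : ‖(pair 0 y : XY m n)‖ ^ 2 = ‖y‖ ^ 2 := by simp
  exact (sq_eq_sq₀ (norm_nonneg _) (norm_nonneg _)).1 h'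

theorem norm_pair_sub_left (x : Vec m) (y y' : Vec n) : ‖pair x y - pair x y'‖ = ‖y - y'‖ := by
  rw [pair_sub_pair x x y y', sub_self, norm_pair_zero_left]

theorem norm_pair_sub_right (x x' : Vec m) (y : Vec n) : ‖pair x y - pair x' y‖ = ‖x - x'‖ := by
  rw [pair_sub_pair x x' y y, sub_self, norm_pair_zero_right]

theorem continuous_pair : Continuous fun q : Vec m × Vec n => pair q.1 q.2 :=
  WithLp.prod_continuous_toLp 2 _ _

theorem norm_fst_le {E F : Type*} [NormedAddCommGroup E] [NormedAddCommGroup F]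
    (g : WithLp 2 (E × F)) : ‖g.fst‖ ≤ ‖g‖ := by
  have h := WithLp.prod_norm_sq_eq_of_L2 g
  exact le_of_sq_le_sq (by nlinarith [sq_nonneg ‖g.snd‖]) (norm_nonneg _)

theorem norm_snd_le {E F : Type*} [NormedAddCommGroup E] [NormedAddCommGroup F]
    (g : WithLp 2 (E × F)) : ‖g.snd‖ ≤ ‖g‖ := by
  have h := WithLp.prod_norm_sq_eq_of_L2 g
  exact le_of_sq_le_sq (by nlinarith [sq_nonneg ‖g.fst‖]) (norm_nonneg _)

theorem norm_le_norm_fst_add_norm_snd {E F : Type*} [NormedAddCommGroup E] [NormedAddCommGroup F]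
    (g : WithLp 2 (E × F)) : ‖g‖ ≤ ‖g.fst‖ + ‖g.snd‖ := by
  have h := WithLp.prod_norm_sq_eq_of_L2 g
  exact le_of_sq_le_sq (by nlinarith [mul_nonneg (norm_nonneg g.fst) (norm_nonneg g.snd)])
    (by positivity)

theorem hasGradientAt_comp_pair_left {f : XY m n → ℝ} {g : XY m n} {x : Vec m} {y : Vec n}
    (h : HasGradientAt f g (pair x y)) : HasGradientAt (fun x => f (pair x y)) g.fst x := by
  rw [hasGradientAt_iff_isLittleO] at h ⊢
  have ht : Tendsto (fun x' : Vec m => pair x' y) (𝓝 x) (𝓝 (pair x y)) :=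
    (continuous_pair.comp (by fun_prop : Continuous fun x' : Vec m => (x', y))).tendsto x
  refine (h.comp_tendsto ht).congr' (Eventually.of_forall fun x' => ?_)
    (Eventually.of_forall fun x' => rfl) |>.trans_isBigO ?_
  · simp
  · refine Asymptotics.IsBigO.of_bound 1 (Eventually.of_forall fun x' => ?_)
    simp only [Function.comp_apply, pair_sub_pair, sub_self, norm_pair_zero_right, one_mul, le_refl]

theorem hasGradientAt_comp_pair_right {f : XY m n → ℝ} {g : XY m n} {x : Vec m} {y : Vec n}
    (h : HasGradientAt f g (pair x y)) : HasGradientAt (fun y => f (pair x y)) g.snd y := by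
  rw [hasGradientAt_iff_isLittleO] at h ⊢
  have ht : Tendsto (fun y' : Vec n => pair x y') (𝓝 y) (𝓝 (pair x y)) :=
    (continuous_pair.comp (by fun_prop : Continuous fun y' : Vec n => (x, y'))).tendsto y
  refine (h.comp_tendsto ht).congr' (Eventually.of_forall fun x' => ?_)
    (Eventually.of_forall fun x' => rfl) |>.trans_isBigO ?_
  · simp
  · refine Asymptotics.IsBigO.of_bound 1 (Eventually.of_forall fun x' => ?_)
    simp only [Function.comp_apply, pair_sub_pair, sub_self, norm_pair_zero_left, one_mul, le_refl]

/-- A vector with coordinates bounded by `c` has Euclidean norm at most `√d c`. -/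
theorem norm_le_sqrt_mul {d : ℕ} {z : Vec d} {c : ℝ} (hc : 0 ≤ c) (h : ∀ i, |z i| ≤ c) :
    ‖z‖ ≤ Real.sqrt d * c := by
  rw [EuclideanSpace.norm_eq]
  refine Real.sqrt_le_iff.2 ⟨by positivity, ?_⟩
  rw [mul_pow, Real.sq_sqrt (Nat.cast_nonneg d)]
  refine (Finset.sum_le_sum fun i _ => ?_).trans_eq
    (by rw [Finset.sum_const, Finset.card_univ, Fintype.card_fin, nsmul_eq_mul])
  simpa using pow_le_pow_left₀ (abs_nonneg _) (h i) 2

theorem abs_apply_le_norm {d : ℕ} (z : Vec d) (i : Fin d) : |z i| ≤ ‖z‖ := by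
  simpa using PiLp.norm_apply_le z i

end WithLp

theorem convex_orthant (p : ℕ) : Convex ℝ (orthant p) := by
  intro a ha b hb s t hs ht _ i
  have h1 := ha i
  have h2 := hb i
  simp only [PiLp.add_apply, PiLp.smul_apply, smul_eq_mul]
  positivity

theorem isClosed_orthant (p : ℕ) : IsClosed (orthant p) := by
  simp only [orthant, ofPred_forall]
  exact isClosed_iInter fun i => isClosed_le continuous_const (by fun_prop)

theorem zero_mem_orthant (p : ℕ) : (0 : Vec p) ∈ orthant p := fun i => by simp

namespace Problem

variable {m n p : ℕ} {Zt Xi : Type*}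

/-- The hypotheses on the lower level of the problem and on the domain. -/
structure Standing (P : Problem m n p Zt Xi) (LG LH : ℝ≥0) (μ MG M0 M1 : ℝ) : Prop where
  convX : Convex ℝ P.X
  compX : IsCompact P.X
  convY : Convex ℝ P.Y
  compY : IsCompact P.Y
  γ₁_pos : 0 < P.γ₁
  γ₂_pos : 0 < P.γ₂
  B_nonneg : 0 ≤ P.B
  diffG : ∀ v ∈ P.domXY, DifferentiableAt ℝ P.G v
  lipG : LipschitzOnWith LG (∇ P.G) P.domXY
  diffH : ∀ i, ∀ v ∈ P.domXY, DifferentiableAt ℝ (P.H i) v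
  lipH : ∀ i, LipschitzOnWith LH (∇ (P.H i)) P.domXY
  μ_pos : 0 < μ
  convexity : P.Convexity μ
  MG_nonneg : 0 ≤ MG
  M0_nonneg : 0 ≤ M0
  M1_nonneg : 0 ≤ M1
  bounded : P.Bounded MG M0 M1

/-- The regularised Lagrangian `ℓ(x, z, w, λ) = ℒ(x, w, λ) - γ₂ / 2 ‖λ - z‖²`. -/
def ell (P : Problem m n p Zt Xi) (x : Vec m) (z : Vec p) (w : Vec n) (l : Vec p) : ℝ :=
  P.augLag x w l - P.γ₂ / 2 * ‖l - z‖ ^ 2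

/-- The gradient of `ℓ` in `λ`. -/
def gradDual (P : Problem m n p Zt Xi) (x : Vec m) (z : Vec p) (w : Vec n) (l : Vec p) : Vec p :=
  WithLp.toLp 2 fun i =>
    max 0 (P.γ₁ * l i + P.H i (pair x w)) - P.γ₁ * l i - P.γ₂ * (l i - z i)

variable {P : Problem m n p Zt Xi}

theorem convex_Z (P : Problem m n p Zt Xi) : Convex ℝ P.Z := by
  intro a ha b hb s t hs ht hst i
  have h1 := ha i
  have h2 := hb i
  simp only [PiLp.add_apply, PiLp.smul_apply, smul_eq_mul]
  refine ⟨by nlinarith [mul_nonneg hs h1.1, mul_nonneg ht h2.1], ?_⟩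
  calc s * a i + t * b i ≤ s * (P.B / Real.sqrt p) + t * (P.B / Real.sqrt p) := by
        gcongr <;> [exact h1.2; exact h2.2]
    _ = P.B / Real.sqrt p := by rw [← add_mul, hst, one_mul]

theorem isCompact_Z (hB : 0 ≤ P.B) : IsCompact P.Z := by
  refine Metric.isCompact_of_isClosed_isBounded ?_ ?_
  · simp only [Z, ofPred_forall, ofPred_and]
    exact isClosed_iInter fun i => (isClosed_le continuous_const (by fun_prop)).inter
      (isClosed_le (by fun_prop) continuous_const)
  · refine isBounded_iff_forall_norm_le.2 ⟨Real.sqrt p * (P.B / Real.sqrt p), fun z hz => ?_⟩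
    exact norm_le_sqrt_mul (by positivity) fun i => by
      rw [abs_of_nonneg (hz i).1]; exact (hz i).2

theorem hasGradientAt_augLag_of {l : Vec p} {v : XY m n} (hγ : 0 < P.γ₁)
    (hG : DifferentiableAt ℝ P.G v) (hH : ∀ i, DifferentiableAt ℝ (P.H i) v) :
    HasGradientAt (fun v : XY m n => P.augLag v.fst v.snd l) (P.gradLag (∇ P.G v) v l) v := by
  have h1 : ∀ i, HasFDerivAt
      (fun v => max 0 (P.γ₁ * l i + P.H i v) ^ 2 - (P.γ₁ * l i) ^ 2)
      ((2 * max 0 (P.γ₁ * l i + P.H i v)) • InnerProductSpace.toDual ℝ _ (∇ (P.H i) v)) v :=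
    fun i => ((hasDerivAt_sq_max_zero _).comp_hasFDerivAt v
      ((hH i).hasGradientAt.hasFDerivAt.const_add (P.γ₁ * l i))).sub_const _
  have h2 := hG.hasGradientAt.hasFDerivAt.add
    ((HasFDerivAt.fun_sum (u := Finset.univ) fun i _ => h1 i).const_mul (1 / (2 * P.γ₁)))
  rw [hasGradientAt_iff_hasFDerivAt]
  refine h2.congr_fderiv ?_
  simp only [gradLag, map_add, map_smul, map_sum, Finset.smul_sum, smul_smul]
  congr 1
  refine Finset.sum_congr rfl fun i _ => ?_
  congr 1
  field_simp

namespace Standing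

variable {LG LH : ℝ≥0} {μ MG M0 M1 : ℝ} (hP : P.Standing LG LH μ MG M0 M1)
include hP

theorem convex_domXY : Convex ℝ P.domXY := fun _ ha _ hb _ _ hs ht hst =>
  ⟨hP.convX ha.1 hb.1 hs ht hst, hP.convY ha.2 hb.2 hs ht hst⟩

theorem isCompact_domXY : IsCompact P.domXY := by
  have : P.domXY = (fun q : Vec m × Vec n => pair q.1 q.2) '' (P.X ×ˢ P.Y) := by
    ext v
    exact ⟨fun h => ⟨(v.fst, v.snd), ⟨h.1, h.2⟩, rfl⟩, by rintro ⟨q, hq, rfl⟩; exact ⟨hq.1, hq.2⟩⟩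
  rw [this]
  exact (hP.compX.prod hP.compY).image continuous_pair

theorem convex_U : Convex ℝ P.U := fun _ ha _ hb _ _ hs ht hst =>
  ⟨hP.convex_domXY ha.1 hb.1 hs ht hst, P.convex_Z ha.2 hb.2 hs ht hst⟩

theorem isCompact_U : IsCompact P.U := by
  have : P.U = (fun q : XY m n × Vec p => triple q.1 q.2) '' (P.domXY ×ˢ P.Z) := by
    ext v
    exact ⟨fun h => ⟨(v.fst, v.snd), ⟨h.1, h.2⟩, rfl⟩, by rintro ⟨q, hq, rfl⟩; exact ⟨hq.1, hq.2⟩⟩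
  rw [this]
  exact (hP.isCompact_domXY.prod (isCompact_Z hP.B_nonneg)).image
    (WithLp.prod_continuous_toLp 2 _ _)

theorem hasGradientAt_augLag {v : XY m n} (hv : v ∈ P.domXY) (l : Vec p) :
    HasGradientAt (fun v : XY m n => P.augLag v.fst v.snd l) (P.gradLag (∇ P.G v) v l) v :=
  hasGradientAt_augLag_of hP.γ₁_pos (hP.diffG v hv) fun i => hP.diffH i v hv

theorem hasGradientAt_augLag_left {x : Vec m} (hx : x ∈ P.X) {w : Vec n} (hw : w ∈ P.Y)
    (l : Vec p) : HasGradientAt (fun x => P.augLag x w l)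
      (P.gradLag (∇ P.G (pair x w)) (pair x w) l).fst x :=
  hasGradientAt_comp_pair_left (hP.hasGradientAt_augLag (v := pair x w) ⟨hx, hw⟩ l)

theorem hasGradientAt_augLag_right {x : Vec m} (hx : x ∈ P.X) {w : Vec n} (hw : w ∈ P.Y)
    (l : Vec p) : HasGradientAt (fun w => P.augLag x w l)
      (P.gradLag (∇ P.G (pair x w)) (pair x w) l).snd w :=
  hasGradientAt_comp_pair_right (hP.hasGradientAt_augLag (v := pair x w) ⟨hx, hw⟩ l)

theorem continuousOn_augLag {x : Vec m} (hx : x ∈ P.X) (l : Vec p) :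
    ContinuousOn (fun w => P.augLag x w l) P.Y := fun _ hw =>
  (hP.hasGradientAt_augLag_right hx hw l).differentiableAt.continuousAt.continuousWithinAt

theorem strongConvexOn_augLag {x : Vec m} (hx : x ∈ P.X) (l : Vec p) :
    StrongConvexOn P.Y μ fun w => P.augLag x w l := by
  have h1 : ∀ i, ConvexOn ℝ P.Y fun w => max 0 (P.γ₁ * l i + P.H i (pair x w)) := fun i =>
    (convexOn_const 0 hP.convY).sup
      ((convexOn_const (P.γ₁ * l i) hP.convY).add ((hP.convexity x hx).2 i))
  have h2 : ∀ i, ConvexOn ℝ P.Y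
      fun w => max 0 (P.γ₁ * l i + P.H i (pair x w)) ^ 2 - (P.γ₁ * l i) ^ 2 := fun i =>
    ((h1 i).pow (fun _ _ => le_max_left _ _) 2).sub
      (concaveOn_const ((P.γ₁ * l i) ^ 2) hP.convY)
  have h3 : ConvexOn ℝ P.Y fun w => 1 / (2 * P.γ₁) *
      ∑ i, (max 0 (P.γ₁ * l i + P.H i (pair x w)) ^ 2 - (P.γ₁ * l i) ^ 2) := by
    have hγ := hP.γ₁_pos
    have := (convexOn_finset_sum Finset.univ hP.convY fun i _ => h2 i).smul
      (show 0 ≤ 1 / (2 * P.γ₁) by positivity)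
    simpa only [smul_eq_mul] using this
  have := UniformConvexOn.add (hP.convexity x hx).1 (uniformConvexOn_zero.2 h3)
  rwa [add_zero] at this

omit hP in
/-- `ℓ` is `γ₂`-strongly concave in `λ`, in the form of the gradient inequality. -/
theorem ell_le (hγ : 0 < P.γ₁) (x : Vec m) (z : Vec p) (w : Vec n) (l l' : Vec p) :
    P.ell x z w l' ≤ P.ell x z w l + ⟪P.gradDual x z w l, l' - l⟫ - P.γ₂ / 2 * ‖l' - l‖ ^ 2 := by
  have h1 : ∀ i, 1 / (2 * P.γ₁) *
        (max 0 (P.γ₁ * l' i + P.H i (pair x w)) ^ 2 - (P.γ₁ * l' i) ^ 2)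
      ≤ 1 / (2 * P.γ₁) * (max 0 (P.γ₁ * l i + P.H i (pair x w)) ^ 2 - (P.γ₁ * l i) ^ 2)
        + (max 0 (P.γ₁ * l i + P.H i (pair x w)) - P.γ₁ * l i) * (l' i - l i) := fun i => by
    have := sq_max_zero_le (P.γ₁ * l i + P.H i (pair x w)) (P.γ₁ * l' i + P.H i (pair x w))
    set s := max 0 (P.γ₁ * l i + P.H i (pair x w))
    set s' := max 0 (P.γ₁ * l' i + P.H i (pair x w))
    have e : (s - P.γ₁ * l i) * (l' i - l i)
        = 1 / (2 * P.γ₁) * (2 * (s - P.γ₁ * l i) * (P.γ₁ * l' i - P.γ₁ * l i)) := by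
      field_simp
    rw [e, ← mul_add]
    refine mul_le_mul_of_nonneg_left ?_ (by positivity)
    nlinarith
  have h2 := Finset.sum_le_sum fun i (_ : i ∈ Finset.univ) => h1 i
  rw [Finset.sum_add_distrib, ← Finset.mul_sum, ← Finset.mul_sum] at h2
  have h3 : ⟪P.gradDual x z w l, l' - l⟫
      = ∑ i, (max 0 (P.γ₁ * l i + P.H i (pair x w)) - P.γ₁ * l i) * (l' i - l i)
        - P.γ₂ * ⟪l - z, l' - l⟫ := by
    simp only [gradDual, PiLp.inner_apply, Real.inner_apply, PiLp.sub_apply, Finset.mul_sum,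
      ← Finset.sum_sub_distrib]
    exact Finset.sum_congr rfl fun i _ => by ring
  have h4 : ‖l' - z‖ ^ 2 = ‖l - z‖ ^ 2 + 2 * ⟪l - z, l' - l⟫ + ‖l' - l‖ ^ 2 := by
    rw [← norm_add_sq_real]; congr 2; abel
  simp only [ell, augLag]
  rw [h3, h4]
  linarith

omit hP in
/-- `ℓ` is `γ₂`-strongly concave in `λ`, along a segment. -/
theorem ell_segment_ge (hγ : 0 < P.γ₁) (x : Vec m) (z : Vec p) (w : Vec n) (l l' : Vec p)
    {t : ℝ} (ht0 : 0 ≤ t) (ht1 : t ≤ 1) :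
    (1 - t) * P.ell x z w l + t * P.ell x z w l' + t * (1 - t) * (P.γ₂ / 2 * ‖l' - l‖ ^ 2)
      ≤ P.ell x z w (l + t • (l' - l)) := by
  have h1 := ell_le (P := P) hγ x z w (l + t • (l' - l)) l
  have h2 := ell_le (P := P) hγ x z w (l + t • (l' - l)) l'
  set G := P.gradDual x z w (l + t • (l' - l))
  have e1 : l - (l + t • (l' - l)) = (-t) • (l' - l) := by module
  have e2 : l' - (l + t • (l' - l)) = (1 - t) • (l' - l) := by module
  rw [e1, inner_smul_right, norm_smul, mul_pow, Real.norm_eq_abs, sq_abs] at h1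
  rw [e2, inner_smul_right, norm_smul, mul_pow, Real.norm_eq_abs, sq_abs] at h2
  have h3 := mul_le_mul_of_nonneg_left h1 (sub_nonneg.2 ht1)
  have h4 := mul_le_mul_of_nonneg_left h2 ht0
  nlinarith

end Standing

end Problem

/-! ### The saddle point of the max-min problem -/

namespace Problem

variable {m n p : ℕ} {Zt Xi : Type*} {P : Problem m n p Zt Xi}

namespace Standing

variable {LG LH : ℝ≥0} {μ MG M0 M1 : ℝ} (hP : P.Standing LG LH μ MG M0 M1)
include hP

theorem argmin_augLag_spec (hY : P.Y.Nonempty) {x : Vec m} (hx : x ∈ P.X) (l : Vec p) :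
    argminOn P.Y (fun w => P.augLag x w l) ∈ P.Y ∧
      ∀ w ∈ P.Y, P.augLag x (argminOn P.Y fun w => P.augLag x w l) l ≤ P.augLag x w l :=
  argminOn_spec (hP.compY.exists_isMinOn hY (hP.continuousOn_augLag hx l))

theorem bddBelow_augLag {x : Vec m} (hx : x ∈ P.X) (l : Vec p) :
    BddBelow (range fun w : P.Y => P.augLag x w l) := by
  have := (hP.compY.image_of_continuousOn (hP.continuousOn_augLag hx l)).bddBelow
  rwa [image_eq_range] at this

theorem dual_le {x : Vec m} (hx : x ∈ P.X) (l : Vec p) {w : Vec n} (hw : w ∈ P.Y) :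
    P.dual x l ≤ P.augLag x w l :=
  ciInf_le (hP.bddBelow_augLag hx l) ⟨w, hw⟩

theorem dual_eq (hY : P.Y.Nonempty) {x : Vec m} (hx : x ∈ P.X) (l : Vec p) :
    P.dual x l = P.augLag x (argminOn P.Y fun w => P.augLag x w l) l := by
  have h := hP.argmin_augLag_spec hY hx l
  have : Nonempty P.Y := hY.to_subtype
  exact le_antisymm (hP.dual_le hx l h.1) (le_ciInf fun w => h.2 w w.2)

theorem upperSemicontinuous_dual {x : Vec m} (hx : x ∈ P.X) :
    UpperSemicontinuous fun l => P.dual x l := by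
  have h : ∀ w : P.Y, UpperSemicontinuous fun l => P.augLag x w l := fun w => by
    refine Continuous.upperSemicontinuous ?_
    simp only [augLag]
    fun_prop
  exact upperSemicontinuous_ciInf (fun l => hP.bddBelow_augLag hx l) h

/-- The regularised dual problem has a solution: the objective is upper semicontinuous, and
coercive by the strong concavity of `ℓ` in `λ`. -/
theorem exists_isMaxOn_dual (hY : P.Y.Nonempty) {x : Vec m} (hx : x ∈ P.X) (z : Vec p) :
    ∃ a ∈ orthant p, ∀ l ∈ orthant p,
      P.dual x l - P.γ₂ / 2 * ‖l - z‖ ^ 2 ≤ P.dual x a - P.γ₂ / 2 * ‖a - z‖ ^ 2 := by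
  set φ : Vec p → ℝ := fun l => P.dual x l - P.γ₂ / 2 * ‖l - z‖ ^ 2 with hφ
  have husc : UpperSemicontinuous φ := by
    have h1 : Continuous fun l : Vec p => -(P.γ₂ / 2 * ‖l - z‖ ^ 2) := by fun_prop
    simpa only [hφ, sub_eq_add_neg] using
      (hP.upperSemicontinuous_dual hx).add h1.upperSemicontinuous
  obtain ⟨w, hw⟩ := hY
  have hγ := hP.γ₂_pos
  set c := ‖P.gradDual x z w 0‖ with hc
  set D := |P.ell x z w 0 - φ 0| with hD
  set R := 1 + 2 * (c + D) / P.γ₂ with hR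
  have hc0 : 0 ≤ c := norm_nonneg _
  have hD0 : 0 ≤ D := abs_nonneg _
  have hR1 : 1 ≤ R := by
    have : 0 ≤ 2 * (c + D) / P.γ₂ := by positivity
    linarith
  have hfar : ∀ l, R ≤ ‖l‖ → φ l ≤ φ 0 := fun l hl => by
    have h1 : φ l ≤ P.ell x z w l := sub_le_sub_right (hP.dual_le hx l hw) _
    have h2 := ell_le (P := P) hP.γ₁_pos x z w 0 l
    rw [sub_zero] at h2
    have h3 := real_inner_le_norm (P.gradDual x z w 0) l
    have h4 : P.ell x z w 0 - φ 0 ≤ D := le_abs_self _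
    have h5 : (c + D) ≤ P.γ₂ / 2 * ‖l‖ := by
      have : P.γ₂ / 2 * R ≤ P.γ₂ / 2 * ‖l‖ := by gcongr
      have e : P.γ₂ / 2 * R = P.γ₂ / 2 + (c + D) := by rw [hR]; field_simp
      linarith
    nlinarith
  obtain ⟨a, ha, hmax⟩ := UpperSemicontinuousOn.exists_isMaxOn
    (s := orthant p ∩ Metric.closedBall 0 R) ⟨0, zero_mem_orthant p,
      Metric.mem_closedBall_self (by linarith)⟩
    ((isCompact_closedBall 0 R).inter_left (isClosed_orthant p)) (husc.upperSemicontinuousOn _)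
  refine ⟨a, ha.1, fun l hl => ?_⟩
  by_cases hlR : ‖l‖ ≤ R
  · exact hmax ⟨hl, by simpa using hlR⟩
  · exact (hfar l (le_of_not_ge hlR)).trans
      (hmax ⟨zero_mem_orthant p, Metric.mem_closedBall_self (by linarith)⟩)

theorem lamStar_spec (hY : P.Y.Nonempty) {x : Vec m} (hx : x ∈ P.X) (z : Vec p) :
    P.lamStar x z ∈ orthant p ∧ ∀ l ∈ orthant p, P.dual x l - P.γ₂ / 2 * ‖l - z‖ ^ 2 ≤
      P.dual x (P.lamStar x z) - P.γ₂ / 2 * ‖P.lamStar x z - z‖ ^ 2 := by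
  obtain ⟨a, ha, h⟩ := hP.exists_isMaxOn_dual hY hx z
  have : P.lamStar x z ∈ orthant p ∧ _ := argminOn_spec (S := orthant p)
    (f := fun l => -(P.dual x l - P.γ₂ / 2 * ‖l - z‖ ^ 2)) ⟨a, ha, fun l hl => neg_le_neg (h l hl)⟩
  exact ⟨this.1, fun l hl => neg_le_neg_iff.1 (this.2 l hl)⟩

theorem wStar_mem (hY : P.Y.Nonempty) {x : Vec m} (hx : x ∈ P.X) (z : Vec p) :
    P.wStar x z ∈ P.Y := (hP.argmin_augLag_spec hY hx _).1

theorem env_eq (hY : P.Y.Nonempty) {x : Vec m} (hx : x ∈ P.X) (z : Vec p) :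
    P.env x z = P.ell x z (P.wStar x z) (P.lamStar x z) := by
  have h := hP.lamStar_spec hY hx z
  have : Nonempty (orthant p) := ⟨⟨_, h.1⟩⟩
  have h1 : P.env x z
      = P.dual x (P.lamStar x z) - P.γ₂ / 2 * ‖P.lamStar x z - z‖ ^ 2 :=
    le_antisymm (ciSup_le fun l => h.2 l l.2)
      (le_ciSup (f := fun l : orthant p => P.dual x l - P.γ₂ / 2 * ‖(l : Vec p) - z‖ ^ 2)
        ⟨_, by rintro _ ⟨l, rfl⟩; exact h.2 l l.2⟩ ⟨_, h.1⟩)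
  rw [h1, hP.dual_eq hY hx]
  rfl

theorem strongConvexOn_ell {x : Vec m} (hx : x ∈ P.X) (z l : Vec p) :
    StrongConvexOn P.Y μ fun w => P.ell x z w l := by
  have := (hP.strongConvexOn_augLag hx l).add
    (uniformConvexOn_zero.2 (convexOn_const (-(P.γ₂ / 2 * ‖l - z‖ ^ 2)) hP.convY))
  rw [add_zero] at this
  exact this

/-- `w*` minimises `ℓ(x, z, ·, λ*)`, with quadratic growth. -/
theorem ell_wStar_add_le (hY : P.Y.Nonempty) {x : Vec m} (hx : x ∈ P.X) (z : Vec p) {w : Vec n}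
    (hw : w ∈ P.Y) :
    P.ell x z (P.wStar x z) (P.lamStar x z) + μ / 2 * ‖w - P.wStar x z‖ ^ 2
      ≤ P.ell x z w (P.lamStar x z) :=
  (hP.strongConvexOn_ell hx z _).add_le_of_forall_le (hP.wStar_mem hY hx z) hw fun _ hw' =>
    sub_le_sub_right ((hP.argmin_augLag_spec hY hx _).2 _ hw') _

/-- The pair `(w*, λ*)` is a saddle point: `λ*` maximises `ℓ(x, z, w*, ·)`, with quadratic growth.

For `λ_t = λ* + t (λ - λ*)` and `w_t` a minimiser of `ℓ(·, λ_t)`, concavity in `λ` and the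
maximality of `λ*` give `ℓ(w_t, λ) + (1 - t) γ₂ / 2 ‖λ - λ*‖² ≤ E`, and also
`‖w_t - w*‖² = O(t)` by strong convexity in `w`; then `t → 0`. -/
theorem ell_lamStar_add_le (hY : P.Y.Nonempty) {x : Vec m} (hx : x ∈ P.X) (z : Vec p) {l : Vec p}
    (hl : l ∈ orthant p) :
    P.ell x z (P.wStar x z) l + P.γ₂ / 2 * ‖l - P.lamStar x z‖ ^ 2
      ≤ P.ell x z (P.wStar x z) (P.lamStar x z) := by
  have hs := hP.lamStar_spec hY hx z
  have hw₀ := hP.wStar_mem hY hx z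
  set a := P.lamStar x z with ha
  set w₀ := P.wStar x z with hw₀_def
  set W : ℝ → Vec n := fun t => argminOn P.Y fun w => P.augLag x w (a + t • (l - a)) with hW
  have hWY : ∀ t, W t ∈ P.Y := fun t => (hP.argmin_augLag_spec hY hx _).1
  set E := P.ell x z w₀ a with hE
  set Q := P.γ₂ / 2 * ‖l - a‖ ^ 2 with hQ
  have hγ := hP.γ₂_pos
  have hQ0 : 0 ≤ Q := by positivity
  have hμ := hP.μ_pos
  have hkey : ∀ t ∈ Ioo (0 : ℝ) 1, (1 - t) * (E + μ / 2 * ‖W t - w₀‖ ^ 2) + t * P.ell x z (W t) l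
      + t * (1 - t) * Q ≤ E := fun t ht => by
    have h1 := ell_segment_ge (P := P) hP.γ₁_pos x z (W t) a l ht.1.le ht.2.le
    have h2 : P.ell x z (W t) (a + t • (l - a)) ≤ E := by
      have hmem : a + t • (l - a) ∈ orthant p :=
        (convex_orthant p).add_smul_sub_mem hs.1 hl ⟨ht.1.le, ht.2.le⟩
      have h3 := hs.2 _ hmem
      rw [hP.dual_eq hY hx, hP.dual_eq hY hx] at h3
      exact h3
    have h4 : E + μ / 2 * ‖W t - w₀‖ ^ 2 ≤ P.ell x z (W t) a := hP.ell_wStar_add_le hY hx z (hWY t)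
    have h5 := mul_le_mul_of_nonneg_left h4 (sub_nonneg.2 ht.2.le)
    rw [← hQ] at h1
    linarith
  have hcont : ContinuousOn (fun w => P.ell x z w l) P.Y :=
    (hP.continuousOn_augLag hx l).sub continuousOn_const
  obtain ⟨b, hb⟩ := (hP.compY.image_of_continuousOn hcont).bddBelow
  have hb' : ∀ w ∈ P.Y, b ≤ P.ell x z w l := fun w hw => hb ⟨w, hw, rfl⟩
  have hsmall : ∀ t ∈ Ioo (0 : ℝ) (1 / 2), ‖W t - w₀‖ ^ 2 ≤ t * (4 / μ * (E - b)) := fun t ht => by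
    have h1 := hkey t ⟨ht.1, by linarith [ht.2]⟩
    have h2 := mul_le_mul_of_nonneg_left (hb' _ (hWY t)) ht.1.le
    have h3 : 0 ≤ t * (1 - t) * Q :=
      mul_nonneg (mul_nonneg ht.1.le (by linarith [ht.2])) hQ0
    have h4 : 1 / 2 * (μ / 2 * ‖W t - w₀‖ ^ 2) ≤ (1 - t) * (μ / 2 * ‖W t - w₀‖ ^ 2) := by
      gcongr; linarith [ht.2]
    have e : t * (4 / μ * (E - b)) = 4 * (t * (E - b)) / μ := by ring
    rw [e, le_div_iff₀ hμ]
    nlinarith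
  have hev : Ioo (0 : ℝ) (1 / 2) ∈ 𝓝[>] (0 : ℝ) := Ioo_mem_nhdsGT (by norm_num)
  have hWlim : Tendsto W (𝓝[>] 0) (𝓝[P.Y] w₀) := by
    refine tendsto_nhdsWithin_iff.2 ⟨?_, Eventually.of_forall hWY⟩
    rw [tendsto_iff_norm_sub_tendsto_zero]
    have h1 : Tendsto (fun t : ℝ => t * (4 / μ * (E - b))) (𝓝[>] 0) (𝓝 (0 * (4 / μ * (E - b)))) :=
      ((continuous_id.mul continuous_const).tendsto 0).mono_left nhdsWithin_le_nhds
    rw [zero_mul] at h1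
    have h2 : Tendsto (fun t => ‖W t - w₀‖ ^ 2) (𝓝[>] 0) (𝓝 0) :=
      squeeze_zero' (Eventually.of_forall fun t => sq_nonneg _)
        (by filter_upwards [hev] with t ht using hsmall t ht) h1
    have h3 := h2.sqrt
    simpa using h3
  have hlim : Tendsto (fun t : ℝ => P.ell x z (W t) l + (1 - t) * Q) (𝓝[>] 0)
      (𝓝 (P.ell x z w₀ l + (1 - 0) * Q)) := by
    refine ((hcont w₀ hw₀).tendsto.comp hWlim).add ?_
    refine Tendsto.mono_left (Continuous.tendsto ?_ 0) nhdsWithin_le_nhds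
    fun_prop
  have := le_of_tendsto hlim (b := E) ?_
  · linarith
  filter_upwards [hev] with t ht
  have h1 := hkey t ⟨ht.1, by linarith [ht.2]⟩
  have h2 : 0 ≤ (1 - t) * (μ / 2 * ‖W t - w₀‖ ^ 2) :=
    mul_nonneg (by linarith [ht.2]) (by positivity)
  refine le_of_mul_le_mul_left (a := t) ?_ ht.1
  nlinarith

/-- The strong monotonicity of the saddle operator at the solution, which drives the inner loop. -/
theorem inner_gradLag_sub_inner_gradDual_ge (hY : P.Y.Nonempty) {x : Vec m} (hx : x ∈ P.X)
    (z : Vec p) {w : Vec n} (hw : w ∈ P.Y) {l : Vec p} (hl : l ∈ orthant p) :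
    μ * ‖w - P.wStar x z‖ ^ 2 + P.γ₂ * ‖l - P.lamStar x z‖ ^ 2 ≤
      ⟪(P.gradLag (∇ P.G (pair x w)) (pair x w) l).snd, w - P.wStar x z⟫
        - ⟪P.gradDual x z w l, l - P.lamStar x z⟫ := by
  have h1 := (hP.strongConvexOn_augLag hx l).add_inner_add_le hw (hP.wStar_mem hY hx z)
    (hP.hasGradientAt_augLag_right hx hw l)
  have h2 := ell_le (P := P) hP.γ₁_pos x z w l (P.lamStar x z)
  have h3 := hP.ell_wStar_add_le hY hx z hw
  have h4 := hP.ell_lamStar_add_le hY hx z hl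
  rw [norm_sub_rev, ← neg_sub w, inner_neg_right] at h1
  rw [norm_sub_rev _ l, ← neg_sub l, inner_neg_right] at h2
  simp only [ell] at h2 h3 h4
  linarith

theorem abs_gradDual_le {x : Vec m} (hx : x ∈ P.X) {z : Vec p} (hz : z ∈ P.Z) {w : Vec n}
    (hw : w ∈ P.Y) {l : Vec p} (hl : l ∈ orthant p) (i : Fin p) :
    |P.gradDual x z w l i| ≤ M0 + P.γ₂ * (|l i| + P.B / Real.sqrt p) := by
  have h1 := abs_le.1 ((hP.bounded (pair x w) ⟨hx, hw⟩).2 i).1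
  have h2 := hP.γ₁_pos
  have h3 := hP.γ₂_pos
  have h4 := hz i
  have h5 := hl i
  have h6 := hP.M0_nonneg
  rw [abs_of_nonneg h5]
  have h7 : |max 0 (P.γ₁ * l i + P.H i (pair x w)) - P.γ₁ * l i| ≤ M0 := by
    have := mul_nonneg h2.le h5
    rw [abs_le]
    constructor
    · linarith [le_max_right 0 (P.γ₁ * l i + P.H i (pair x w)), h1.1]
    · have : max 0 (P.γ₁ * l i + P.H i (pair x w)) ≤ P.γ₁ * l i + M0 := max_le (by linarith)
        (by linarith [h1.2])
      linarith
  have h8 : |P.γ₂ * (l i - z i)| ≤ P.γ₂ * (l i + P.B / Real.sqrt p) := by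
    rw [abs_mul, abs_of_pos h3]
    refine mul_le_mul_of_nonneg_left (abs_le.2 ⟨?_, ?_⟩) h3.le <;> linarith
  exact (abs_sub _ _).trans (add_le_add h7 h8)

theorem norm_gradDual_le {x : Vec m} (hx : x ∈ P.X) {z : Vec p} (hz : z ∈ P.Z) {w : Vec n}
    (hw : w ∈ P.Y) {l : Vec p} (hl : l ∈ orthant p) :
    ‖P.gradDual x z w l‖ ≤ Real.sqrt p * (M0 + P.γ₂ * (‖l‖ + P.B / Real.sqrt p)) := by
  have h3 := hP.γ₂_pos
  have h4 := hP.B_nonneg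
  have h6 := hP.M0_nonneg
  refine norm_le_sqrt_mul (by positivity) fun i => (hP.abs_gradDual_le hx hz hw hl i).trans ?_
  gcongr
  exact abs_apply_le_norm l i

/-- A bound on the multiplier `λ*`, obtained by comparing it with `λ = 0`. -/
theorem norm_lamStar_le (hY : P.Y.Nonempty) {x : Vec m} (hx : x ∈ P.X) {z : Vec p} (hz : z ∈ P.Z) :
    ‖P.lamStar x z‖ ≤ Real.sqrt p * (M0 + P.γ₂ * (P.B / Real.sqrt p)) / P.γ₂ := by
  have h1 := ell_le (P := P) hP.γ₁_pos x z (P.wStar x z) 0 (P.lamStar x z)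
  have h2 := hP.ell_lamStar_add_le hY hx z (zero_mem_orthant p)
  have h3 := hP.norm_gradDual_le hx hz (hP.wStar_mem hY hx z) (zero_mem_orthant p)
  rw [norm_zero, zero_add] at h3
  rw [sub_zero] at h1
  rw [zero_sub, norm_neg] at h2
  have h4 := real_inner_le_norm (P.gradDual x z (P.wStar x z) 0) (P.lamStar x z)
  have hγ := hP.γ₂_pos
  rw [le_div_iff₀ hγ]
  set a := ‖P.lamStar x z‖
  have ha : 0 ≤ a := norm_nonneg _
  rcases ha.eq_or_lt with h0 | h0
  · rw [← h0, zero_mul]; exact (norm_nonneg _).trans h3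
  · have h5 : P.γ₂ * a ^ 2 ≤ ‖P.gradDual x z (P.wStar x z) 0‖ * a := by linarith
    refine le_trans ?_ h3
    refine le_of_mul_le_mul_right (a := a) ?_ h0
    nlinarith

end Standing

end Problem

/-! ### Lipschitz estimates and the gradient of the gap function -/

theorem norm_max_zero_smul_sub_le {E : Type*} [NormedAddCommGroup E] [NormedSpace ℝ E]
    (a a' : ℝ) (g g' : E) :
    ‖max 0 a • g - max 0 a' • g'‖ ≤ |a - a'| * ‖g‖ + |a'| * ‖g - g'‖ := by
  have e : max 0 a • g - max 0 a' • g' = (max 0 a - max 0 a') • g + max 0 a' • (g - g') := by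
    module
  rw [e]
  refine (norm_add_le _ _).trans (add_le_add ?_ ?_) <;> rw [norm_smul, Real.norm_eq_abs]
  · exact mul_le_mul_of_nonneg_right (abs_max_zero_sub_le a a') (norm_nonneg _)
  · exact mul_le_mul_of_nonneg_right (by simpa using abs_max_zero_sub_le a' 0) (norm_nonneg _)

namespace Problem

variable {m n p : ℕ} {Zt Xi : Type*} {P : Problem m n p Zt Xi}

theorem gradLag_sub_gradLag (a a' v : XY m n) (l : Vec p) :
    P.gradLag a v l - P.gradLag a' v l = a - a' := by
  simp [gradLag]

namespace Standing

variable {LG LH : ℝ≥0} {μ MG M0 M1 : ℝ} (hP : P.Standing LG LH μ MG M0 M1)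
include hP

theorem norm_gradG_sub_le {v v' : XY m n} (hv : v ∈ P.domXY) (hv' : v' ∈ P.domXY) :
    ‖∇ P.G v - ∇ P.G v'‖ ≤ LG * ‖v - v'‖ := hP.lipG.norm_sub_le hv hv'

theorem norm_gradH_sub_le (i : Fin p) {v v' : XY m n} (hv : v ∈ P.domXY) (hv' : v' ∈ P.domXY) :
    ‖∇ (P.H i) v - ∇ (P.H i) v'‖ ≤ LH * ‖v - v'‖ := (hP.lipH i).norm_sub_le hv hv'

theorem abs_H_sub_le (i : Fin p) {v v' : XY m n} (hv : v ∈ P.domXY) (hv' : v' ∈ P.domXY) :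
    |P.H i v - P.H i v'| ≤ M1 * ‖v - v'‖ :=
  abs_sub_le_of_norm_gradient_le hP.convex_domXY
    (fun x hx => (hP.diffH i x hx).hasGradientAt.gradientWithinAt)
    (fun x hx => ((hP.bounded x hx).2 i).2) hv' hv

theorem continuousOn_H (i : Fin p) : ContinuousOn (P.H i) P.domXY := fun v hv =>
  (hP.diffH i v hv).hasGradientAt.continuousAt.continuousWithinAt

theorem exists_norm_gradLag_sub_le (R : ℝ) (hR : 0 ≤ R) : ∃ C, 0 ≤ C ∧ ∀ v ∈ P.domXY,
    ∀ v' ∈ P.domXY, ∀ l l' : Vec p, ‖l'‖ ≤ R →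
      ‖P.gradLag (∇ P.G v) v l - P.gradLag (∇ P.G v') v' l'‖ ≤ C * (‖v - v'‖ + ‖l - l'‖) := by
  have hγ := hP.γ₁_pos
  have hM0 := hP.M0_nonneg
  have hM1 := hP.M1_nonneg
  refine ⟨LG + 1 / P.γ₁ * (p * ((P.γ₁ + M1) * M1 + (P.γ₁ * R + M0) * LH)), by positivity, ?_⟩
  intro v hv v' hv' l l' hl'
  set A := ‖v - v'‖ + ‖l - l'‖ with hA
  have hvA : ‖v - v'‖ ≤ A := le_add_of_nonneg_right (norm_nonneg _)
  have hlA : ‖l - l'‖ ≤ A := le_add_of_nonneg_left (norm_nonneg _)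
  have hA0 : 0 ≤ A := by positivity
  have hterm : ∀ i, ‖max 0 (P.γ₁ * l i + P.H i v) • ∇ (P.H i) v
      - max 0 (P.γ₁ * l' i + P.H i v') • ∇ (P.H i) v'‖
        ≤ ((P.γ₁ + M1) * M1 + (P.γ₁ * R + M0) * LH) * A := fun i => by
    refine (norm_max_zero_smul_sub_le _ _ _ _).trans ?_
    rw [add_mul]
    have h1 : |P.γ₁ * l i + P.H i v - (P.γ₁ * l' i + P.H i v')| ≤ (P.γ₁ + M1) * A := by
      have e : P.γ₁ * l i + P.H i v - (P.γ₁ * l' i + P.H i v')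
          = P.γ₁ * (l i - l' i) + (P.H i v - P.H i v') := by ring
      rw [e, add_mul]
      refine (abs_add_le _ _).trans (add_le_add ?_ ?_)
      · rw [abs_mul, abs_of_pos hγ]
        gcongr
        exact (abs_apply_le_norm (l - l') i).trans hlA
      · exact (hP.abs_H_sub_le i hv hv').trans (by gcongr)
    have h2 : |P.γ₁ * l' i + P.H i v'| ≤ P.γ₁ * R + M0 := by
      refine (abs_add_le _ _).trans (add_le_add ?_ ((hP.bounded v' hv').2 i).1)
      rw [abs_mul, abs_of_pos hγ]
      gcongr
      exact (abs_apply_le_norm l' i).trans hl'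
    have h3 : ‖∇ (P.H i) v - ∇ (P.H i) v'‖ ≤ LH * A :=
      (hP.norm_gradH_sub_le i hv hv').trans (by gcongr)
    have h4 := ((hP.bounded v hv).2 i).2
    refine add_le_add ?_ ?_
    · calc _ ≤ (P.γ₁ + M1) * A * M1 := by gcongr
        _ = _ := by ring
    · calc _ ≤ (P.γ₁ * R + M0) * (LH * A) := by gcongr
        _ = _ := by ring
  have e : P.gradLag (∇ P.G v) v l - P.gradLag (∇ P.G v') v' l' = (∇ P.G v - ∇ P.G v')
      + (1 / P.γ₁) • ∑ i, (max 0 (P.γ₁ * l i + P.H i v) • ∇ (P.H i) v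
      - max 0 (P.γ₁ * l' i + P.H i v') • ∇ (P.H i) v') := by
    simp only [gradLag, Finset.sum_sub_distrib, smul_sub]; abel
  rw [e, add_mul]
  refine (norm_add_le _ _).trans (add_le_add
    ((hP.norm_gradG_sub_le hv hv').trans (by gcongr)) ?_)
  rw [norm_smul, Real.norm_eq_abs, abs_of_pos (by positivity), mul_assoc]
  gcongr
  refine (norm_sum_le_of_le _ fun i _ => hterm i).trans_eq ?_
  rw [Finset.sum_const, Finset.card_univ, Fintype.card_fin, nsmul_eq_mul]; ring

theorem norm_gradLag_le {R : ℝ} {v : XY m n} (hv : v ∈ P.domXY) {l : Vec p} (hl : ‖l‖ ≤ R) :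
    ‖P.gradLag (∇ P.G v) v l‖ ≤ MG + 1 / P.γ₁ * (p * ((P.γ₁ * R + M0) * M1)) := by
  have hγ := hP.γ₁_pos
  have hR : 0 ≤ R := (norm_nonneg _).trans hl
  have hM0 := hP.M0_nonneg
  refine (norm_add_le _ _).trans (add_le_add (hP.bounded v hv).1 ?_)
  rw [norm_smul, Real.norm_eq_abs, abs_of_pos (by positivity)]
  gcongr
  refine (norm_sum_le_of_le _ (f := fun i => max 0 (P.γ₁ * l i + P.H i v) • ∇ (P.H i) v)
    (n := fun _ => (P.γ₁ * R + M0) * M1) fun i _ => ?_).trans_eq ?_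
  · rw [norm_smul, Real.norm_eq_abs, abs_of_nonneg (le_max_left _ _)]
    have h1 := (hP.bounded v hv).2 i
    refine mul_le_mul (max_le (by positivity) (add_le_add ?_ ((le_abs_self _).trans h1.1))) h1.2
      (norm_nonneg _) (by positivity)
    gcongr
    exact (le_abs_self _).trans ((abs_apply_le_norm l i).trans hl)
  · rw [Finset.sum_const, Finset.card_univ, Fintype.card_fin, nsmul_eq_mul]

theorem exists_norm_lamStar_le (hY : P.Y.Nonempty) :
    ∃ R, 0 ≤ R ∧ ∀ x ∈ P.X, ∀ z ∈ P.Z, ‖P.lamStar x z‖ ≤ R := by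
  have h3 := hP.γ₂_pos
  have h4 := hP.B_nonneg
  have h6 := hP.M0_nonneg
  exact ⟨Real.sqrt p * (M0 + P.γ₂ * (P.B / Real.sqrt p)) / P.γ₂, by positivity,
    fun x hx z hz => hP.norm_lamStar_le hY hx hz⟩

/-- The saddle point `(w*, λ*)` is a Lipschitz function of `(x, z)`.  The growth of `ℓ` around the
two saddle points bounds the squared distance between them by the mixed difference
`h(x', z') - h(x, z)` of `h = ℓ(·, w', λ) - ℓ(·, w, λ')`, whose gradient is at most a constant
times that distance. -/
theorem exists_norm_star_sub_le (hY : P.Y.Nonempty) : ∃ C, 0 ≤ C ∧ ∀ x ∈ P.X, ∀ x' ∈ P.X,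
    ∀ z ∈ P.Z, ∀ z' ∈ P.Z,
      ‖P.wStar x z - P.wStar x' z'‖ + ‖P.lamStar x z - P.lamStar x' z'‖
        ≤ C * (‖x - x'‖ + ‖z - z'‖) := by
  obtain ⟨R, hR0, hR⟩ := hP.exists_norm_lamStar_le hY
  obtain ⟨C, hC0, hC⟩ := hP.exists_norm_gradLag_sub_le R hR0
  have hμ := hP.μ_pos
  have hγ := hP.γ₂_pos
  have hκ : 0 < min μ P.γ₂ := lt_min hμ hγ
  refine ⟨2 * (C + P.γ₂) / min μ P.γ₂, by positivity, ?_⟩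
  intro x hx x' hx' z hz z' hz'
  have hw := hP.wStar_mem hY hx z
  have hw' := hP.wStar_mem hY hx' z'
  have hl := (hP.lamStar_spec hY hx z).1
  have hl' := (hP.lamStar_spec hY hx' z').1
  have g1 := hP.ell_wStar_add_le hY hx z hw'
  have g2 := hP.ell_lamStar_add_le hY hx z hl'
  have g3 := hP.ell_wStar_add_le hY hx' z' hw
  have g4 := hP.ell_lamStar_add_le hY hx' z' hl
  have hRl' := hR x' hx' z' hz'
  set w := P.wStar x z
  set w' := P.wStar x' z'
  set l := P.lamStar x z
  set l' := P.lamStar x' z'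
  have hmean : |(P.augLag x w' l - P.augLag x w l') - (P.augLag x' w' l - P.augLag x' w l')|
      ≤ C * (‖w' - w‖ + ‖l - l'‖) * ‖x - x'‖ := by
    refine abs_sub_le_of_norm_gradient_le hP.convX
      (f := fun x => P.augLag x w' l - P.augLag x w l')
      (fun y hy => ((hP.hasGradientAt_augLag_left hy hw' l).sub_hasGradientAt
        (hP.hasGradientAt_augLag_left hy hw l')).gradientWithinAt)
      (fun y hy => ?_) hx' hx
    refine (norm_fst_le (P.gradLag (∇ P.G (pair y w')) (pair y w') l
      - P.gradLag (∇ P.G (pair y w)) (pair y w) l')).trans ?_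
    have := hC (pair y w') ⟨hy, hw'⟩ (pair y w) ⟨hy, hw⟩ l l' hRl'
    rwa [norm_pair_sub_left] at this
  have hz2 : (‖l - z‖ ^ 2 - ‖l' - z‖ ^ 2) - (‖l - z'‖ ^ 2 - ‖l' - z'‖ ^ 2)
      = -2 * ⟪l - l', z - z'⟫ := by
    simp only [← real_inner_self_eq_norm_sq, inner_sub_left, inner_sub_right]
    rw [real_inner_comm z l, real_inner_comm z l', real_inner_comm z' l, real_inner_comm z' l']
    ring
  have hz3 := (abs_real_inner_le_norm (l - l') (z - z'))
  have hm2 := (le_abs_self _).trans hmean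
  rw [norm_sub_rev w' w] at g1 hm2
  rw [norm_sub_rev l' l] at g2
  simp only [ell] at g1 g2 g3 g4
  set a := ‖w - w'‖
  set b := ‖l - l'‖
  set X := ‖x - x'‖
  set W := ‖z - z'‖
  have ha : 0 ≤ a := norm_nonneg _
  have hb : 0 ≤ b := norm_nonneg _
  have hX : 0 ≤ X := norm_nonneg _
  have hW : 0 ≤ W := norm_nonneg _
  have h1 : μ * a ^ 2 + P.γ₂ * b ^ 2 ≤ C * (a + b) * X + P.γ₂ * (b * W) := by
    have h2 : P.γ₂ * ⟪l - l', z - z'⟫ ≤ P.γ₂ * (b * W) :=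
      mul_le_mul_of_nonneg_left ((le_abs_self _).trans hz3) hγ.le
    have h3 : P.γ₂ / 2 * (‖l - z‖ ^ 2 - ‖l' - z‖ ^ 2 - (‖l - z'‖ ^ 2 - ‖l' - z'‖ ^ 2))
      = P.γ₂ / 2 * (-2 * ⟪l - l', z - z'⟫) := by rw [hz2]
    linarith
  have h2 : min μ P.γ₂ * (a ^ 2 + b ^ 2) ≤ μ * a ^ 2 + P.γ₂ * b ^ 2 := by
    rw [mul_add]
    gcongr
    · exact min_le_left _ _
    · exact min_le_right _ _
  have h3 : C * (a + b) * X + P.γ₂ * (b * W) ≤ (C + P.γ₂) * ((a + b) * (X + W)) := by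
    have i1 : C * ((a + b) * X) ≤ C * ((a + b) * (X + W)) := by gcongr; linarith
    have i2 : P.γ₂ * (b * W) ≤ P.γ₂ * ((a + b) * (X + W)) := by gcongr <;> linarith
    linarith
  rw [div_mul_eq_mul_div, le_div_iff₀ hκ]
  have h4 : min μ P.γ₂ * (a + b) ^ 2 ≤ 2 * ((C + P.γ₂) * ((a + b) * (X + W))) := by
    have : min μ P.γ₂ * (a + b) ^ 2 ≤ min μ P.γ₂ * (2 * (a ^ 2 + b ^ 2)) := by
      gcongr; nlinarith [sq_nonneg (a - b)]
    linarith
  rcases (add_nonneg ha hb).eq_or_lt with h0 | h0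
  · rw [← h0, zero_mul]; positivity
  · refine le_of_mul_le_mul_right (a := a + b) ?_ h0
    nlinarith

/-- The first-order expansion of `ℓ` in `(x, z)`, with a remainder uniform in `w` and bounded
`λ`. -/
theorem exists_abs_ell_sub_le (R : ℝ) (hR : 0 ≤ R) : ∃ C, 0 ≤ C ∧ ∀ x ∈ P.X, ∀ x' ∈ P.X,
    ∀ z z' : Vec p, ∀ w ∈ P.Y, ∀ l : Vec p, ‖l‖ ≤ R →
      |P.ell x' z' w l - P.ell x z w l
        - (⟪(P.gradLag (∇ P.G (pair x w)) (pair x w) l).fst, x' - x⟫ + P.γ₂ * ⟪l - z, z' - z⟫)|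
        ≤ C * (‖x' - x‖ + ‖z' - z‖) ^ 2 := by
  obtain ⟨C, hC0, hC⟩ := hP.exists_norm_gradLag_sub_le R hR
  have hγ := hP.γ₂_pos
  refine ⟨C + P.γ₂ / 2, by positivity, ?_⟩
  intro x hx x' hx' z z' w hw l hl
  have h1 := abs_sub_sub_inner_le hP.convX
    (fun y hy => (hP.hasGradientAt_augLag_left hy hw l).gradientWithinAt) hC0 hx hx' (fun y hy => by
      refine (norm_fst_le (P.gradLag (∇ P.G (pair y w)) (pair y w) l
        - P.gradLag (∇ P.G (pair x w)) (pair x w) l)).trans ?_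
      have := hC (pair y w) ⟨hy, hw⟩ (pair x w) ⟨hx, hw⟩ l l hl
      rwa [norm_pair_sub_right, sub_self, norm_zero, add_zero] at this)
  have h2 : ‖l - z'‖ ^ 2 = ‖l - z‖ ^ 2 - 2 * ⟪l - z, z' - z⟫ + ‖z' - z‖ ^ 2 := by
    rw [← norm_sub_sq_real]; congr 2; abel
  simp only [ell]
  rw [h2]
  have e : P.augLag x' w l - P.γ₂ / 2 * (‖l - z‖ ^ 2 - 2 * ⟪l - z, z' - z⟫ + ‖z' - z‖ ^ 2)
      - (P.augLag x w l - P.γ₂ / 2 * ‖l - z‖ ^ 2)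
      - (⟪(P.gradLag (∇ P.G (pair x w)) (pair x w) l).fst, x' - x⟫ + P.γ₂ * ⟪l - z, z' - z⟫)
      = (P.augLag x' w l - P.augLag x w l
          - ⟪(P.gradLag (∇ P.G (pair x w)) (pair x w) l).fst, x' - x⟫)
        + (-(P.γ₂ / 2 * ‖z' - z‖ ^ 2)) := by ring
  rw [e, add_mul]
  have hx0 := norm_nonneg (x' - x)
  have hz0 := norm_nonneg (z' - z)
  refine (abs_add_le _ _).trans (add_le_add (h1.trans ?_) ?_)
  · gcongr; linarith
  · rw [abs_neg, abs_of_nonneg (by positivity)]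
    gcongr; linarith

/-- The envelope theorem for `E(x, z) = max_λ min_w ℓ(x, z, w, λ)`, with a quadratic remainder. -/
theorem exists_abs_env_sub_le (hY : P.Y.Nonempty) : ∃ C, 0 ≤ C ∧ ∀ x ∈ P.X, ∀ x' ∈ P.X,
    ∀ z ∈ P.Z, ∀ z' ∈ P.Z,
      |P.env x' z' - P.env x z
        - (⟪(P.gradLag (∇ P.G (pair x (P.wStar x z))) (pair x (P.wStar x z))
            (P.lamStar x z)).fst, x' - x⟫ + P.γ₂ * ⟪P.lamStar x z - z, z' - z⟫)|
        ≤ C * (‖x' - x‖ + ‖z' - z‖) ^ 2 := by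
  obtain ⟨R, hR0, hR⟩ := hP.exists_norm_lamStar_le hY
  obtain ⟨C₁, hC₁, h1⟩ := hP.exists_norm_gradLag_sub_le R hR0
  obtain ⟨C₂, hC₂, h2⟩ := hP.exists_abs_ell_sub_le R hR0
  obtain ⟨C₃, hC₃, h3⟩ := hP.exists_norm_star_sub_le hY
  have hγ := hP.γ₂_pos
  refine ⟨C₂ + (C₁ * C₃ + P.γ₂ * C₃), by positivity, ?_⟩
  intro x hx x' hx' z hz z' hz'
  have hw := hP.wStar_mem hY hx z
  have hw' := hP.wStar_mem hY hx' z'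
  have g1 := hP.ell_wStar_add_le hY hx z hw'
  have g2 := hP.ell_lamStar_add_le hY hx z (hP.lamStar_spec hY hx' z').1
  have g3 := hP.ell_wStar_add_le hY hx' z' hw
  have g4 := hP.ell_lamStar_add_le hY hx' z' (hP.lamStar_spec hY hx z).1
  have hS := h3 x' hx' x hx z' hz' z hz
  have hRl := hR x hx z hz
  have hRl' := hR x' hx' z' hz'
  rw [hP.env_eq hY hx, hP.env_eq hY hx']
  set w := P.wStar x z
  set w' := P.wStar x' z'
  set l := P.lamStar x z
  set l' := P.lamStar x' z'
  set A := ‖x' - x‖ + ‖z' - z‖ with hA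
  have hA0 : 0 ≤ A := by positivity
  have hxA : ‖x' - x‖ ≤ A := le_add_of_nonneg_right (norm_nonneg _)
  have hzA : ‖z' - z‖ ≤ A := le_add_of_nonneg_left (norm_nonneg _)
  -- replacing one of `w`, `λ` by its value at `(x', z')` changes the linear part by `O(A²)`
  have key : ∀ w₁ ∈ P.Y, ∀ l₁ : Vec p, ‖l₁‖ ≤ R → ‖w₁ - w‖ + ‖l₁ - l‖ ≤ C₃ * A →
      |P.ell x' z' w₁ l₁ - P.ell x z w₁ l₁
        - (⟪(P.gradLag (∇ P.G (pair x w)) (pair x w) l).fst, x' - x⟫ + P.γ₂ * ⟪l - z, z' - z⟫)|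
        ≤ (C₂ + (C₁ * C₃ + P.γ₂ * C₃)) * A ^ 2 := by
    intro w₁ hw₁ l₁ hl₁ hd
    have i1 := h2 x hx x' hx' z z' w₁ hw₁ l₁ hl₁
    have i2 := h1 (pair x w₁) ⟨hx, hw₁⟩ (pair x w) ⟨hx, hw⟩ l₁ l hRl
    rw [norm_pair_sub_left] at i2
    set g₁ := P.gradLag (∇ P.G (pair x w₁)) (pair x w₁) l₁
    set g := P.gradLag (∇ P.G (pair x w)) (pair x w) l
    have i3 : |⟪g₁.fst, x' - x⟫ - ⟪g.fst, x' - x⟫| ≤ C₁ * C₃ * A ^ 2 := by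
      rw [← inner_sub_left]
      refine (abs_real_inner_le_norm _ _).trans ?_
      calc ‖g₁.fst - g.fst‖ * ‖x' - x‖ ≤ (C₁ * (C₃ * A)) * A := by
            gcongr
            exact (norm_fst_le (g₁ - g)).trans (i2.trans (by gcongr))
        _ = _ := by ring
    have i4 : |P.γ₂ * ⟪l₁ - z, z' - z⟫ - P.γ₂ * ⟪l - z, z' - z⟫| ≤ P.γ₂ * C₃ * A ^ 2 := by
      rw [← mul_sub, ← inner_sub_left, abs_mul, abs_of_pos hγ, sub_sub_sub_cancel_right]
      calc P.γ₂ * |⟪l₁ - l, z' - z⟫| ≤ P.γ₂ * ((C₃ * A) * A) := by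
            gcongr
            refine (abs_real_inner_le_norm _ _).trans ?_
            gcongr
            exact (le_add_of_nonneg_left (norm_nonneg _)).trans hd
        _ = _ := by ring
    rw [abs_le] at i1 i3 i4 ⊢
    constructor <;> linarith [i1.1, i1.2, i3.1, i3.2, i4.1, i4.2]
  have k1 := key w hw l' hRl' (by
    rw [sub_self, norm_zero, zero_add]
    exact (le_add_of_nonneg_left (norm_nonneg _)).trans hS)
  have k2 := key w' hw' l hRl (by
    rw [sub_self, norm_zero, add_zero]
    exact (le_add_of_nonneg_right (norm_nonneg _)).trans hS)
  have hμ := hP.μ_pos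
  have q1 : 0 ≤ μ / 2 * ‖w' - w‖ ^ 2 := by positivity
  have q2 : 0 ≤ P.γ₂ / 2 * ‖l' - l‖ ^ 2 := by positivity
  have q3 : 0 ≤ μ / 2 * ‖w - w'‖ ^ 2 := by positivity
  have q4 : 0 ≤ P.γ₂ / 2 * ‖l - l'‖ ^ 2 := by positivity
  rw [abs_le] at k1 k2 ⊢
  constructor <;> linarith [k1.1, k1.2, k2.1, k2.2]

/-- The envelope theorem identifies the gradient of the gap function. -/
theorem hasGradientWithinAt_gap {u : XYZ m n p} (hu : u ∈ P.U) :
    HasGradientWithinAt P.gap (P.gapGradient u) P.U u := by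
  have hY : P.Y.Nonempty := ⟨_, hu.1.2⟩
  obtain ⟨C, hC, h⟩ := hP.exists_abs_env_sub_le hY
  refine hasGradientWithinAt_of_abs_le (C := LG + C * 4) fun v hv => ?_
  have h1 := h u.fst.fst hu.1.1 v.fst.fst hv.1.1 u.snd hu.2 v.snd hv.2
  have h2 := abs_sub_sub_inner_le hP.convex_domXY (f := P.G) (g := ∇ P.G) (fun w hw =>
    (hP.diffG w hw).hasGradientAt.gradientWithinAt)
    LG.coe_nonneg hu.1 hv.1 (fun w hw => hP.norm_gradG_sub_le hw hu.1)
  have n1 : ‖v.fst - u.fst‖ ≤ ‖v - u‖ := norm_fst_le (v - u)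
  have n2 : ‖v.fst.fst - u.fst.fst‖ ≤ ‖v - u‖ := (norm_fst_le (v.fst - u.fst)).trans n1
  have n3 : ‖v.snd - u.snd‖ ≤ ‖v - u‖ := norm_snd_le (v - u)
  set x := u.fst.fst
  set w := P.wStar x u.snd
  set l := P.lamStar x u.snd
  have e : ⟪P.gapGradient u, v - u⟫ = ⟪∇ P.G u.fst, v.fst - u.fst⟫
      - (⟪(P.gradLag (∇ P.G (pair x w)) (pair x w) l).fst, v.fst.fst - x⟫
        + P.γ₂ * ⟪l - u.snd, v.snd - u.snd⟫) := by
    have e1 : ⟪P.gapGradient u, v - u⟫ =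
        ⟪∇ P.G u.fst - pair (P.gradLag (∇ P.G (pair x w)) (pair x w) l).fst 0, v.fst - u.fst⟫
          + ⟪-(P.γ₂ • (l - u.snd)), v.snd - u.snd⟫ := rfl
    have e2 : ⟪(pair (P.gradLag (∇ P.G (pair x w)) (pair x w) l).fst 0 : XY m n), v.fst - u.fst⟫
        = ⟪(P.gradLag (∇ P.G (pair x w)) (pair x w) l).fst, v.fst.fst - x⟫
          + ⟪(0 : Vec n), v.fst.snd - u.fst.snd⟫ := rfl
    rw [e1, inner_sub_left, e2, inner_zero_left, inner_neg_left, real_inner_smul_left]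
    ring
  have e3 : P.gap v - P.gap u - ⟪P.gapGradient u, v - u⟫
      = (P.G v.fst - P.G u.fst - ⟪∇ P.G u.fst, v.fst - u.fst⟫)
        - (P.env v.fst.fst v.snd - P.env x u.snd
          - (⟪(P.gradLag (∇ P.G (pair x w)) (pair x w) l).fst, v.fst.fst - x⟫
            + P.γ₂ * ⟪l - u.snd, v.snd - u.snd⟫)) := by
    rw [e]; simp only [gap]; ring
  rw [e3, add_mul]
  refine (abs_sub _ _).trans (add_le_add (h2.trans (by gcongr)) (h1.trans ?_))
  rw [mul_assoc]
  gcongr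
  calc (‖v.fst.fst - x‖ + ‖v.snd - u.snd‖) ^ 2 ≤ (‖v - u‖ + ‖v - u‖) ^ 2 := by gcongr
    _ = 4 * ‖v - u‖ ^ 2 := by ring

omit hP in
theorem norm_gradGap_sub_le (hγ : 0 < P.γ₂) (a b a' b' : XY m n) (u u' : XYZ m n p) (w w' : Vec n)
    (l l' : Vec p) : ‖P.gradGap a b u w l - P.gradGap a' b' u' w' l'‖ ≤ ‖a - a'‖
      + ‖P.gradLag b (pair u.fst.fst w) l - P.gradLag b' (pair u'.fst.fst w') l'‖
      + P.γ₂ * (‖l - l'‖ + ‖u.snd - u'.snd‖) := by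
  refine (norm_le_norm_fst_add_norm_snd _).trans (add_le_add ?_ ?_)
  · have e : (P.gradGap a b u w l - P.gradGap a' b' u' w' l').fst = (a - a')
        - pair (P.gradLag b (pair u.fst.fst w) l - P.gradLag b' (pair u'.fst.fst w') l').fst 0 := by
      change (a - pair (P.gradLag b (pair u.fst.fst w) l).fst 0)
        - (a' - pair (P.gradLag b' (pair u'.fst.fst w') l').fst 0) = _
      rw [sub_sub_sub_comm, pair_sub_pair (P.gradLag b (pair u.fst.fst w) l).fst
        (P.gradLag b' (pair u'.fst.fst w') l').fst 0 0, sub_zero]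
      rfl
    rw [e]
    refine (norm_sub_le _ _).trans (add_le_add le_rfl ?_)
    rw [norm_pair_zero_right]
    exact norm_fst_le _
  · have e : (P.gradGap a b u w l - P.gradGap a' b' u' w' l').snd
        = -(P.γ₂ • ((l - l') - (u.snd - u'.snd))) := by
      change -(P.γ₂ • (l - u.snd)) - -(P.γ₂ • (l' - u'.snd)) = _
      module
    rw [e, norm_neg, norm_smul, Real.norm_eq_abs, abs_of_pos hγ]
    gcongr
    exact norm_sub_le _ _

theorem exists_lipschitzOnWith_gapGradient : ∃ L : ℝ≥0, LipschitzOnWith L P.gapGradient P.U := by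
  rcases P.Y.eq_empty_or_nonempty with hY | hY
  · refine ⟨0, fun u hu => ?_⟩
    have := hu.1.2
    simp [hY] at this
  obtain ⟨R, hR0, hR⟩ := hP.exists_norm_lamStar_le hY
  obtain ⟨C₁, hC₁, h1⟩ := hP.exists_norm_gradLag_sub_le R hR0
  obtain ⟨C₃, hC₃, h3⟩ := hP.exists_norm_star_sub_le hY
  have hγ := hP.γ₂_pos
  set L : ℝ := LG + C₁ * (1 + C₃ * 2) + P.γ₂ * (C₃ * 2 + 1) with hL
  have hL0 : 0 ≤ L := by positivity
  refine ⟨L.toNNReal, LipschitzOnWith.of_dist_le_mul fun u hu v hv => ?_⟩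
  rw [Real.coe_toNNReal _ hL0, dist_eq_norm, dist_eq_norm]
  have n1 : ‖u.fst - v.fst‖ ≤ ‖u - v‖ := norm_fst_le (u - v)
  have n2 : ‖u.fst.fst - v.fst.fst‖ ≤ ‖u - v‖ := (norm_fst_le (u.fst - v.fst)).trans n1
  have n3 : ‖u.snd - v.snd‖ ≤ ‖u - v‖ := norm_snd_le (u - v)
  have hs := h3 u.fst.fst hu.1.1 v.fst.fst hv.1.1 u.snd hu.2 v.snd hv.2
  have hs' : ‖P.wStar u.fst.fst u.snd - P.wStar v.fst.fst v.snd‖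
      + ‖P.lamStar u.fst.fst u.snd - P.lamStar v.fst.fst v.snd‖ ≤ C₃ * 2 * ‖u - v‖ := by
    refine hs.trans ?_
    rw [mul_assoc]; gcongr; linarith
  have hg := h1 (pair u.fst.fst (P.wStar u.fst.fst u.snd)) ⟨hu.1.1, hP.wStar_mem hY hu.1.1 _⟩
    (pair v.fst.fst (P.wStar v.fst.fst v.snd)) ⟨hv.1.1, hP.wStar_mem hY hv.1.1 _⟩
    (P.lamStar u.fst.fst u.snd) (P.lamStar v.fst.fst v.snd) (hR _ hv.1.1 _ hv.2)
  have hp : ‖pair u.fst.fst (P.wStar u.fst.fst u.snd) - pair v.fst.fst (P.wStar v.fst.fst v.snd)‖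
      ≤ ‖u.fst.fst - v.fst.fst‖ + ‖P.wStar u.fst.fst u.snd - P.wStar v.fst.fst v.snd‖ :=
    norm_le_norm_fst_add_norm_snd _
  refine (norm_gradGap_sub_le hγ _ _ _ _ _ _ _ _ _ _).trans ?_
  rw [hL, add_mul, add_mul]
  refine add_le_add (add_le_add ((hP.norm_gradG_sub_le hu.1 hv.1).trans (by gcongr))
    (hg.trans ?_)) ?_
  · rw [mul_assoc]; gcongr; linarith
  · rw [mul_assoc]; gcongr
    linarith [norm_nonneg (P.wStar u.fst.fst u.snd - P.wStar v.fst.fst v.snd)]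

theorem hasGradientAt_penalty {v : XY m n} (hv : v ∈ P.domXY) :
    HasGradientAt P.penalty (P.penaltyGradient v) v := by
  have h1 : ∀ i, HasFDerivAt (fun v => max 0 (P.H i v) ^ 2)
      ((2 * max 0 (P.H i v)) • InnerProductSpace.toDual ℝ _ (∇ (P.H i) v)) v :=
    fun i => (hasDerivAt_sq_max_zero _).comp_hasFDerivAt v
      (hP.diffH i v hv).hasGradientAt.hasFDerivAt
  have h2 := (HasFDerivAt.fun_sum (u := Finset.univ) fun i _ => h1 i).const_mul (1 / 2)
  rw [hasGradientAt_iff_hasFDerivAt]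
  refine h2.congr_fderiv ?_
  simp only [penaltyGradient, map_smul, map_sum, Finset.smul_sum, smul_smul]
  refine Finset.sum_congr rfl fun i _ => ?_
  congr 1
  ring

theorem exists_lipschitzOnWith_penaltyGradient :
    ∃ L : ℝ≥0, LipschitzOnWith L P.penaltyGradient P.domXY := by
  have hM0 := hP.M0_nonneg
  have hM1 := hP.M1_nonneg
  have hL0 : 0 ≤ p * (M1 * M1 + M0 * LH) := by positivity
  refine ⟨(p * (M1 * M1 + M0 * LH)).toNNReal, LipschitzOnWith.of_dist_le_mul fun u hu v hv => ?_⟩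
  rw [Real.coe_toNNReal _ hL0, dist_eq_norm, dist_eq_norm, penaltyGradient, penaltyGradient,
    ← Finset.sum_sub_distrib]
  refine (norm_sum_le_of_le _ (n := fun _ => (M1 * M1 + M0 * LH) * ‖u - v‖) fun i _ => ?_).trans_eq
    (by rw [Finset.sum_const, Finset.card_univ, Fintype.card_fin, nsmul_eq_mul]; ring)
  refine (norm_max_zero_smul_sub_le _ _ _ _).trans ?_
  have h1 := hP.abs_H_sub_le i hu hv
  have h2 := hP.norm_gradH_sub_le i hu hv
  calc |P.H i u - P.H i v| * ‖∇ (P.H i) u‖ + |P.H i v| * ‖∇ (P.H i) u - ∇ (P.H i) v‖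
      ≤ (M1 * ‖u - v‖) * M1 + M0 * (LH * ‖u - v‖) := by
        gcongr
        · exact ((hP.bounded u hu).2 i).2
        · exact ((hP.bounded v hv).2 i).1
    _ = _ := by ring

/-- The gradient of `Ψ`. -/
def _root_.SALVF.Problem.psiGradient (P : Problem m n p Zt Xi) (c₁ c₂ : ℝ) (u : XYZ m n p) :
    XYZ m n p :=
  triple (∇ P.F u.fst) 0 + c₁ • P.gapGradient u + c₂ • triple (P.penaltyGradient u.fst) 0

/-- The quadratic upper model of `Ψ` on `𝒰`, with constant `LΨ` instead of the sharp `LΨ / 2`; the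
loss is affordable since the step size is below `1 / (2 LΨ)`. -/
theorem Psi_sub_sub_inner_le {LF Lgap Lpen : ℝ≥0}
    (hF : ∀ v ∈ P.domXY, DifferentiableAt ℝ P.F v) (hLF : LipschitzOnWith LF (∇ P.F) P.domXY)
    (hgap : LipschitzOnWith Lgap P.gapGradient P.U)
    (hpen : LipschitzOnWith Lpen P.penaltyGradient P.domXY) {c₁ c₂ : ℝ} (hc₁ : 0 < c₁)
    (hc₂ : 0 < c₂) {u v : XYZ m n p} (hu : u ∈ P.U) (hv : v ∈ P.U) :
    P.Psi c₁ c₂ v - P.Psi c₁ c₂ u - ⟪P.psiGradient c₁ c₂ u, v - u⟫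
      ≤ (LF + c₁ * Lgap + c₂ * Lpen) * ‖v - u‖ ^ 2 := by
  have n1 : ‖v.fst - u.fst‖ ≤ ‖v - u‖ := norm_fst_le (v - u)
  have h1 := (le_abs_self _).trans (abs_sub_sub_inner_le hP.convex_domXY (f := P.F) (g := ∇ P.F)
    (fun w hw => (hF w hw).hasGradientAt.gradientWithinAt)
    LF.coe_nonneg hu.1 hv.1 (fun w hw => hLF.norm_sub_le hw hu.1))
  have h2 := (le_abs_self _).trans (abs_sub_sub_inner_le hP.convex_U
    (fun w hw => hP.hasGradientWithinAt_gap hw)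
    Lgap.coe_nonneg hu hv (fun w hw => hgap.norm_sub_le hw hu))
  have h3 := (le_abs_self _).trans (abs_sub_sub_inner_le hP.convex_domXY (f := P.penalty)
    (g := P.penaltyGradient)
    (fun w hw => (hP.hasGradientAt_penalty hw).gradientWithinAt)
    Lpen.coe_nonneg hu.1 hv.1 (fun w hw => hpen.norm_sub_le hw hu.1))
  have e : ∀ g : XY m n, ⟪(triple g 0 : XYZ m n p), v - u⟫ = ⟪g, v.fst - u.fst⟫ := fun g => by
    have : ⟪(triple g 0 : XYZ m n p), v - u⟫ = ⟪g, v.fst - u.fst⟫ + ⟪(0 : Vec p), v.snd - u.snd⟫ :=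
      rfl
    rw [this, inner_zero_left, add_zero]
  rw [psiGradient, inner_add_left, inner_add_left, real_inner_smul_left, real_inner_smul_left,
    e, e]
  simp only [Psi]
  have h2' := mul_le_mul_of_nonneg_left h2 hc₁.le
  have h3' := mul_le_mul_of_nonneg_left h3 hc₂.le
  have q1 : LF * ‖v.fst - u.fst‖ ^ 2 ≤ LF * ‖v - u‖ ^ 2 := by gcongr
  have q3 : c₂ * (Lpen * ‖v.fst - u.fst‖ ^ 2) ≤ c₂ * (Lpen * ‖v - u‖ ^ 2) := by gcongr
  linarith

end Standing

end Problem

/-! ### The inner loop: one step of projected descent-ascent -/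

theorem proj_orthant_apply {p : ℕ} (v : Vec p) (i : Fin p) :
    proj (orthant p) v i = max 0 (v i) := by
  have hq : (WithLp.toLp 2 fun i => max 0 (v i) : Vec p) ∈ orthant p := fun i => le_max_left _ _
  rw [proj_eq_of_inner_le_zero (convex_orthant p) (isClosed_orthant p) ⟨0, zero_mem_orthant p⟩ hq]
  intro b hb
  simp only [PiLp.inner_apply, Real.inner_apply, PiLp.sub_apply]
  refine Finset.sum_nonpos fun i _ => ?_
  rcases le_total 0 (v i) with h | h
  · simp [h]
  · simp only [max_eq_left h, sub_zero]
    exact mul_nonpos_of_nonpos_of_nonneg h (hb i)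

/-- A recursion `a_{j+1} ≤ (1 - 2 / (j + 1)) a_j + M / (j + 1)²` forces `a_j ≤ M / j`. The first
step has factor `-1`, so that the initial value does not matter. -/
theorem le_div_of_recursion {a : ℕ → ℝ} {M : ℝ} (ha : ∀ j, 0 ≤ a j) (hM : 0 ≤ M)
    (h : ∀ j : ℕ, a (j + 1) ≤ (1 - 2 / ((j : ℝ) + 1)) * a j + M / ((j : ℝ) + 1) ^ 2) {j : ℕ}
    (hj : 1 ≤ j) : a j ≤ M / j := by
  induction j, hj using Nat.le_induction with
  | base =>
    have := h 0
    have h0 := ha 0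
    norm_num at this ⊢
    linarith
  | succ j hj ih =>
    have hj' : (1 : ℝ) ≤ j := by exact_mod_cast hj
    have hj0 : (0 : ℝ) < j := by linarith
    refine (h j).trans ?_
    have hc : 0 ≤ 1 - 2 / ((j : ℝ) + 1) := by
      rw [sub_nonneg, div_le_one (by linarith)]; linarith
    calc (1 - 2 / ((j : ℝ) + 1)) * a j + M / ((j : ℝ) + 1) ^ 2
        ≤ (1 - 2 / ((j : ℝ) + 1)) * (M / j) + M / ((j : ℝ) + 1) ^ 2 := by gcongr
      _ ≤ M / ((j + 1 : ℕ) : ℝ) := by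
        push_cast
        rw [← sub_nonneg]
        have e : M / ((j : ℝ) + 1) - ((1 - 2 / ((j : ℝ) + 1)) * (M / j) + M / ((j : ℝ) + 1) ^ 2)
            = M / (j * ((j : ℝ) + 1) ^ 2) := by
          field_simp; ring
        rw [e]; positivity

namespace Problem

variable {m n p : ℕ} {Zt Xi : Type*} {P : Problem m n p Zt Xi}

/-- The Lyapunov function of the inner loop: the squared distance of `(w, λ)` to the saddle point,
each block weighted by the inverse of its step size. -/
def lyap (P : Problem m n p Zt Xi) (η ρ : ℝ) (x : Vec m) (z : Vec p) (w : Vec n) (l : Vec p) : ℝ :=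
  1 / η * ‖w - P.wStar x z‖ ^ 2 + 1 / ρ * ‖l - P.lamStar x z‖ ^ 2

theorem salm_succ (η ρ : ℝ) (x : Vec m) (z : Vec p) (w0 : Vec n) (ξ : ℕ → Xi) (j : ℕ) :
    P.salm η ρ x z w0 ξ (j + 1) =
      (proj P.Y ((P.salm η ρ x z w0 ξ j).1 - (η / ((j : ℝ) + 1)) •
        (P.gradLag (P.gradg (pair x (P.salm η ρ x z w0 ξ j).1) (ξ j))
          (pair x (P.salm η ρ x z w0 ξ j).1) (P.salm η ρ x z w0 ξ j).2).snd),
      proj (orthant p) ((P.salm η ρ x z w0 ξ j).2 + (ρ / ((j : ℝ) + 1)) •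
        P.gradDual x z (P.salm η ρ x z w0 ξ j).1 (P.salm η ρ x z w0 ξ j).2)) := rfl

namespace Standing

variable {LG LH : ℝ≥0} {μ MG M0 M1 : ℝ} (hP : P.Standing LG LH μ MG M0 M1)
include hP

/-- The multipliers produced by the inner loop stay bounded: each coordinate of a step is either
a convex combination of the old one and a bounded quantity, or, when `ρ γ₂ > j + 1`, dominated by
a bounded quantity alone. -/
theorem salm_mem (η : ℝ) {ρ : ℝ} (hρ : 1 / P.γ₂ ≤ ρ) {x : Vec m} (hx : x ∈ P.X) {z : Vec p}
    (hz : z ∈ P.Z) {w0 : Vec n} (hw0 : w0 ∈ P.Y) (ξ : ℕ → Xi) (j : ℕ) :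
    (P.salm η ρ x z w0 ξ j).1 ∈ P.Y ∧ (P.salm η ρ x z w0 ξ j).2 ∈ orthant p ∧
      ∀ i, (P.salm η ρ x z w0 ξ j).2 i ≤ ρ * (M0 + P.γ₂ * (P.B / Real.sqrt p)) := by
  have hγ₁ := hP.γ₁_pos
  have hγ := hP.γ₂_pos
  have hρ0 : 0 < ρ := lt_of_lt_of_le (by positivity) hρ
  have hρ1 : 1 ≤ ρ * P.γ₂ := by rwa [div_le_iff₀ hγ] at hρ
  have hM0 := hP.M0_nonneg
  have hB := hP.B_nonneg
  set b := P.B / Real.sqrt p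
  have hb : 0 ≤ b := by positivity
  set N := M0 + P.γ₂ * b with hN
  have hN0 : 0 ≤ N := by positivity
  induction j with
  | zero => exact ⟨hw0, zero_mem_orthant p, fun i => by
      simp only [salm, PiLp.zero_apply]; positivity⟩
  | succ j ih =>
    obtain ⟨hw, hl, hlR⟩ := ih
    rw [salm_succ]
    set w := (P.salm η ρ x z w0 ξ j).1
    set l := (P.salm η ρ x z w0 ξ j).2
    refine ⟨proj_mem hP.convY hP.compY.isClosed ⟨_, hw⟩ _,
      proj_mem (convex_orthant p) (isClosed_orthant p) ⟨0, zero_mem_orthant p⟩ _, fun i => ?_⟩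
    dsimp only
    rw [proj_orthant_apply]
    refine max_le (by positivity) ?_
    have hH := (abs_le.1 ((hP.bounded (pair x w) ⟨hx, hw⟩).2 i).1).2
    have hli : 0 ≤ l i := hl i
    have hlRi := hlR i
    have hzi := (hz i).2
    have h1 : max 0 (P.γ₁ * l i + P.H i (pair x w)) - P.γ₁ * l i ≤ M0 := by
      rw [sub_le_iff_le_add]
      have := mul_nonneg hγ₁.le hli
      exact max_le (by linarith) (by linarith)
    simp only [PiLp.add_apply, PiLp.smul_apply, smul_eq_mul, gradDual]
    set s := max 0 (P.γ₁ * l i + P.H i (pair x w)) - P.γ₁ * l i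
    set t := ρ / ((j : ℝ) + 1) with ht
    have ht0 : 0 ≤ t := by positivity
    have htρ : t ≤ ρ := div_le_self hρ0.le (by linarith [Nat.cast_nonneg (α := ℝ) j])
    have h2 : s + P.γ₂ * z i ≤ N := by
      have : P.γ₂ * z i ≤ P.γ₂ * b := by gcongr
      linarith
    have h3 : t * (s + P.γ₂ * z i) ≤ t * N := by gcongr
    rcases le_total (t * P.γ₂) 1 with h | h
    · have h4 : (1 - t * P.γ₂) * l i ≤ (1 - t * P.γ₂) * (ρ * N) := by
        gcongr
      have h5 : t * N ≤ t * P.γ₂ * (ρ * N) := by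
        have := mul_le_mul_of_nonneg_left hρ1 (mul_nonneg ht0 hN0)
        nlinarith
      nlinarith
    · have h4 : (1 - t * P.γ₂) * l i ≤ 0 :=
        mul_nonpos_of_nonpos_of_nonneg (by linarith) hli
      have h5 : t * N ≤ ρ * N := by gcongr
      nlinarith

theorem exists_norm_salm_le {ρ : ℝ} (hρ : 1 / P.γ₂ ≤ ρ) : ∃ R, 0 ≤ R ∧ ∀ η : ℝ,
    ∀ x ∈ P.X, ∀ z ∈ P.Z, ∀ w0 ∈ P.Y, ∀ (ξ : ℕ → Xi) (j : ℕ),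
      ‖(P.salm η ρ x z w0 ξ j).2‖ ≤ R := by
  have hγ := hP.γ₂_pos
  have hρ0 : 0 < ρ := lt_of_lt_of_le (by positivity) hρ
  have hM0 := hP.M0_nonneg
  have hB := hP.B_nonneg
  refine ⟨Real.sqrt p * (ρ * (M0 + P.γ₂ * (P.B / Real.sqrt p))), by positivity, ?_⟩
  intro η x hx z hz w0 hw0 ξ j
  have h := hP.salm_mem η hρ hx hz hw0 ξ j
  exact norm_le_sqrt_mul (by positivity) fun i => by
    rw [abs_of_nonneg (h.2.1 i)]; exact h.2.2 i

/-- One inner step multiplies the Lyapunov function by `1 - 2 / (j + 1)`, up to a term linear in the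
error `a - ∇G` of the gradient estimate, which has mean zero at a fresh sample, and a term of order
`1 / (j + 1)²`. The choice `η ≥ 1 / μ`, `ρ ≥ 1 / γ₂` makes the strong monotonicity strong enough for
the factor `2`. -/
theorem exists_lyap_step_le {η ρ : ℝ} (hη : 1 / μ ≤ η) (hρ : 1 / P.γ₂ ≤ ρ) (R : ℝ) :
    ∃ M, 0 ≤ M ∧ ∀ x ∈ P.X, ∀ z ∈ P.Z, ∀ w ∈ P.Y, ∀ l ∈ orthant p, ‖l‖ ≤ R →
      ∀ (a : XY m n) (j : ℕ),
        P.lyap η ρ x z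
          (proj P.Y (w - (η / ((j : ℝ) + 1)) • (P.gradLag a (pair x w) l).snd))
          (proj (orthant p) (l + (ρ / ((j : ℝ) + 1)) • P.gradDual x z w l))
        ≤ (1 - 2 / ((j : ℝ) + 1)) * P.lyap η ρ x z w l
          - 2 / ((j : ℝ) + 1) * ⟪pair 0 (w - P.wStar x z), a - ∇ P.G (pair x w)⟫
          + (M + 2 * η * ‖a - ∇ P.G (pair x w)‖ ^ 2) / ((j : ℝ) + 1) ^ 2 := by
  have hγ₁ := hP.γ₁_pos
  have hγ := hP.γ₂_pos
  have hμ := hP.μ_pos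
  have hη0 : 0 < η := lt_of_lt_of_le (by positivity) hη
  have hρ0 : 0 < ρ := lt_of_lt_of_le (by positivity) hρ
  have hM0 := hP.M0_nonneg
  have hM1 := hP.M1_nonneg
  have hMG := hP.MG_nonneg
  have hB := hP.B_nonneg
  set A := MG + 1 / P.γ₁ * (p * ((P.γ₁ * R + M0) * M1))
  set D := Real.sqrt p * (M0 + P.γ₂ * (R + P.B / Real.sqrt p))
  refine ⟨2 * η * A ^ 2 + ρ * D ^ 2, by positivity, ?_⟩
  intro x hx z hz w hw l hl hlR a j
  have hY : P.Y.Nonempty := ⟨w, hw⟩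
  set t : ℝ := 1 / ((j : ℝ) + 1) with ht
  have hj0 : (0 : ℝ) < (j : ℝ) + 1 := by positivity
  have ht0 : 0 ≤ t := by positivity
  have eη : η / ((j : ℝ) + 1) = η * t := by rw [ht]; ring
  have eρ : ρ / ((j : ℝ) + 1) = ρ * t := by rw [ht]; ring
  have e2 : 2 / ((j : ℝ) + 1) = 2 * t := by rw [ht]; ring
  have e3 : ∀ c : ℝ, c / ((j : ℝ) + 1) ^ 2 = t ^ 2 * c := fun c => by rw [ht]; field_simp
  rw [eη, eρ, e2, e3]
  have hmono := hP.inner_gradLag_sub_inner_gradDual_ge hY hx z hw hl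
  have hg : ‖P.gradLag (∇ P.G (pair x w)) (pair x w) l‖ ≤ A :=
    hP.norm_gradLag_le (v := pair x w) ⟨hx, hw⟩ hlR
  have hd : ‖P.gradDual x z w l‖ ≤ D :=
    (hP.norm_gradDual_le hx hz hw hl).trans (by simp only [D]; gcongr)
  set w' := P.wStar x z
  set l' := P.lamStar x z
  set δ := a - ∇ P.G (pair x w) with hδ
  set g := P.gradLag (∇ P.G (pair x w)) (pair x w) l
  set d := P.gradDual x z w l
  have ega : (P.gradLag a (pair x w) l).snd = g.snd + δ.snd := by
    have : P.gradLag a (pair x w) l = g + δ := by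
      rw [hδ, ← gradLag_sub_gradLag (P := P) a (∇ P.G (pair x w)) (pair x w) l]; abel
    rw [this]; rfl
  have einner : ⟪pair 0 (w - w'), δ⟫ = ⟪δ.snd, w - w'⟫ := by
    rw [real_inner_comm, inner_pair, inner_zero_right, zero_add]
  rw [ega, einner]
  have p1 : ‖proj P.Y (w - (η * t) • (g.snd + δ.snd)) - w'‖ ^ 2
      ≤ ‖w - w'‖ ^ 2 - 2 * (η * t) * (⟪g.snd, w - w'⟫ + ⟪δ.snd, w - w'⟫)
        + (η * t) ^ 2 * (2 * A ^ 2 + 2 * ‖δ‖ ^ 2) := by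
    have h1 := norm_proj_sub_le hP.convY hP.compY.isClosed hY (hP.wStar_mem hY hx z)
      (w - (η * t) • (g.snd + δ.snd))
    have h2 := pow_le_pow_left₀ (norm_nonneg _) h1 2
    refine h2.trans ?_
    rw [sub_right_comm, norm_sub_sq_real, inner_smul_right, norm_smul, mul_pow, Real.norm_eq_abs,
      sq_abs, real_inner_comm, inner_add_left]
    have h3 : ‖g.snd + δ.snd‖ ^ 2 ≤ 2 * A ^ 2 + 2 * ‖δ‖ ^ 2 := by
      have i1 : ‖g.snd + δ.snd‖ ≤ A + ‖δ‖ :=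
        (norm_add_le _ _).trans (add_le_add ((norm_snd_le _).trans hg) (norm_snd_le _))
      have i2 := pow_le_pow_left₀ (norm_nonneg _) i1 2
      nlinarith [sq_nonneg (A - ‖δ‖)]
    have h4 := mul_le_mul_of_nonneg_left h3 (sq_nonneg (η * t))
    linarith
  have p2 : ‖proj (orthant p) (l + (ρ * t) • d) - l'‖ ^ 2
      ≤ ‖l - l'‖ ^ 2 + 2 * (ρ * t) * ⟪d, l - l'⟫ + (ρ * t) ^ 2 * D ^ 2 := by
    have h1 := norm_proj_sub_le (convex_orthant p) (isClosed_orthant p) ⟨0, zero_mem_orthant p⟩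
      (hP.lamStar_spec hY hx z).1 (l + (ρ * t) • d)
    have h2 := pow_le_pow_left₀ (norm_nonneg _) h1 2
    refine h2.trans ?_
    rw [add_sub_right_comm, norm_add_sq_real, inner_smul_right, norm_smul, mul_pow,
      Real.norm_eq_abs, sq_abs, real_inner_comm]
    have h3 : ‖d‖ ^ 2 ≤ D ^ 2 := pow_le_pow_left₀ (norm_nonneg _) hd 2
    have h4 := mul_le_mul_of_nonneg_left h3 (sq_nonneg (ρ * t))
    linarith
  have q1 := mul_le_mul_of_nonneg_left p1 (show 0 ≤ 1 / η by positivity)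
  have q2 := mul_le_mul_of_nonneg_left p2 (show 0 ≤ 1 / ρ by positivity)
  have r1 : 1 / η * (‖w - w'‖ ^ 2 - 2 * (η * t) * (⟪g.snd, w - w'⟫ + ⟪δ.snd, w - w'⟫)
        + (η * t) ^ 2 * (2 * A ^ 2 + 2 * ‖δ‖ ^ 2)) = 1 / η * ‖w - w'‖ ^ 2
        - 2 * t * (⟪g.snd, w - w'⟫ + ⟪δ.snd, w - w'⟫)
        + t ^ 2 * (η * (2 * A ^ 2 + 2 * ‖δ‖ ^ 2)) := by field_simp
  have r2 : 1 / ρ * (‖l - l'‖ ^ 2 + 2 * (ρ * t) * ⟪d, l - l'⟫ + (ρ * t) ^ 2 * D ^ 2)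
      = 1 / ρ * ‖l - l'‖ ^ 2 + 2 * t * ⟪d, l - l'⟫ + t ^ 2 * (ρ * D ^ 2) := by field_simp
  have h5 : 1 / η * ‖w - w'‖ ^ 2 + 1 / ρ * ‖l - l'‖ ^ 2 ≤ ⟪g.snd, w - w'⟫ - ⟪d, l - l'⟫ := by
    refine le_trans (add_le_add ?_ ?_) hmono
    · gcongr; rw [div_le_comm₀ hη0 hμ]; exact hη
    · gcongr; rw [div_le_comm₀ hρ0 hγ]; exact hρ
  have h6 := mul_le_mul_of_nonneg_left h5 (mul_nonneg zero_le_two ht0)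
  simp only [lyap]
  linarith

end Standing

end Problem

/-! ### Stochastic oracles at fresh samples -/

theorem integrable_inner_of_memLp {E Ω : Type*} [NormedAddCommGroup E] [InnerProductSpace ℝ E]
    {mΩ : MeasurableSpace Ω} {μ : Measure Ω} {f g : Ω → E}
    (hf : MemLp f 2 μ) (hg : MemLp g 2 μ) : Integrable (fun ω => ⟪f ω, g ω⟫) μ := by
  refine Integrable.mono' ((hf.integrable_norm_pow (p := 2) two_ne_zero).add
    (hg.integrable_norm_pow (p := 2) two_ne_zero)) (hf.1.inner hg.1)
    (Eventually.of_forall fun ω => ?_)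
  refine (norm_inner_le_norm _ _).trans ?_
  simp only [Pi.add_apply]
  nlinarith [sq_nonneg (‖f ω‖ - ‖g ω‖), sq_nonneg (‖f ω‖), sq_nonneg (‖g ω‖)]

/-- A variable that depends on the past and a fresh sample have a product law. -/
theorem map_prodMk_eq {F Ξ Ω : Type*} [MeasurableSpace F] [MeasurableSpace Ξ]
    {m mΩ : MeasurableSpace Ω} {Pr : Measure Ω} [IsProbabilityMeasure Pr] {D : Measure Ξ}
    (hm : m ≤ mΩ) {T : Ω → Ξ} (hT : Measurable T) (hlaw : Pr.map T = D)
    (hind : Indep m (MeasurableSpace.comap T inferInstance) Pr) {W : Ω → F}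
    (hW : Measurable[m] W) : Pr.map (fun ω => (W ω, T ω)) = (Pr.map W).prod D := by
  have hW' : Measurable W := hW.mono hm le_rfl
  have hi : IndepFun W T Pr := by
    rw [IndepFun_iff_Indep]
    exact indep_of_indep_of_le_left hind hW.comap_le
  rw [(indepFun_iff_map_prod_eq_prod_map_map hW'.aemeasurable hT.aemeasurable).1 hi, hlaw]

section Oracle

variable {E Ξ Ω : Type*} [NormedAddCommGroup E] [InnerProductSpace ℝ E] [CompleteSpace E]
  [MeasurableSpace E] [BorelSpace E] [SecondCountableTopology E] [MeasurableSpace Ξ]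

/-- `g` is a measurable unbiased oracle for `gbar` at the points of `S`, with variance at most
`σ²`. -/
structure IsOracle (D : Measure Ξ) (g : E → Ξ → E) (gbar : E → E) (S : Set E) (σ : ℝ) : Prop where
  measurable : Measurable (Function.uncurry g)
  measurable_mean : Measurable gbar
  memLp : ∀ v ∈ S, MemLp (g v) 2 D
  integral_eq : ∀ v ∈ S, ∫ ξ, g v ξ ∂D = gbar v
  variance_le : ∀ v ∈ S, ∫ ξ, ‖g v ξ - gbar v‖ ^ 2 ∂D ≤ σ ^ 2

variable {D : Measure Ξ} [IsProbabilityMeasure D] {g : E → Ξ → E} {gbar : E → E} {S : Set E} {σ : ℝ}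
  (hO : IsOracle D g gbar S σ)
include hO

namespace IsOracle

omit [CompleteSpace E] [IsProbabilityMeasure D] in
theorem measurable_noise : Measurable fun q : E × Ξ => g q.1 q.2 - gbar q.1 :=
  hO.measurable.sub (hO.measurable_mean.comp measurable_fst)

omit [CompleteSpace E] [BorelSpace E] [SecondCountableTopology E] in
theorem lintegral_noise_le {v : E} (hv : v ∈ S) :
    ∫⁻ ξ, ENNReal.ofReal (‖g v ξ - gbar v‖ ^ 2) ∂D ≤ ENNReal.ofReal (σ ^ 2) := by
  have h1 : MemLp (fun ξ => g v ξ - gbar v) 2 D := (hO.memLp v hv).sub (memLp_const _)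
  rw [← ofReal_integral_eq_lintegral_ofReal (h1.integrable_norm_pow (p := 2) two_ne_zero)
    (Eventually.of_forall fun ξ => by positivity)]
  exact ENNReal.ofReal_le_ofReal (hO.variance_le v hv)

variable {m mΩ : MeasurableSpace Ω} {Pr : Measure Ω} [IsProbabilityMeasure Pr]
  (hm : m ≤ mΩ) {V : Ω → E} (hV : Measurable[m] V) (hVS : ∀ ω, V ω ∈ S)
  {T : Ω → Ξ} (hT : Measurable T) (hlaw : Pr.map T = D)
  (hind : Indep m (MeasurableSpace.comap T inferInstance) Pr)
include hm hV hVS hT hlaw hind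

omit [CompleteSpace E] in
theorem lintegral_noise_comp_le :
    ∫⁻ ω, ENNReal.ofReal (‖g (V ω) (T ω) - gbar (V ω)‖ ^ 2) ∂Pr ≤ ENNReal.ofReal (σ ^ 2) := by
  have hV' : Measurable V := hV.mono hm le_rfl
  have hF : Measurable fun q : E × Ξ => ENNReal.ofReal (‖g q.1 q.2 - gbar q.1‖ ^ 2) :=
    (hO.measurable_noise.norm.pow_const 2).ennreal_ofReal
  have h1 : ∫⁻ ω, ENNReal.ofReal (‖g (V ω) (T ω) - gbar (V ω)‖ ^ 2) ∂Pr
      = ∫⁻ ω, ∫⁻ ξ, ENNReal.ofReal (‖g (V ω) ξ - gbar (V ω)‖ ^ 2) ∂D ∂Pr := by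
    rw [← lintegral_map (f := fun q : E × Ξ => ENNReal.ofReal (‖g q.1 q.2 - gbar q.1‖ ^ 2))
      (g := fun ω => (V ω, T ω)) hF (hV'.prodMk hT), map_prodMk_eq hm hT hlaw hind hV,
      lintegral_prod _ hF.aemeasurable,
      lintegral_map (f := fun v => ∫⁻ ξ, ENNReal.ofReal (‖g v ξ - gbar v‖ ^ 2) ∂D)
        hF.lintegral_prod_right' hV']
  rw [h1]
  refine (lintegral_mono fun ω => hO.lintegral_noise_le (hVS ω)).trans ?_
  simp

omit [CompleteSpace E] in
theorem memLp_noise : MemLp (fun ω => g (V ω) (T ω) - gbar (V ω)) 2 Pr := by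
  have hV' : Measurable V := hV.mono hm le_rfl
  have hmeas : Measurable fun ω => g (V ω) (T ω) - gbar (V ω) :=
    hO.measurable_noise.comp (hV'.prodMk hT)
  rw [memLp_two_iff_integrable_sq_norm hmeas.aestronglyMeasurable]
  refine ⟨(hmeas.norm.pow_const 2).aestronglyMeasurable, ?_⟩
  rw [hasFiniteIntegral_iff_ofReal (Eventually.of_forall fun ω => by positivity)]
  exact (hO.lintegral_noise_comp_le hm hV hVS hT hlaw hind).trans_lt ENNReal.ofReal_lt_top

omit [CompleteSpace E] in
theorem integral_norm_noise_sq_le :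
    ∫ ω, ‖g (V ω) (T ω) - gbar (V ω)‖ ^ 2 ∂Pr ≤ σ ^ 2 := by
  have h := hO.lintegral_noise_comp_le hm hV hVS hT hlaw hind
  rw [← ofReal_integral_eq_lintegral_ofReal
    ((hO.memLp_noise hm hV hVS hT hlaw hind).integrable_norm_pow (p := 2) two_ne_zero)
    (Eventually.of_forall fun ω => by positivity)] at h
  exact (ENNReal.ofReal_le_ofReal_iff (sq_nonneg _)).1 h

/-- The noise at a fresh sample is orthogonal to everything determined by the past. -/
theorem integral_inner_noise_eq_zero {W : Ω → E} (hW : Measurable[m] W) (hW2 : MemLp W 2 Pr) :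
    ∫ ω, ⟪W ω, g (V ω) (T ω) - gbar (V ω)⟫ ∂Pr = 0 := by
  have hV' : Measurable V := hV.mono hm le_rfl
  have hW' : Measurable W := hW.mono hm le_rfl
  have hWV : Measurable[m] fun ω => (W ω, V ω) := hW.prodMk hV
  have hmap := map_prodMk_eq hm hT hlaw hind hWV
  have hF : Measurable fun q : (E × E) × Ξ => ⟪q.1.1, g q.1.2 q.2 - gbar q.1.2⟫ :=
    (measurable_fst.comp measurable_fst).inner
      (hO.measurable_noise.comp ((measurable_snd.comp measurable_fst).prodMk measurable_snd))
  have hq : Measurable fun ω => ((W ω, V ω), T ω) := (hW'.prodMk hV').prodMk hT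
  have hint : Integrable (fun q : (E × E) × Ξ => ⟪q.1.1, g q.1.2 q.2 - gbar q.1.2⟫)
      ((Pr.map fun ω => (W ω, V ω)).prod D) := by
    rw [← hmap, integrable_map_measure hF.aestronglyMeasurable hq.aemeasurable]
    exact integrable_inner_of_memLp hW2 (hO.memLp_noise hm hV hVS hT hlaw hind)
  rw [← integral_map (φ := fun ω => ((W ω, V ω), T ω))
    (f := fun q : (E × E) × Ξ => ⟪q.1.1, g q.1.2 q.2 - gbar q.1.2⟫) hq.aemeasurable
    hF.aestronglyMeasurable, hmap, integral_prod _ hint,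
    integral_map (hW'.prodMk hV').aemeasurable
      hF.stronglyMeasurable.integral_prod_right'.aestronglyMeasurable]
  refine integral_eq_zero_of_ae (Eventually.of_forall fun ω => ?_)
  have h1 : Integrable (g (V ω)) D := (hO.memLp _ (hVS ω)).integrable (by norm_num)
  have h2 : Integrable (fun ξ => g (V ω) ξ - gbar (V ω)) D := h1.sub (integrable_const _)
  simp only [Pi.zero_apply]
  rw [integral_inner h2, integral_sub h1 (integrable_const _), hO.integral_eq _ (hVS ω)]
  simp

end IsOracle

end Oracle

section Batch

variable {E Ξ Ω : Type*} [NormedAddCommGroup E] [InnerProductSpace ℝ E] [CompleteSpace E]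
  [MeasurableSpace E] [BorelSpace E] [SecondCountableTopology E] [MeasurableSpace Ξ]
  {D : Measure Ξ} [IsProbabilityMeasure D] {g : E → Ξ → E} {gbar : E → E} {S : Set E} {σ : ℝ}
  {m : ℕ → MeasurableSpace Ω} {mΩ : MeasurableSpace Ω} {Pr : Measure Ω} [IsProbabilityMeasure Pr]
  {V : Ω → E} {T : ℕ → Ω → Ξ}

/-- The summed noise of `b` successive fresh samples has second moment at most `b σ²`. -/
theorem IsOracle.sum_noise (hO : IsOracle D g gbar S σ) (hmono : Monotone m) (hm : ∀ j, m j ≤ mΩ)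
    (hV : Measurable[m 0] V) (hVS : ∀ ω, V ω ∈ S) (hT : ∀ j, Measurable[m (j + 1)] (T j))
    (hlaw : ∀ j, Pr.map (T j) = D)
    (hind : ∀ j, Indep (m j) (MeasurableSpace.comap (T j) inferInstance) Pr) (b : ℕ) :
    Measurable[m b] (fun ω => ∑ j ∈ Finset.range b, (g (V ω) (T j ω) - gbar (V ω))) ∧
    MemLp (fun ω => ∑ j ∈ Finset.range b, (g (V ω) (T j ω) - gbar (V ω))) 2 Pr ∧
    ∫ ω, ‖∑ j ∈ Finset.range b, (g (V ω) (T j ω) - gbar (V ω))‖ ^ 2 ∂Pr ≤ b * σ ^ 2 := by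
  induction b with
  | zero => simp
  | succ b ih =>
    obtain ⟨ih1, ih2, ih3⟩ := ih
    have hVb : ∀ j, Measurable[m j] V := fun j => hV.mono (hmono (Nat.zero_le j)) le_rfl
    have hTb : Measurable (T b) := (hT b).mono (hm _) le_rfl
    have h2 := hO.memLp_noise (hm b) (hVb b) hVS hTb (hlaw b) (hind b)
    have h3 := hO.integral_norm_noise_sq_le (hm b) (hVb b) hVS hTb (hlaw b) (hind b)
    have h4 := hO.integral_inner_noise_eq_zero (hm b) (hVb b) hVS hTb (hlaw b) (hind b) ih1 ih2
    have h5 := integrable_inner_of_memLp ih2 h2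
    simp only [Finset.sum_range_succ]
    refine ⟨?_, ih2.add h2, ?_⟩
    · have h6 : Measurable[m (b + 1)] fun ω => g (V ω) (T b ω) - gbar (V ω) :=
        hO.measurable_noise.comp ((hVb (b + 1)).prodMk (hT b))
      exact (ih1.mono (hmono (Nat.le_succ b)) le_rfl).add h6
    · simp only [norm_add_sq_real]
      have i1 := ih2.integrable_norm_pow (p := 2) two_ne_zero
      have i2 := h2.integrable_norm_pow (p := 2) two_ne_zero
      have i3 : Integrable (fun ω => ‖∑ j ∈ Finset.range b, (g (V ω) (T j ω) - gbar (V ω))‖ ^ 2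
          + 2 * ⟪∑ j ∈ Finset.range b, (g (V ω) (T j ω) - gbar (V ω)),
            g (V ω) (T b ω) - gbar (V ω)⟫) Pr := i1.add (h5.const_mul 2)
      rw [integral_add i3 i2, integral_add i1 (h5.const_mul 2),
        integral_const_mul, h4]
      push_cast
      linarith

/-- The mini-batch average of `b` fresh samples has variance at most `σ² / b`. -/
theorem IsOracle.batch_noise {m n : ℕ} {g : XY m n → Ξ → XY m n} {gbar : XY m n → XY m n}
    {S : Set (XY m n)} {h : ℕ → MeasurableSpace Ω} {V : Ω → XY m n}
    (hO : IsOracle D g gbar S σ) (hmono : Monotone h)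
    (hm : ∀ j, h j ≤ mΩ) (hV : Measurable[h 0] V) (hVS : ∀ ω, V ω ∈ S)
    (hT : ∀ j, Measurable[h (j + 1)] (T j)) (hlaw : ∀ j, Pr.map (T j) = D)
    (hind : ∀ j, Indep (h j) (MeasurableSpace.comap (T j) inferInstance) Pr) {b : ℕ}
    (hb : 1 ≤ b) :
    Integrable (fun ω => ‖Problem.batch b (g (V ω)) (fun j => T j ω) - gbar (V ω)‖ ^ 2) Pr ∧
    ∫ ω, ‖Problem.batch b (g (V ω)) (fun j => T j ω) - gbar (V ω)‖ ^ 2 ∂Pr ≤ σ ^ 2 / b := by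
  obtain ⟨-, h2, h3⟩ := hO.sum_noise hmono hm hV hVS hT hlaw hind b
  have hb0 : (0 : ℝ) < b := by exact_mod_cast hb
  have e : ∀ ω, ‖Problem.batch b (g (V ω)) (fun j => T j ω) - gbar (V ω)‖ ^ 2
      = (1 / (b : ℝ)) ^ 2 * ‖∑ j ∈ Finset.range b, (g (V ω) (T j ω) - gbar (V ω))‖ ^ 2 := by
    intro ω
    have : Problem.batch b (g (V ω)) (fun j => T j ω) - gbar (V ω)
        = (1 / (b : ℝ)) • ∑ j ∈ Finset.range b, (g (V ω) (T j ω) - gbar (V ω)) := by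
      rw [Problem.batch, Finset.sum_sub_distrib, smul_sub, Finset.sum_const, Finset.card_range,
        ← Nat.cast_smul_eq_nsmul ℝ, smul_smul, one_div_mul_cancel hb0.ne', one_smul]
    rw [this, norm_smul, mul_pow, Real.norm_eq_abs, sq_abs]
  simp only [e]
  refine ⟨(h2.integrable_norm_pow (p := 2) two_ne_zero).const_mul _, ?_⟩
  rw [integral_const_mul]
  calc (1 / (b : ℝ)) ^ 2 * _ ≤ (1 / (b : ℝ)) ^ 2 * (b * σ ^ 2) := by gcongr
    _ = σ ^ 2 / b := by field_simp

end Batch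

/-! ### Measurability and the expected accuracy of the inner loop -/

/-- A function continuous on a set `S` may be composed with measurable maps into `S`. -/
theorem _root_.ContinuousOn.measurable_comp_of_forall_mem {Ω A B : Type*} {mΩ : MeasurableSpace Ω}
    [TopologicalSpace A] [MeasurableSpace A] [BorelSpace A] [TopologicalSpace B]
    [MeasurableSpace B] [BorelSpace B] {S : Set A} {f : A → B} (hf : ContinuousOn f S) {V : Ω → A}
    (hV : Measurable V) (hVS : ∀ ω, V ω ∈ S) : Measurable fun ω => f (V ω) :=
  (continuousOn_iff_continuous_domRestrict.1 hf).measurable.comp (hV.subtype_mk (h := hVS))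

theorem continuousOn_of_norm_sub_le {A B E : Type*} [NormedAddCommGroup A] [NormedAddCommGroup B]
    [NormedAddCommGroup E] {S : Set (A × B)} {f : A × B → E} {C : ℝ} (hC : 0 ≤ C)
    (h : ∀ q ∈ S, ∀ q' ∈ S, ‖f q - f q'‖ ≤ C * (‖q.1 - q'.1‖ + ‖q.2 - q'.2‖)) :
    ContinuousOn f S := by
  refine (LipschitzOnWith.of_dist_le_mul (K := (C * 2).toNNReal) fun q hq q' hq' => ?_).continuousOn
  rw [Real.coe_toNNReal _ (by positivity), dist_eq_norm, dist_eq_norm, mul_assoc, two_mul]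
  refine (h q hq q' hq').trans ?_
  gcongr
  · exact _root_.norm_fst_le (q - q')
  · exact _root_.norm_snd_le (q - q')

theorem measurable_gradient {E : Type*} [NormedAddCommGroup E] [InnerProductSpace ℝ E]
    [CompleteSpace E] [MeasurableSpace E] [BorelSpace E] (f : E → ℝ) : Measurable (∇ f) :=
  (InnerProductSpace.toDual ℝ E).symm.continuous.measurable.comp (measurable_fderiv ℝ f)

theorem measurable_pair {Ω : Type*} {mΩ : MeasurableSpace Ω} {m n : ℕ} {x : Ω → Vec m}
    {y : Ω → Vec n} (hx : Measurable x) (hy : Measurable y) :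
    Measurable fun ω => pair (x ω) (y ω) :=
  (WithLp.measurable_toLp 2 _).comp (hx.prodMk hy)

theorem measurable_triple {Ω : Type*} {mΩ : MeasurableSpace Ω} {m n p : ℕ} {v : Ω → XY m n}
    {z : Ω → Vec p} (hv : Measurable v) (hz : Measurable z) :
    Measurable fun ω => triple (v ω) (z ω) :=
  (WithLp.measurable_toLp 2 _).comp (hv.prodMk hz)

theorem measurable_withLp_fst {Ω E F : Type*} {mΩ : MeasurableSpace Ω} [MeasurableSpace E]
    [MeasurableSpace F] {v : Ω → WithLp 2 (E × F)} (hv : Measurable v) :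
    Measurable fun ω => (v ω).fst :=
  measurable_fst.comp ((WithLp.measurable_ofLp 2 _).comp hv)

theorem measurable_withLp_snd {Ω E F : Type*} {mΩ : MeasurableSpace Ω} [MeasurableSpace E]
    [MeasurableSpace F] {v : Ω → WithLp 2 (E × F)} (hv : Measurable v) :
    Measurable fun ω => (v ω).snd :=
  measurable_snd.comp ((WithLp.measurable_ofLp 2 _).comp hv)

theorem measurable_vec_apply {Ω : Type*} {mΩ : MeasurableSpace Ω} {d : ℕ} {v : Ω → Vec d}
    (hv : Measurable v) (i : Fin d) : Measurable fun ω => v ω i :=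
  (measurable_pi_apply i).comp ((WithLp.measurable_ofLp 2 _).comp hv)

/-- Integration of a recursive inequality whose linear noise term `I` has mean zero. -/
theorem integral_le_of_forall_le {Ω : Type*} {mΩ : MeasurableSpace Ω} {μ : Measure Ω}
    [IsProbabilityMeasure μ] {V' V I N : Ω → ℝ} {c d M e q s : ℝ} (hV' : Integrable V' μ)
    (hV : Integrable V μ) (hI : Integrable I μ) (hN : Integrable N μ)
    (h : ∀ ω, V' ω ≤ c * V ω - d * I ω + (M + e * N ω) / q) (hI0 : ∫ ω, I ω ∂μ = 0)
    (hNs : ∫ ω, N ω ∂μ ≤ s) (he : 0 ≤ e) (hq : 0 ≤ q) :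
    ∫ ω, V' ω ∂μ ≤ c * ∫ ω, V ω ∂μ + (M + e * s) / q := by
  have i1 : Integrable (fun ω => c * V ω - d * I ω) μ := (hV.const_mul c).sub (hI.const_mul d)
  have i2 : Integrable (fun ω => (M + e * N ω) / q) μ :=
    ((integrable_const M).add (hN.const_mul e)).div_const q
  refine (integral_mono hV' (i1.add i2) h).trans ?_
  rw [integral_add' i1 i2, integral_sub (hV.const_mul c) (hI.const_mul d), integral_const_mul,
    integral_const_mul, hI0, mul_zero, sub_zero, integral_div,
    integral_add (integrable_const M) (hN.const_mul e), integral_const_mul, integral_const,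
    probReal_univ, one_smul]
  gcongr

namespace Problem

variable {m n p : ℕ} {Zt Xi : Type*} {P : Problem m n p Zt Xi}

namespace Standing

variable {LG LH : ℝ≥0} {μ MG M0 M1 : ℝ} (hP : P.Standing LG LH μ MG M0 M1)
include hP

section Measurability

variable {Ω : Type*} {mΩ : MeasurableSpace Ω}

theorem measurable_H_comp (i : Fin p) {v : Ω → XY m n} (hv : Measurable v)
    (hvS : ∀ ω, v ω ∈ P.domXY) : Measurable fun ω => P.H i (v ω) :=
  (hP.continuousOn_H i).measurable_comp_of_forall_mem hv hvS

theorem measurable_gradLag {a v : Ω → XY m n} {l : Ω → Vec p} (ha : Measurable a)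
    (hv : Measurable v) (hvS : ∀ ω, v ω ∈ P.domXY) (hl : Measurable l) :
    Measurable fun ω => P.gradLag (a ω) (v ω) (l ω) := by
  have hs : Measurable fun ω => ∑ i, max 0 (P.γ₁ * l ω i + P.H i (v ω)) • ∇ (P.H i) (v ω) :=
    Finset.measurable_fun_sum _ fun i _ =>
      (measurable_const.max (((measurable_vec_apply hl i).const_mul _).add
        (hP.measurable_H_comp i hv hvS))).smul ((measurable_gradient _).comp hv)
  exact ha.add (hs.const_smul (1 / P.γ₁))

theorem measurable_penaltyGradient {v : Ω → XY m n} (hv : Measurable v)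
    (hvS : ∀ ω, v ω ∈ P.domXY) : Measurable fun ω => P.penaltyGradient (v ω) :=
  Finset.measurable_fun_sum _ fun i _ =>
    (measurable_const.max (hP.measurable_H_comp i hv hvS)).smul ((measurable_gradient _).comp hv)

theorem measurable_gradDual {x : Ω → Vec m} {z : Ω → Vec p} {w : Ω → Vec n} {l : Ω → Vec p}
    (hx : Measurable x) (hz : Measurable z) (hw : Measurable w) (hl : Measurable l)
    (hxX : ∀ ω, x ω ∈ P.X) (hwY : ∀ ω, w ω ∈ P.Y) :
    Measurable fun ω => P.gradDual (x ω) (z ω) (w ω) (l ω) := by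
  refine (WithLp.measurable_toLp 2 _).comp (measurable_pi_lambda _ fun i => ?_)
  have h1 := hP.measurable_H_comp i (measurable_pair hx hw) fun ω => ⟨hxX ω, hwY ω⟩
  have h2 := measurable_vec_apply hl i
  have h3 := measurable_vec_apply hz i
  exact ((measurable_const.max ((h2.const_mul _).add h1)).sub (h2.const_mul _)).sub
    ((h2.sub h3).const_mul _)

theorem measurable_star (hY : P.Y.Nonempty) {x : Ω → Vec m} {z : Ω → Vec p} (hx : Measurable x)
    (hz : Measurable z) (hxX : ∀ ω, x ω ∈ P.X) (hzZ : ∀ ω, z ω ∈ P.Z) :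
    (Measurable fun ω => P.wStar (x ω) (z ω)) ∧ Measurable fun ω => P.lamStar (x ω) (z ω) := by
  obtain ⟨C, hC0, hC⟩ := hP.exists_norm_star_sub_le hY
  have h1 : ContinuousOn (fun q : Vec m × Vec p => P.wStar q.1 q.2) (P.X ×ˢ P.Z) :=
    continuousOn_of_norm_sub_le hC0 fun q hq q' hq' =>
      (le_add_of_nonneg_right (norm_nonneg _)).trans (hC q.1 hq.1 q'.1 hq'.1 q.2 hq.2 q'.2 hq'.2)
  have h2 : ContinuousOn (fun q : Vec m × Vec p => P.lamStar q.1 q.2) (P.X ×ˢ P.Z) :=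
    continuousOn_of_norm_sub_le hC0 fun q hq q' hq' =>
      (le_add_of_nonneg_left (norm_nonneg _)).trans (hC q.1 hq.1 q'.1 hq'.1 q.2 hq.2 q'.2 hq'.2)
  have hq : Measurable fun ω => (x ω, z ω) := hx.prodMk hz
  have hqS : ∀ ω, (x ω, z ω) ∈ P.X ×ˢ P.Z := fun ω => ⟨hxX ω, hzZ ω⟩
  have m1 := h1.measurable_comp_of_forall_mem hq hqS
  have m2 := h2.measurable_comp_of_forall_mem hq hqS
  exact ⟨m1, m2⟩

theorem measurable_proj_Y (hY : P.Y.Nonempty) {w : Ω → Vec n} (hw : Measurable w) :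
    Measurable fun ω => proj P.Y (w ω) :=
  (continuous_proj hP.convY hP.compY.isClosed hY).measurable.comp hw

omit hP in
theorem measurable_proj_orthant {l : Ω → Vec p} (hl : Measurable l) :
    Measurable fun ω => proj (orthant p) (l ω) :=
  (continuous_proj (convex_orthant p) (isClosed_orthant p)
    ⟨0, zero_mem_orthant p⟩).measurable.comp hl

end Measurability

section InnerLoop

variable [MeasurableSpace Xi]

theorem measurable_salm {Ω : Type*} {h : ℕ → MeasurableSpace Ω}
    (hg : Measurable (Function.uncurry P.gradg)) {η ρ : ℝ} (hρ : 1 / P.γ₂ ≤ ρ) (hmono : Monotone h)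
    {x : Ω → Vec m} {z : Ω → Vec p} {w0 : Ω → Vec n} {ξ : ℕ → Ω → Xi}
    (hx : Measurable[h 0] x) (hz : Measurable[h 0] z) (hw0 : Measurable[h 0] w0)
    (hxX : ∀ ω, x ω ∈ P.X) (hzZ : ∀ ω, z ω ∈ P.Z) (hw0Y : ∀ ω, w0 ω ∈ P.Y)
    (hξ : ∀ j, Measurable[h (j + 1)] (ξ j)) (j : ℕ) :
    Measurable[h j] (fun ω => (P.salm η ρ (x ω) (z ω) (w0 ω) (fun j => ξ j ω) j).1) ∧
    Measurable[h j] (fun ω => (P.salm η ρ (x ω) (z ω) (w0 ω) (fun j => ξ j ω) j).2) := by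
  induction j with
  | zero => exact ⟨hw0, measurable_const⟩
  | succ j ih =>
    rcases isEmpty_or_nonempty Ω with hΩ | ⟨⟨ω₀⟩⟩
    · exact ⟨@measurable_of_empty _ _ (h (j + 1)) _ _ _, @measurable_of_empty _ _ (h (j + 1)) _ _ _⟩
    have hmem := fun ω => hP.salm_mem η hρ (hxX ω) (hzZ ω) (hw0Y ω) (fun j => ξ j ω) j
    have hY : P.Y.Nonempty := ⟨_, hw0Y ω₀⟩
    have hw := ih.1.mono (hmono (Nat.le_succ j)) le_rfl
    have hl := ih.2.mono (hmono (Nat.le_succ j)) le_rfl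
    have hx' := hx.mono (hmono (Nat.zero_le (j + 1))) le_rfl
    have hz' := hz.mono (hmono (Nat.zero_le (j + 1))) le_rfl
    simp only [salm_succ]
    set w := fun ω => (P.salm η ρ (x ω) (z ω) (w0 ω) (fun j => ξ j ω) j).1
    set l := fun ω => (P.salm η ρ (x ω) (z ω) (w0 ω) (fun j => ξ j ω) j).2
    have hp : Measurable[h (j + 1)] fun ω => pair (x ω) (w ω) := measurable_pair hx' hw
    have ha : Measurable[h (j + 1)] fun ω => P.gradg (pair (x ω) (w ω)) (ξ j ω) :=
      hg.comp (hp.prodMk (hξ j))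
    have hgl := measurable_withLp_snd
      (hP.measurable_gradLag ha hp (fun ω => ⟨hxX ω, (hmem ω).1⟩) hl)
    have hgd := hP.measurable_gradDual hx' hz' hw hl hxX fun ω => (hmem ω).1
    exact ⟨hP.measurable_proj_Y hY (hw.sub (hgl.const_smul (η / ((j : ℝ) + 1)))),
      measurable_proj_orthant (hl.add (hgd.const_smul (ρ / ((j : ℝ) + 1))))⟩

/-- After `s` steps with fresh samples, the expected squared distance of the inner loop to the
saddle point is `O(1 / s)`, uniformly in the outer iterate and the starting point. -/
theorem exists_integral_salm_le (hY : P.Y.Nonempty) {Dξ : Measure Xi} [IsProbabilityMeasure Dξ]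
    {σ : ℝ} (hO : IsOracle Dξ P.gradg (∇ P.G) P.domXY σ) {η ρ : ℝ} (hη : 1 / μ ≤ η)
    (hρ : 1 / P.γ₂ ≤ ρ) :
    ∃ C, 0 ≤ C ∧ ∀ (Ω : Type*) (h : ℕ → MeasurableSpace Ω) (mΩ : MeasurableSpace Ω)
      (Pr : Measure Ω) [IsProbabilityMeasure Pr], Monotone h → (∀ j, h j ≤ mΩ) →
      ∀ (x : Ω → Vec m) (z : Ω → Vec p) (w0 : Ω → Vec n) (ξ : ℕ → Ω → Xi),
      Measurable[h 0] x → Measurable[h 0] z → Measurable[h 0] w0 → (∀ ω, x ω ∈ P.X) →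
      (∀ ω, z ω ∈ P.Z) → (∀ ω, w0 ω ∈ P.Y) → (∀ j, Measurable[h (j + 1)] (ξ j)) →
      (∀ j, Pr.map (ξ j) = Dξ) →
      (∀ j, Indep (h j) (MeasurableSpace.comap (ξ j) inferInstance) Pr) → ∀ s, 1 ≤ s →
      Integrable (fun ω =>
        ‖(P.salm η ρ (x ω) (z ω) (w0 ω) (fun j => ξ j ω) s).1 - P.wStar (x ω) (z ω)‖ ^ 2
        + ‖(P.salm η ρ (x ω) (z ω) (w0 ω) (fun j => ξ j ω) s).2 - P.lamStar (x ω) (z ω)‖ ^ 2) Pr ∧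
      ∫ ω, (‖(P.salm η ρ (x ω) (z ω) (w0 ω) (fun j => ξ j ω) s).1 - P.wStar (x ω) (z ω)‖ ^ 2
        + ‖(P.salm η ρ (x ω) (z ω) (w0 ω) (fun j => ξ j ω) s).2 - P.lamStar (x ω) (z ω)‖ ^ 2) ∂Pr
        ≤ C / s := by
  obtain ⟨R, hR0, hR⟩ := hP.exists_norm_salm_le (Xi := Xi) hρ
  obtain ⟨R', hR'0, hR'⟩ := hP.exists_norm_lamStar_le hY
  obtain ⟨M, hM0, hM⟩ := hP.exists_lyap_step_le hη hρ R
  obtain ⟨b, hb⟩ := isBounded_iff_forall_norm_le.1 hP.compY.isBounded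
  have hb0 : 0 ≤ b := (norm_nonneg _).trans (hb _ hY.some_mem)
  have hμ := hP.μ_pos
  have hγ := hP.γ₂_pos
  have hη0 : 0 < η := lt_of_lt_of_le (by positivity) hη
  have hρ0 : 0 < ρ := lt_of_lt_of_le (by positivity) hρ
  refine ⟨(η + ρ) * (M + 2 * η * σ ^ 2), by positivity, ?_⟩
  intro Ω h mΩ Pr _ hmono hle x z w0 ξ hx hz hw0 hxX hzZ hw0Y hξ hlaw hind s hs
  set w : ℕ → Ω → Vec n := fun j ω => (P.salm η ρ (x ω) (z ω) (w0 ω) (fun j => ξ j ω) j).1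
    with hw_def
  set l : ℕ → Ω → Vec p := fun j ω => (P.salm η ρ (x ω) (z ω) (w0 ω) (fun j => ξ j ω) j).2
    with hl_def
  have hmem : ∀ j ω, w j ω ∈ P.Y ∧ l j ω ∈ orthant p := fun j ω =>
    let q := hP.salm_mem η hρ (hxX ω) (hzZ ω) (hw0Y ω) (fun j => ξ j ω) j
    ⟨q.1, q.2.1⟩
  have hlR : ∀ j ω, ‖l j ω‖ ≤ R := fun j ω =>
    hR η _ (hxX ω) _ (hzZ ω) _ (hw0Y ω) (fun j => ξ j ω) j
  have hmeas := fun j => hP.measurable_salm hO.measurable (η := η) hρ hmono hx hz hw0 hxX hzZ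
    hw0Y hξ j
  have hwm : ∀ j, Measurable[h j] (w j) := fun j => (hmeas j).1
  have hlm : ∀ j, Measurable[h j] (l j) := fun j => (hmeas j).2
  have hxj : ∀ j, Measurable[h j] x := fun j => hx.mono (hmono (Nat.zero_le j)) le_rfl
  have hzj : ∀ j, Measurable[h j] z := fun j => hz.mono (hmono (Nat.zero_le j)) le_rfl
  set ws : Ω → Vec n := fun ω => P.wStar (x ω) (z ω) with hws_def
  set ls : Ω → Vec p := fun ω => P.lamStar (x ω) (z ω) with hls_def
  have hsm : ∀ j, Measurable[h j] ws ∧ Measurable[h j] ls := fun j =>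
    hP.measurable_star hY (hxj j) (hzj j) hxX hzZ
  have hwsY : ∀ ω, ws ω ∈ P.Y := fun ω => hP.wStar_mem hY (hxX ω) _
  have hwb : ∀ j ω, ‖w j ω - ws ω‖ ≤ 2 * b := fun j ω => by
    refine (norm_sub_le _ _).trans ?_
    linarith [hb _ (hmem j ω).1, hb _ (hwsY ω)]
  have hlb : ∀ j ω, ‖l j ω - ls ω‖ ≤ R + R' := fun j ω =>
    (norm_sub_le _ _).trans (add_le_add (hlR j ω) (hR' _ (hxX ω) _ (hzZ ω)))
  -- all the quantities below are bounded and measurable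
  have hint1 : ∀ j, Integrable (fun ω => ‖w j ω - ws ω‖ ^ 2) Pr := fun j => by
    have hd : Measurable[mΩ] fun ω => w j ω - ws ω :=
      ((hwm j).mono (hle j) le_rfl).sub ((hsm j).1.mono (hle j) le_rfl)
    refine Integrable.of_bound (hd.norm.pow_const 2).aestronglyMeasurable ((2 * b) ^ 2)
      (Eventually.of_forall fun ω => ?_)
    rw [Real.norm_eq_abs, abs_of_nonneg (by positivity)]
    exact pow_le_pow_left₀ (norm_nonneg _) (hwb j ω) 2
  have hint2 : ∀ j, Integrable (fun ω => ‖l j ω - ls ω‖ ^ 2) Pr := fun j => by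
    have hd : Measurable[mΩ] fun ω => l j ω - ls ω :=
      ((hlm j).mono (hle j) le_rfl).sub ((hsm j).2.mono (hle j) le_rfl)
    refine Integrable.of_bound (hd.norm.pow_const 2).aestronglyMeasurable ((R + R') ^ 2)
      (Eventually.of_forall fun ω => ?_)
    rw [Real.norm_eq_abs, abs_of_nonneg (by positivity)]
    exact pow_le_pow_left₀ (norm_nonneg _) (hlb j ω) 2
  have hVint : ∀ j, Integrable (fun ω => P.lyap η ρ (x ω) (z ω) (w j ω) (l j ω)) Pr := fun j =>
    ((hint1 j).const_mul _).add ((hint2 j).const_mul _)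
  set a : ℕ → ℝ := fun j => ∫ ω, P.lyap η ρ (x ω) (z ω) (w j ω) (l j ω) ∂Pr with ha_def
  have hrec : ∀ j : ℕ, a (j + 1)
      ≤ (1 - 2 / ((j : ℝ) + 1)) * a j + (M + 2 * η * σ ^ 2) / ((j : ℝ) + 1) ^ 2 := fun j => by
    set V : Ω → XY m n := fun ω => pair (x ω) (w j ω) with hV_def
    have hV : Measurable[h j] V := measurable_pair (hxj j) (hwm j)
    have hVS : ∀ ω, V ω ∈ P.domXY := fun ω => ⟨hxX ω, (hmem j ω).1⟩
    set W : Ω → XY m n := fun ω => pair 0 (w j ω - ws ω) with hW_def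
    have hW : Measurable[h j] W := measurable_pair measurable_const ((hwm j).sub (hsm j).1)
    have hW2 : MemLp W 2 Pr := MemLp.of_bound (hW.mono (hle j) le_rfl).aestronglyMeasurable (2 * b)
      (Eventually.of_forall fun ω => by rw [hW_def, norm_pair_zero_left]; exact hwb j ω)
    have hξj : Measurable (ξ j) := (hξ j).mono (hle _) le_rfl
    have n1 := hO.memLp_noise (hle j) hV hVS hξj (hlaw j) (hind j)
    have n2 := hO.integral_norm_noise_sq_le (hle j) hV hVS hξj (hlaw j) (hind j)
    have n3 := hO.integral_inner_noise_eq_zero (hle j) hV hVS hξj (hlaw j) (hind j) hW hW2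
    have hstep : ∀ ω, P.lyap η ρ (x ω) (z ω) (w (j + 1) ω) (l (j + 1) ω) ≤
        (1 - 2 / ((j : ℝ) + 1)) * P.lyap η ρ (x ω) (z ω) (w j ω) (l j ω)
          - 2 / ((j : ℝ) + 1) * ⟪W ω, P.gradg (V ω) (ξ j ω) - ∇ P.G (V ω)⟫
          + (M + 2 * η * ‖P.gradg (V ω) (ξ j ω) - ∇ P.G (V ω)‖ ^ 2) / ((j : ℝ) + 1) ^ 2 :=
      fun ω => hM _ (hxX ω) _ (hzZ ω) _ (hmem j ω).1 _ (hmem j ω).2 (hlR j ω)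
        (P.gradg (V ω) (ξ j ω)) j
    exact integral_le_of_forall_le (hVint (j + 1)) (hVint j) (integrable_inner_of_memLp hW2 n1)
      (n1.integrable_norm_pow (p := 2) two_ne_zero) hstep n3 n2 (by positivity) (by positivity)
  have hlyap0 : ∀ x z w l, 0 ≤ P.lyap η ρ x z w l := fun x z w l => by
    simp only [lyap]; positivity
  have ha0 : ∀ j, 0 ≤ a j := fun j =>
    integral_nonneg fun ω => hlyap0 (x ω) (z ω) (w j ω) (l j ω)
  have hfin : a s ≤ (M + 2 * η * σ ^ 2) / s :=
    le_div_of_recursion (a := a) ha0 (by positivity) hrec hs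
  refine ⟨(hint1 s).add (hint2 s), ?_⟩
  calc ∫ ω, (‖w s ω - ws ω‖ ^ 2 + ‖l s ω - ls ω‖ ^ 2) ∂Pr
      ≤ ∫ ω, (η + ρ) * P.lyap η ρ (x ω) (z ω) (w s ω) (l s ω) ∂Pr := by
        refine integral_mono ((hint1 s).add (hint2 s)) ((hVint s).const_mul _) fun ω => ?_
        simp only [lyap]
        have e1 : (η + ρ) * (1 / η * ‖w s ω - ws ω‖ ^ 2 + 1 / ρ * ‖l s ω - ls ω‖ ^ 2)
            = ‖w s ω - ws ω‖ ^ 2 + ‖l s ω - ls ω‖ ^ 2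
              + (ρ / η * ‖w s ω - ws ω‖ ^ 2 + η / ρ * ‖l s ω - ls ω‖ ^ 2) := by
          field_simp; ring
        rw [e1]
        exact le_add_of_nonneg_right (by positivity)
    _ = (η + ρ) * a s := integral_const_mul _ _
    _ ≤ (η + ρ) * ((M + 2 * η * σ ^ 2) / s) := by gcongr
    _ = _ := by ring

end InnerLoop

end Standing

end Problem

/-! ### The history of the samples -/

section History

variable {Ω Zt Xi : Type*} [MeasurableSpace Zt] [MeasurableSpace Xi]

/-- The σ-algebra generated by the samples with labels in `S`. -/
@[reducible] def hist (ζ : ℕ → ℕ → Ω → Zt) (ξ ξt : ℕ → ℕ → Ω → Xi) (S : Set Label) :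
    MeasurableSpace Ω :=
  ⨆ i ∈ S, sampleSigma ζ ξ ξt i

variable {ζ : ℕ → ℕ → Ω → Zt} {ξ ξt : ℕ → ℕ → Ω → Xi}

theorem hist_mono {S T : Set Label} (h : S ⊆ T) : hist ζ ξ ξt S ≤ hist ζ ξ ξt T :=
  biSup_mono h

theorem sampleSigma_le_hist {S : Set Label} {i : Label} (hi : i ∈ S) :
    sampleSigma ζ ξ ξt i ≤ hist ζ ξ ξt S :=
  le_iSup₂ (f := fun i _ => sampleSigma ζ ξ ξt i) i hi

theorem past_mono {k k' : ℕ} (h : k ≤ k') : past ζ ξ ξt k ≤ past ζ ξ ξt k' :=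
  hist_mono fun i (hi : i.iteration < k) => lt_of_lt_of_le hi h

theorem measurable_zeta {S : Set Label} {k j : ℕ} (h : Label.zeta k j ∈ S) :
    Measurable[hist ζ ξ ξt S] (ζ k j) :=
  measurable_iff_comap_le.2 (sampleSigma_le_hist (ζ := ζ) (ξ := ξ) (ξt := ξt) h)

theorem measurable_xi {S : Set Label} {k j : ℕ} (h : Label.xi k j ∈ S) :
    Measurable[hist ζ ξ ξt S] (ξ k j) :=
  measurable_iff_comap_le.2 (sampleSigma_le_hist (ζ := ζ) (ξ := ξ) (ξt := ξt) h)

theorem measurable_xit {S : Set Label} {k j : ℕ} (h : Label.xit k j ∈ S) :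
    Measurable[hist ζ ξ ξt S] (ξt k j) :=
  measurable_iff_comap_le.2 (sampleSigma_le_hist (ζ := ζ) (ξ := ξ) (ξt := ξt) h)

variable {mΩ : MeasurableSpace Ω} {Pr : Measure Ω} {Dζ : Measure Zt} {Dξ : Measure Xi}
  (H : IIDSamples Pr Dζ Dξ ζ ξ ξt)
include H

theorem IIDSamples.sampleSigma_le (i : Label) : sampleSigma ζ ξ ξt i ≤ mΩ := by
  cases i with
  | zeta k j => exact (H.1 k j).1.comap_le
  | xi k j => exact (H.2.1 k j).1.comap_le
  | xit k j => exact (H.2.2.1 k j).1.comap_le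

theorem IIDSamples.hist_le (S : Set Label) : hist ζ ξ ξt S ≤ mΩ :=
  iSup₂_le fun i _ => H.sampleSigma_le i

theorem IIDSamples.indep_hist {S : Set Label} {i : Label} (hi : i ∉ S) :
    Indep (hist ζ ξ ξt S) (sampleSigma ζ ξ ξt i) Pr := by
  have := indep_iSup_of_disjoint H.sampleSigma_le H.2.2.2 (disjoint_singleton_right.2 hi)
  rwa [iSup_singleton] at this

end History

/-! ### The error of the stochastic direction -/

namespace Problem

variable {m n p : ℕ} {Zt Xi : Type*} {P : Problem m n p Zt Xi}

namespace Standing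

variable {LG LH : ℝ≥0} {μ MG M0 M1 : ℝ} (hP : P.Standing LG LH μ MG M0 M1)
include hP

/-- The error of the stochastic direction consists of the errors of the mini-batches and the
inaccuracy of the inner loop; the penalty part is exact and cancels. -/
theorem exists_norm_psiGradient_sub_direction_le {R : ℝ} (hR : 0 ≤ R) :
    ∃ C, 0 ≤ C ∧ ∀ u ∈ P.U, ∀ w ∈ P.Y, ∀ l : Vec p, ‖l‖ ≤ R → ∀ (c₁ c₂ : ℝ) (r q : ℕ)
      (ζ : ℕ → Zt) (ξt : ℕ → Xi),
      ‖P.psiGradient c₁ c₂ u - P.direction c₁ c₂ r q u w l ζ ξt‖ ^ 2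
        ≤ 2 * ‖batch r (P.gradf u.fst) ζ - ∇ P.F u.fst‖ ^ 2
          + c₁ ^ 2 * (6 * ‖batch q (P.gradg u.fst) ξt - ∇ P.G u.fst‖ ^ 2
            + 6 * ‖batch q (P.gradg (pair u.fst.fst w)) ξt - ∇ P.G (pair u.fst.fst w)‖ ^ 2
            + C * (‖w - P.wStar u.fst.fst u.snd‖ ^ 2 + ‖l - P.lamStar u.fst.fst u.snd‖ ^ 2)) := by
  obtain ⟨C₁, hC₁, h1⟩ := hP.exists_norm_gradLag_sub_le R hR
  have hγ := hP.γ₂_pos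
  refine ⟨12 * (C₁ + P.γ₂) ^ 2, by positivity, ?_⟩
  intro u hu w hw l hl c₁ c₂ r q ζ ξt
  have hY : P.Y.Nonempty := ⟨w, hw⟩
  have hws := hP.wStar_mem hY hu.1.1 u.snd
  set x := u.fst.fst
  set ws := P.wStar x u.snd
  set ls := P.lamStar x u.snd
  set bf := batch r (P.gradf u.fst) ζ
  set bg := batch q (P.gradg u.fst) ξt
  set bw := batch q (P.gradg (pair x w)) ξt
  have e : P.psiGradient c₁ c₂ u - P.direction c₁ c₂ r q u w l ζ ξt
      = triple (∇ P.F u.fst - bf) 0 + c₁ • (P.gapGradient u - P.gradGap bg bw u w l) := by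
    have e1 : (triple (∇ P.F u.fst) 0 : XYZ m n p) - triple bf 0 = triple (∇ P.F u.fst - bf) 0 := by
      rw [pair_zero_sub]
    rw [psiGradient, direction, ← e1]
    module
  have n1 : ‖(triple (∇ P.F u.fst - bf) 0 : XYZ m n p)‖ ≤ ‖bf - ∇ P.F u.fst‖ := by
    refine (norm_le_norm_fst_add_norm_snd _).trans ?_
    rw [norm_sub_rev]
    simp
  have n2 : ‖P.gapGradient u - P.gradGap bg bw u w l‖ ≤ ‖bg - ∇ P.G u.fst‖
      + ‖bw - ∇ P.G (pair x w)‖ + (C₁ + P.γ₂) * (‖w - ws‖ + ‖l - ls‖) := by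
    refine (norm_gradGap_sub_le hγ _ _ _ _ _ _ _ _ _ _).trans ?_
    rw [sub_self, norm_zero, add_zero, norm_sub_rev bg, norm_sub_rev w, norm_sub_rev l]
    have h2 := h1 (pair x ws) ⟨hu.1.1, hws⟩ (pair x w) ⟨hu.1.1, hw⟩ ls l hl
    rw [norm_pair_sub_left] at h2
    have h3 : ‖P.gradLag (∇ P.G (pair x ws)) (pair x ws) ls - P.gradLag bw (pair x w) l‖
        ≤ C₁ * (‖ws - w‖ + ‖ls - l‖) + ‖bw - ∇ P.G (pair x w)‖ := by
      refine (norm_sub_le_norm_sub_add_norm_sub _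
        (P.gradLag (∇ P.G (pair x w)) (pair x w) l) _).trans (add_le_add h2 ?_)
      rw [gradLag_sub_gradLag, norm_sub_rev]
    have h4 : P.γ₂ * ‖ls - l‖ ≤ P.γ₂ * (‖ws - w‖ + ‖ls - l‖) := by
      gcongr; exact le_add_of_nonneg_left (norm_nonneg _)
    have h5 : ‖P.gradLag (∇ P.G (pair x ws)) (pair u.fst.fst ws) ls
      - P.gradLag bw (pair u.fst.fst w) l‖
        ≤ C₁ * (‖ws - w‖ + ‖ls - l‖) + ‖bw - ∇ P.G (pair x w)‖ := h3
    linarith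
  rw [e]
  set A := ‖bf - ∇ P.F u.fst‖
  set B := ‖bg - ∇ P.G u.fst‖
  set D := ‖bw - ∇ P.G (pair x w)‖
  set a := ‖w - ws‖
  set b := ‖l - ls‖
  set c := C₁ + P.γ₂
  set N := ‖P.gapGradient u - P.gradGap bg bw u w l‖
  have hsum : ‖(triple (∇ P.F u.fst - bf) 0 : XYZ m n p)
      + c₁ • (P.gapGradient u - P.gradGap bg bw u w l)‖ ≤ A + |c₁| * N := by
    refine (norm_add_le _ _).trans (add_le_add n1 ?_)
    rw [norm_smul, Real.norm_eq_abs]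
  have hN2 : N ^ 2 ≤ 3 * B ^ 2 + 3 * D ^ 2 + 6 * c ^ 2 * (a ^ 2 + b ^ 2) := by
    have i1 : N ^ 2 ≤ (B + D + c * (a + b)) ^ 2 := pow_le_pow_left₀ (norm_nonneg _) n2 2
    have i2 : (c * (a + b)) ^ 2 ≤ 2 * c ^ 2 * (a ^ 2 + b ^ 2) := by
      nlinarith [mul_nonneg (sq_nonneg c) (sq_nonneg (a - b))]
    nlinarith [sq_nonneg (B - D), sq_nonneg (B - c * (a + b)), sq_nonneg (D - c * (a + b))]
  calc _ ≤ (A + |c₁| * N) ^ 2 := pow_le_pow_left₀ (norm_nonneg _) hsum 2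
    _ ≤ 2 * A ^ 2 + c₁ ^ 2 * (2 * N ^ 2) := by
      nlinarith [sq_nonneg (A - |c₁| * N), sq_abs c₁]
    _ ≤ 2 * A ^ 2 + c₁ ^ 2 * (6 * B ^ 2 + 6 * D ^ 2 + 12 * c ^ 2 * (a ^ 2 + b ^ 2)) := by
      gcongr; linarith

variable [MeasurableSpace Zt] [MeasurableSpace Xi]

/-- The mean squared error of the stochastic direction at an iterate determined by the past,
through an integrable majorant of the squared error. -/
theorem exists_integral_error_le (hY : P.Y.Nonempty) {Dζ : Measure Zt} {Dξ : Measure Xi}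
    [IsProbabilityMeasure Dζ] [IsProbabilityMeasure Dξ] {σf σg : ℝ}
    (hOf : IsOracle Dζ P.gradf (∇ P.F) P.domXY σf) (hOg : IsOracle Dξ P.gradg (∇ P.G) P.domXY σg)
    {η ρ : ℝ} (hη : 1 / μ ≤ η) (hρ : 1 / P.γ₂ ≤ ρ) :
    ∃ C, 0 ≤ C ∧ ∀ (Ω : Type*) (_mΩ : MeasurableSpace Ω) (Pr : Measure Ω) [IsProbabilityMeasure Pr]
      (ζ : ℕ → ℕ → Ω → Zt) (ξ ξt : ℕ → ℕ → Ω → Xi), IIDSamples Pr Dζ Dξ ζ ξ ξt →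
      ∀ (k : ℕ) (u : Ω → XYZ m n p) (w0 : Ω → Vec n), Measurable[past ζ ξ ξt k] u →
      Measurable[past ζ ξ ξt k] w0 → (∀ ω, u ω ∈ P.U) → (∀ ω, w0 ω ∈ P.Y) →
      ∀ (c₁ c₂ : ℝ) (r q s : ℕ), 1 ≤ r → 1 ≤ q → 1 ≤ s →
      ∃ N : Ω → ℝ, Integrable N Pr ∧ ∫ ω, N ω ∂Pr ≤ C * (1 / r + c₁ ^ 2 / q + c₁ ^ 2 / s) ∧
        ∀ ω, ‖P.psiGradient c₁ c₂ (u ω) - P.direction c₁ c₂ r q (u ω)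
          (P.salm η ρ (u ω).fst.fst (u ω).snd (w0 ω) (fun j => ξ k j ω) s).1
          (P.salm η ρ (u ω).fst.fst (u ω).snd (w0 ω) (fun j => ξ k j ω) s).2
          (fun j => ζ k j ω) (fun j => ξt k j ω)‖ ^ 2 ≤ N ω := by
  obtain ⟨R, hR0, hR⟩ := hP.exists_norm_salm_le (Xi := Xi) hρ
  obtain ⟨C₁, hC₁, h1⟩ := hP.exists_norm_psiGradient_sub_direction_le hR0
  obtain ⟨C₂, hC₂, h2⟩ := hP.exists_integral_salm_le hY hOg hη hρ
  refine ⟨2 * σf ^ 2 + 12 * σg ^ 2 + C₁ * C₂, by positivity, ?_⟩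
  intro Ω mΩ Pr _ ζ ξ ξt H k u w0 hu hw0 huU hw0Y c₁ c₂ r q s hr hq hs
  -- the histories along which each family of samples is fresh; the inner loop uses only `ξ`, so
  -- that its output belongs to the history of the `ξt`
  set hin : ℕ → MeasurableSpace Ω := fun j =>
    hist ζ ξ ξt {i | i.iteration < k ∨ ∃ a < j, i = Label.xi k a} with hin_def
  set hze : ℕ → MeasurableSpace Ω := fun j =>
    hist ζ ξ ξt {i | i.iteration < k ∨ ∃ a < j, i = Label.zeta k a} with hze_def
  set hxt : ℕ → MeasurableSpace Ω := fun j =>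
    hist ζ ξ ξt {i | (i.iteration < k ∨ ∃ a, i = Label.xi k a) ∨ ∃ a < j, i = Label.xit k a}
    with hxt_def
  have hin_mono : Monotone hin := fun j j' hj => hist_mono fun i hi =>
    hi.imp_right fun ⟨a, ha, e⟩ => ⟨a, lt_of_lt_of_le ha hj, e⟩
  have hze_mono : Monotone hze := fun j j' hj => hist_mono fun i hi =>
    hi.imp_right fun ⟨a, ha, e⟩ => ⟨a, lt_of_lt_of_le ha hj, e⟩
  have hxt_mono : Monotone hxt := fun j j' hj => hist_mono fun i hi =>
    hi.imp_right fun ⟨a, ha, e⟩ => ⟨a, lt_of_lt_of_le ha hj, e⟩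
  have past_in : past ζ ξ ξt k ≤ hin 0 := hist_mono fun i hi => Or.inl hi
  have past_ze : past ζ ξ ξt k ≤ hze 0 := hist_mono fun i hi => Or.inl hi
  have past_xt : past ζ ξ ξt k ≤ hxt 0 := hist_mono fun i hi => Or.inl (Or.inl hi)
  have in_xt : ∀ j, hin j ≤ hxt 0 := fun j => hist_mono fun i hi => Or.inl
    (hi.imp_right fun ⟨a, _, e⟩ => ⟨a, e⟩)
  have ind_in : ∀ j, Indep (hin j) (MeasurableSpace.comap (ξ k j) inferInstance) Pr := fun j =>
    H.indep_hist (i := Label.xi k j) (by simp [Label.iteration])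
  have ind_ze : ∀ j, Indep (hze j) (MeasurableSpace.comap (ζ k j) inferInstance) Pr := fun j =>
    H.indep_hist (i := Label.zeta k j) (by simp [Label.iteration])
  have ind_xt : ∀ j, Indep (hxt j) (MeasurableSpace.comap (ξt k j) inferInstance) Pr := fun j =>
    H.indep_hist (i := Label.xit k j) (by simp [Label.iteration])
  have hx : Measurable[past ζ ξ ξt k] fun ω => (u ω).fst.fst :=
    measurable_withLp_fst (measurable_withLp_fst hu)
  have hv : Measurable[past ζ ξ ξt k] fun ω => (u ω).fst := measurable_withLp_fst hu
  have hz : Measurable[past ζ ξ ξt k] fun ω => (u ω).snd := measurable_withLp_snd hu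
  have hξ : ∀ j, Measurable[hin (j + 1)] (ξ k j) := fun j =>
    measurable_xi (Or.inr ⟨j, Nat.lt_succ_self j, rfl⟩)
  have hxX : ∀ ω, (u ω).fst.fst ∈ P.X := fun ω => (huU ω).1.1
  have hzZ : ∀ ω, (u ω).snd ∈ P.Z := fun ω => (huU ω).2
  have hsalm := hP.measurable_salm hOg.measurable (η := η) hρ hin_mono (hx.mono past_in le_rfl)
    (hz.mono past_in le_rfl) (hw0.mono past_in le_rfl) hxX hzZ hw0Y hξ s
  obtain ⟨i4, b4⟩ := h2 Ω hin mΩ Pr hin_mono (fun j => H.hist_le _) _ _ w0 (fun j => ξ k j)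
    (hx.mono past_in le_rfl) (hz.mono past_in le_rfl) (hw0.mono past_in le_rfl) hxX hzZ hw0Y hξ
    (fun j => (H.2.1 k j).2) ind_in s hs
  have hmem := fun ω => (hP.salm_mem η hρ (hxX ω) (hzZ ω) (hw0Y ω) (fun j => ξ k j ω) s).1
  have hbd := fun ω => hR η _ (hxX ω) _ (hzZ ω) _ (hw0Y ω) (fun j => ξ k j ω) s
  obtain ⟨i1, b1⟩ := hOf.batch_noise hze_mono (fun j => H.hist_le _) (hv.mono past_ze le_rfl)
    (fun ω => (huU ω).1) (fun j => measurable_zeta (Or.inr ⟨j, Nat.lt_succ_self j, rfl⟩))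
    (fun j => (H.1 k j).2) ind_ze hr
  have hξt : ∀ j, Measurable[hxt (j + 1)] (ξt k j) := fun j =>
    measurable_xit (Or.inr ⟨j, Nat.lt_succ_self j, rfl⟩)
  obtain ⟨i2, b2⟩ := hOg.batch_noise hxt_mono (fun j => H.hist_le _) (hv.mono past_xt le_rfl)
    (fun ω => (huU ω).1) hξt (fun j => (H.2.2.1 k j).2) ind_xt hq
  obtain ⟨i3, b3⟩ := hOg.batch_noise hxt_mono (fun j => H.hist_le _)
    (measurable_pair (hx.mono past_xt le_rfl) (hsalm.1.mono (in_xt s) le_rfl))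
    (fun ω => ⟨hxX ω, hmem ω⟩) hξt (fun j => (H.2.2.1 k j).2) ind_xt hq
  have hpt := fun ω => h1 (u ω) (huU ω) _ (hmem ω) _ (hbd ω) c₁ c₂ r q (fun j => ζ k j ω)
    (fun j => ξt k j ω)
  have hr0 : (0 : ℝ) < r := by exact_mod_cast hr
  have hq0 : (0 : ℝ) < q := by exact_mod_cast hq
  have hs0 : (0 : ℝ) < s := by exact_mod_cast hs
  have j23 := (i2.const_mul 6).add (i3.const_mul 6)
  have j234 := j23.add (i4.const_mul C₁)
  refine ⟨_, (i1.const_mul 2).add (j234.const_mul (c₁ ^ 2)), ?_, hpt⟩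
  rw [integral_add' (i1.const_mul 2) (j234.const_mul (c₁ ^ 2)), integral_const_mul,
    integral_const_mul, integral_add' j23 (i4.const_mul C₁),
    integral_add' (i2.const_mul 6) (i3.const_mul 6), integral_const_mul, integral_const_mul,
    integral_const_mul]
  calc _ ≤ 2 * (σf ^ 2 / r) + c₁ ^ 2 * (6 * (σg ^ 2 / q) + 6 * (σg ^ 2 / q) + C₁ * (C₂ / s)) := by
        gcongr
    _ = 2 * σf ^ 2 * (1 / r) + 12 * σg ^ 2 * (c₁ ^ 2 / q) + C₁ * C₂ * (c₁ ^ 2 / s) := by ring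
    _ ≤ (2 * σf ^ 2 + 12 * σg ^ 2 + C₁ * C₂) * (1 / r)
        + (2 * σf ^ 2 + 12 * σg ^ 2 + C₁ * C₂) * (c₁ ^ 2 / q)
        + (2 * σf ^ 2 + 12 * σg ^ 2 + C₁ * C₂) * (c₁ ^ 2 / s) := by
      have k1 : 0 ≤ C₁ * C₂ := by positivity
      have k2 := sq_nonneg σf
      have k3 := sq_nonneg σg
      gcongr <;> linarith
    _ = _ := by ring

end Standing

end Problem

/-! ### The outer loop -/

theorem measurable_add_smul_add_smul {Ω E : Type*} {mΩ : MeasurableSpace Ω}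
    [NormedAddCommGroup E] [NormedSpace ℝ E] [MeasurableSpace E] [BorelSpace E]
    [SecondCountableTopology E] {a b e : Ω → E} (ha : Measurable a) (hb : Measurable b)
    (he : Measurable e) (c d : ℝ) : Measurable fun ω => a ω + c • b ω + d • e ω :=
  (ha.add (hb.const_smul c)).add (he.const_smul d)

theorem measurable_proj_sub_smul {Ω E : Type*} {mΩ : MeasurableSpace Ω}
    [NormedAddCommGroup E] [InnerProductSpace ℝ E] [FiniteDimensional ℝ E] [MeasurableSpace E]
    [BorelSpace E] {C : Set E} (hC : Convex ℝ C) (hCc : IsClosed C) (hne : C.Nonempty)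
    {u d : Ω → E} (hu : Measurable u) (hd : Measurable d) (α : ℝ) :
    Measurable fun ω => proj C (u ω - α • d ω) := by
  have h : Measurable fun ω => u ω - α • d ω := hu.sub (hd.const_smul α)
  exact (continuous_proj hC hCc hne).measurable.comp h

namespace Problem

variable {m n p : ℕ} {Zt Xi : Type*} {P : Problem m n p Zt Xi}

theorem measurable_batch {Ω Ξ : Type*} {mΩ : MeasurableSpace Ω} [MeasurableSpace Ξ]
    {g : XY m n → Ξ → XY m n} (hg : Measurable (Function.uncurry g)) {V : Ω → XY m n}
    (hV : Measurable V) (b : ℕ) {T : ℕ → Ω → Ξ} (hT : ∀ j, Measurable (T j)) :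
    Measurable fun ω => batch b (g (V ω)) (fun j => T j ω) := by
  have hs : Measurable fun ω => ∑ j ∈ Finset.range b, g (V ω) (T j ω) :=
    Finset.measurable_fun_sum _ fun j _ => hg.comp (hV.prodMk (hT j))
  exact hs.const_smul (1 / (b : ℝ))

theorem iterates_succ (η ρ c₁ c₂ α : ℝ) (r q s : ℕ) (u0 : XYZ m n p) (w0 : ℕ → Vec n)
    (ζ : ℕ → ℕ → Zt) (ξ ξt : ℕ → ℕ → Xi) (k : ℕ) :
    P.iterates η ρ c₁ c₂ α r q s u0 w0 ζ ξ ξt (k + 1) =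
      proj P.U (P.iterates η ρ c₁ c₂ α r q s u0 w0 ζ ξ ξt k
        - α • P.direction c₁ c₂ r q (P.iterates η ρ c₁ c₂ α r q s u0 w0 ζ ξ ξt k)
          (P.salm η ρ (P.iterates η ρ c₁ c₂ α r q s u0 w0 ζ ξ ξt k).fst.fst
            (P.iterates η ρ c₁ c₂ α r q s u0 w0 ζ ξ ξt k).snd (w0 k) (ξ k) s).1
          (P.salm η ρ (P.iterates η ρ c₁ c₂ α r q s u0 w0 ζ ξ ξt k).fst.fst
            (P.iterates η ρ c₁ c₂ α r q s u0 w0 ζ ξ ξt k).snd (w0 k) (ξ k) s).2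
          (ζ k) (ξt k)) := rfl

namespace Standing

variable {LG LH : ℝ≥0} {μ MG M0 M1 : ℝ} (hP : P.Standing LG LH μ MG M0 M1)
include hP

theorem iterates_mem (η ρ c₁ c₂ α : ℝ) (r q s : ℕ) {u0 : XYZ m n p} (hu0 : u0 ∈ P.U)
    (w0 : ℕ → Vec n) (ζ : ℕ → ℕ → Zt) (ξ ξt : ℕ → ℕ → Xi) (k : ℕ) :
    P.iterates η ρ c₁ c₂ α r q s u0 w0 ζ ξ ξt k ∈ P.U := by
  cases k with
  | zero => exact hu0
  | succ k => exact proj_mem hP.convex_U hP.isCompact_U.isClosed ⟨u0, hu0⟩ _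

theorem measurable_gradGap {Ω : Type*} {mΩ : MeasurableSpace Ω} {a b : Ω → XY m n}
    {u : Ω → XYZ m n p} {w : Ω → Vec n} {l : Ω → Vec p} (ha : Measurable a) (hb : Measurable b)
    (hu : Measurable u) (hw : Measurable w) (hl : Measurable l) (huU : ∀ ω, u ω ∈ P.U)
    (hwY : ∀ ω, w ω ∈ P.Y) : Measurable fun ω => P.gradGap (a ω) (b ω) (u ω) (w ω) (l ω) := by
  have hx : Measurable fun ω => (u ω).fst.fst := measurable_withLp_fst (measurable_withLp_fst hu)
  have hg := measurable_withLp_fst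
    (hP.measurable_gradLag hb (measurable_pair hx hw) (fun ω => ⟨(huU ω).1.1, hwY ω⟩) hl)
  have hd : Measurable fun ω => P.γ₂ • (l ω - (u ω).snd) :=
    (hl.sub (measurable_withLp_snd hu)).const_smul P.γ₂
  exact measurable_triple (ha.sub (measurable_pair hg measurable_const)) hd.neg

variable [MeasurableSpace Zt] [MeasurableSpace Xi]

theorem measurable_direction {Ω : Type*} {mΩ : MeasurableSpace Ω}
    (hf : Measurable (Function.uncurry P.gradf))
    (hg : Measurable (Function.uncurry P.gradg)) (c₁ c₂ : ℝ) (r q : ℕ)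
    {u : Ω → XYZ m n p} {w : Ω → Vec n} {l : Ω → Vec p} (hu : Measurable u) (hw : Measurable w)
    (hl : Measurable l) (huU : ∀ ω, u ω ∈ P.U) (hwY : ∀ ω, w ω ∈ P.Y)
    {ζ : ℕ → Ω → Zt} {ξt : ℕ → Ω → Xi} (hζ : ∀ j, Measurable (ζ j))
    (hξt : ∀ j, Measurable (ξt j)) :
    Measurable fun ω => P.direction c₁ c₂ r q (u ω) (w ω) (l ω) (fun j => ζ j ω)
      (fun j => ξt j ω) := by
  have hv : Measurable fun ω => (u ω).fst := measurable_withLp_fst hu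
  have hx : Measurable fun ω => (u ω).fst.fst := measurable_withLp_fst hv
  have hxw : Measurable fun ω => pair (u ω).fst.fst (w ω) := measurable_pair hx hw
  have hbf : Measurable fun ω => (triple (batch r (P.gradf (u ω).fst) fun j => ζ j ω) 0 :
      XYZ m n p) := measurable_triple (measurable_batch hf hv r hζ) measurable_const
  have hb1 := measurable_batch hg hv q hξt
  have hb2 := measurable_batch hg hxw q hξt
  have hgap := hP.measurable_gradGap hb1 hb2 hu hw hl huU hwY
  have hpg := hP.measurable_penaltyGradient hv fun ω => (huU ω).1
  have hpen : Measurable fun ω => (triple (P.penaltyGradient (u ω).fst) 0 : XYZ m n p) :=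
    measurable_triple hpg measurable_const
  exact measurable_add_smul_add_smul hbf hgap hpen c₁ c₂

theorem measurable_iterates {Ω : Type*} (hf : Measurable (Function.uncurry P.gradf))
    (hg : Measurable (Function.uncurry P.gradg)) (η : ℝ) {ρ : ℝ} (hρ : 1 / P.γ₂ ≤ ρ)
    (c₁ c₂ α : ℝ) (r q s : ℕ) {u0 : XYZ m n p} (hu0 : u0 ∈ P.U) {ζ : ℕ → ℕ → Ω → Zt}
    {ξ ξt : ℕ → ℕ → Ω → Xi} {w0 : ℕ → Ω → Vec n} (hw0 : ∀ k, Measurable[past ζ ξ ξt k] (w0 k))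
    (hw0Y : ∀ k ω, w0 k ω ∈ P.Y) (k : ℕ) :
    Measurable[past ζ ξ ξt k] fun ω => P.iterates η ρ c₁ c₂ α r q s u0 (fun k => w0 k ω)
      (fun k j => ζ k j ω) (fun k j => ξ k j ω) (fun k j => ξt k j ω) k := by
  induction k with
  | zero => exact measurable_const
  | succ k ih =>
    have huU := fun ω => hP.iterates_mem η ρ c₁ c₂ α r q s hu0 (fun k => w0 k ω)
      (fun k j => ζ k j ω) (fun k j => ξ k j ω) (fun k j => ξt k j ω) k
    simp only [iterates_succ]
    set u := fun ω => P.iterates η ρ c₁ c₂ α r q s u0 (fun k => w0 k ω)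
      (fun k j => ζ k j ω) (fun k j => ξ k j ω) (fun k j => ξt k j ω) k
    have hle : past ζ ξ ξt k ≤ past ζ ξ ξt (k + 1) := past_mono (Nat.le_succ k)
    have hu : Measurable[past ζ ξ ξt (k + 1)] u := ih.mono hle le_rfl
    have hv : Measurable[past ζ ξ ξt (k + 1)] fun ω => (u ω).fst := measurable_withLp_fst hu
    have hx : Measurable[past ζ ξ ξt (k + 1)] fun ω => (u ω).fst.fst := measurable_withLp_fst hv
    have hz : Measurable[past ζ ξ ξt (k + 1)] fun ω => (u ω).snd := measurable_withLp_snd hu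
    have hζ : ∀ j, Measurable[past ζ ξ ξt (k + 1)] (ζ k j) := fun j =>
      measurable_zeta (Nat.lt_succ_self k)
    have hξ : ∀ j, Measurable[past ζ ξ ξt (k + 1)] (ξ k j) := fun j =>
      measurable_xi (Nat.lt_succ_self k)
    have hξt : ∀ j, Measurable[past ζ ξ ξt (k + 1)] (ξt k j) := fun j =>
      measurable_xit (Nat.lt_succ_self k)
    have hsalm := hP.measurable_salm hg (η := η) hρ (h := fun _ => past ζ ξ ξt (k + 1))
      (fun _ _ _ => le_rfl) hx hz
      ((hw0 k).mono hle le_rfl) (fun ω => (huU ω).1.1) (fun ω => (huU ω).2) (hw0Y k) hξ s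
    have hmem := fun ω => (hP.salm_mem η hρ (huU ω).1.1 (huU ω).2 (hw0Y k ω)
      (fun j => ξ k j ω) s).1
    have hdir := hP.measurable_direction hf hg c₁ c₂ r q hu hsalm.1 hsalm.2 huU hmem hζ hξt
    exact measurable_proj_sub_smul hP.convex_U hP.isCompact_U.isClosed ⟨u0, hu0⟩ hu hdir α

omit [MeasurableSpace Zt] [MeasurableSpace Xi] in
theorem continuousOn_Psi_parts (hF : ∀ v ∈ P.domXY, DifferentiableAt ℝ P.F v) :
    ContinuousOn (fun u : XYZ m n p => P.F u.fst) P.U ∧ ContinuousOn P.gap P.U ∧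
      ContinuousOn (fun u : XYZ m n p => P.penalty u.fst) P.U := by
  have hfst : ContinuousOn (fun u : XYZ m n p => u.fst) P.U :=
    (WithLp.continuous_fst (p := 2) (α := XY m n) (β := Vec p)).continuousOn
  have hmaps : MapsTo (fun u : XYZ m n p => u.fst) P.U P.domXY := fun u hu => hu.1
  have h1 : ContinuousOn P.F P.domXY := fun v hv =>
    (hF v hv).hasGradientAt.continuousAt.continuousWithinAt
  have h2 : ContinuousOn P.penalty P.domXY := fun v hv =>
    (hP.hasGradientAt_penalty hv).continuousAt.continuousWithinAt
  have h3 : ContinuousOn P.gap P.U := fun u hu =>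
    (hP.hasGradientWithinAt_gap hu).continuousWithinAt_of_inner
  have h1' := ContinuousOn.comp (g := P.F) h1 hfst hmaps
  have h2' := ContinuousOn.comp (g := P.penalty) h2 hfst hmaps
  exact ⟨h1', h3, h2'⟩

end Standing

end Problem

/-! ### The convergence rate -/

/-- Summing an expected descent inequality along a trajectory. -/
theorem sum_integral_le_of_descent {Ω : Type*} {mΩ : MeasurableSpace Ω} {μ : Measure Ω}
    {V D N : ℕ → Ω → ℝ} {a b e : ℝ} (hb : 0 ≤ b) (hV : ∀ k, Integrable (V k) μ)
    (hD : ∀ k, Integrable (D k) μ) (hN : ∀ k, Integrable (N k) μ) (hNe : ∀ k, ∫ ω, N k ω ∂μ ≤ e)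
    (h : ∀ k ω, a * D k ω ≤ V k ω - V (k + 1) ω + b * N k ω) (K : ℕ) :
    a * ∑ k ∈ Finset.range K, ∫ ω, D k ω ∂μ ≤ ∫ ω, V 0 ω ∂μ - ∫ ω, V K ω ∂μ + b * (K * e) := by
  have hstep : ∀ k, a * ∫ ω, D k ω ∂μ ≤ ∫ ω, V k ω ∂μ - ∫ ω, V (k + 1) ω ∂μ + b * e := by
    intro k
    have i1 : Integrable (fun ω => V k ω - V (k + 1) ω) μ := (hV k).sub (hV (k + 1))
    have i2 : Integrable (fun ω => b * N k ω) μ := (hN k).const_mul b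
    have h1 := integral_mono ((hD k).const_mul a) (i1.add i2) (h k)
    rw [integral_add' i1 i2, integral_sub (hV k) (hV (k + 1)), integral_const_mul,
      integral_const_mul] at h1
    exact h1.trans (by gcongr; exact hNe k)
  induction K with
  | zero => simp
  | succ K ih =>
    rw [Finset.sum_range_succ, mul_add]
    push_cast
    linarith [hstep K]

namespace Problem

variable {m n p : ℕ} {Zt Xi : Type*} {P : Problem m n p Zt Xi}

namespace Standing

variable {LG LH : ℝ≥0} {μ MG M0 M1 : ℝ} (hP : P.Standing LG LH μ MG M0 M1)
include hP

/-- Under the step-size restriction `α (LF + c₁ Lgap + c₂ Lpen) ≤ 1 / 2`, the oscillation of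
`α Ψ` over `𝒰` is bounded independently of the penalty parameters. -/
theorem exists_mul_Psi_sub_le (hF : ∀ v ∈ P.domXY, DifferentiableAt ℝ P.F v) {LF Lgap Lpen : ℝ}
    (hLF : 0 < LF) (hLgap : 0 < Lgap) (hLpen : 0 < Lpen) :
    ∃ B₀, 0 ≤ B₀ ∧ ∀ c₁ c₂ α : ℝ, 0 < c₁ → 0 < c₂ → 0 < α →
      α * (LF + c₁ * Lgap + c₂ * Lpen) ≤ 1 / 2 → ∀ u ∈ P.U, ∀ v ∈ P.U,
        α * (P.Psi c₁ c₂ u - P.Psi c₁ c₂ v) ≤ B₀ := by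
  obtain ⟨f1, f2, f3⟩ := hP.continuousOn_Psi_parts hF
  obtain ⟨b1, h1⟩ := hP.isCompact_U.exists_bound_of_continuousOn f1
  obtain ⟨b2, h2⟩ := hP.isCompact_U.exists_bound_of_continuousOn f2
  obtain ⟨b3, h3⟩ := hP.isCompact_U.exists_bound_of_continuousOn f3
  refine ⟨|b1| / LF + |b2| / Lgap + |b3| / Lpen, by positivity, ?_⟩
  intro c₁ c₂ α hc₁ hc₂ hα hαL u hu v hv
  have p1 : 0 < α * LF := by positivity
  have p2 : 0 < α * (c₁ * Lgap) := by positivity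
  have p3 : 0 < α * (c₂ * Lpen) := by positivity
  have key : ∀ (b L t s s' : ℝ), 0 < L → 0 < t → t * L ≤ 1 / 2 → ‖s‖ ≤ b → ‖s'‖ ≤ b →
      t * (s - s') ≤ |b| / L := by
    intro b L t s s' hL ht htL hs hs'
    have hb : s - s' ≤ 2 * |b| := by
      have := le_abs_self s; have := neg_abs_le s'; have := le_abs_self b
      rw [Real.norm_eq_abs] at hs hs'; linarith
    rw [le_div_iff₀ hL]
    calc t * (s - s') * L ≤ t * (2 * |b|) * L := by gcongr
      _ = t * L * (2 * |b|) := by ring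
      _ ≤ 1 / 2 * (2 * |b|) := by gcongr
      _ = |b| := by ring
  have k1 := key b1 LF α _ _ hLF hα (by nlinarith) (h1 u hu) (h1 v hv)
  have k2 := key b2 Lgap (α * c₁) _ _ hLgap (by positivity) (by nlinarith) (h2 u hu) (h2 v hv)
  have k3 := key b3 Lpen (α * c₂) _ _ hLpen (by positivity) (by nlinarith) (h3 u hu) (h3 v hv)
  simp only [Psi]
  linarith

theorem continuousOn_Psi (hF : ∀ v ∈ P.domXY, DifferentiableAt ℝ P.F v) (c₁ c₂ : ℝ) :
    ContinuousOn (P.Psi c₁ c₂) P.U := by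
  obtain ⟨f1, f2, f3⟩ := hP.continuousOn_Psi_parts hF
  have h := (f1.add (f2.const_smul c₁)).add (f3.const_smul c₂)
  exact h

theorem integrable_Psi_comp (hF : ∀ v ∈ P.domXY, DifferentiableAt ℝ P.F v) (c₁ c₂ : ℝ)
    {Ω : Type*} {mΩ : MeasurableSpace Ω} {Pr : Measure Ω} [IsFiniteMeasure Pr]
    {u : Ω → XYZ m n p} (hu : Measurable u) (huU : ∀ ω, u ω ∈ P.U) :
    Integrable (fun ω => P.Psi c₁ c₂ (u ω)) Pr := by
  have hc := hP.continuousOn_Psi hF c₁ c₂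
  obtain ⟨b, hb⟩ := hP.isCompact_U.exists_bound_of_continuousOn hc
  have hm := ContinuousOn.measurable_comp_of_forall_mem hc hu huU
  exact Integrable.of_bound hm.aestronglyMeasurable b (ae_of_all _ fun ω => hb _ (huU ω))

theorem integrable_norm_sub_sq {Ω : Type*} {mΩ : MeasurableSpace Ω} {Pr : Measure Ω}
    [IsFiniteMeasure Pr] {u v : Ω → XYZ m n p} (hu : Measurable u) (hv : Measurable v)
    (huU : ∀ ω, u ω ∈ P.U) (hvU : ∀ ω, v ω ∈ P.U) :
    Integrable (fun ω => ‖v ω - u ω‖ ^ 2) Pr := by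
  obtain ⟨R, hR⟩ := hP.isCompact_U.isBounded.exists_norm_le
  have hd : Measurable fun ω => v ω - u ω := hv.sub hu
  have hm : Measurable fun ω => ‖v ω - u ω‖ ^ 2 := hd.norm.pow_const 2
  refine Integrable.of_bound hm.aestronglyMeasurable ((R + R) ^ 2) (ae_of_all _ fun ω => ?_)
  rw [Real.norm_of_nonneg (sq_nonneg _)]
  exact pow_le_pow_left₀ (norm_nonneg _)
    ((norm_sub_le _ _).trans (add_le_add (hR _ (hvU ω)) (hR _ (huU ω)))) 2

variable [MeasurableSpace Zt] [MeasurableSpace Xi]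

/-- The convergence rate, for nonempty `𝒰`. -/
theorem exists_rate (hU : P.U.Nonempty) {Dζ : Measure Zt} {Dξ : Measure Xi}
    [IsProbabilityMeasure Dζ] [IsProbabilityMeasure Dξ] {σf σg : ℝ}
    (hOf : IsOracle Dζ P.gradf (∇ P.F) P.domXY σf) (hOg : IsOracle Dξ P.gradg (∇ P.G) P.domXY σg)
    {η ρ : ℝ} (hη : 1 / μ ≤ η) (hρ : 1 / P.γ₂ ≤ ρ)
    (hF : ∀ v ∈ P.domXY, DifferentiableAt ℝ P.F v) {LF Lgap Lpen : ℝ≥0}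
    (hLF : LipschitzOnWith LF (∇ P.F) P.domXY) (hgap : LipschitzOnWith Lgap P.gapGradient P.U)
    (hpen : LipschitzOnWith Lpen P.penaltyGradient P.domXY) (hLF0 : 0 < LF) (hLgap : 0 < Lgap)
    (hLpen : 0 < Lpen) :
    ∃ C : ℝ, 0 < C ∧ ∀ (c₁ c₂ α : ℝ), 0 < c₁ → 0 < c₂ → 0 < α →
      α < 1 / (2 * (LF + c₁ * Lgap + c₂ * Lpen)) →
      ∀ (K r q s : ℕ), 1 ≤ K → 1 ≤ r → 1 ≤ q → 1 ≤ s → ∀ u0 ∈ P.U,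
      ∀ (Ω : Type*) (_mΩ : MeasurableSpace Ω) (Pr : Measure Ω) [IsProbabilityMeasure Pr]
        (ζ : ℕ → ℕ → Ω → Zt) (ξ ξt : ℕ → ℕ → Ω → Xi) (w0 : ℕ → Ω → Vec n),
      IIDSamples Pr Dζ Dξ ζ ξ ξt → (∀ k, Measurable[past ζ ξ ξt k] (w0 k)) →
      (∀ k ω, w0 k ω ∈ P.Y) → ∀ u : ℕ → Ω → XYZ m n p,
      (∀ k ω, u k ω = P.iterates η ρ c₁ c₂ α r q s u0 (fun k => w0 k ω) (fun k j => ζ k j ω)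
        (fun k j => ξ k j ω) (fun k j => ξt k j ω) k) →
      (∀ k, Integrable (fun ω => ‖u (k + 1) ω - u k ω‖ ^ 2) Pr) ∧
      Integrable (fun ω => P.Psi c₁ c₂ (u K ω)) Pr ∧
      ∫ ω, (1 / (K : ℝ)) * ∑ k ∈ Finset.range K, (1 / α) * ‖u (k + 1) ω - u k ω‖ ^ 2 ∂Pr
        ≤ C * (1 / (α * K) + 1 / r + c₁ ^ 2 / q + c₁ ^ 2 / s) ∧
      ∫ ω, (1 / (K * α)) * ∑ k ∈ Finset.range K, (1 / α) * ‖u (k + 1) ω - u k ω‖ ^ 2 ∂Pr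
        ≤ 4 / (α * K) * ∫ ω, (P.Psi c₁ c₂ u0 - P.Psi c₁ c₂ (u K ω)) ∂Pr
          + C * (1 / r + c₁ ^ 2 / q + c₁ ^ 2 / s) := by
  have hY : P.Y.Nonempty := ⟨_, hU.some_mem.1.2⟩
  obtain ⟨C₀, hC₀, herr⟩ := hP.exists_integral_error_le hY hOf hOg hη hρ
  obtain ⟨B₀, hB₀, hosc⟩ := hP.exists_mul_Psi_sub_le hF (NNReal.coe_pos.2 hLF0)
    (NNReal.coe_pos.2 hLgap) (NNReal.coe_pos.2 hLpen)
  -- `4 B₀` pays for the oscillation of `Ψ`, `2 C₀ / LF` for the error in the first bound, where it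
  -- carries the factor `4 α ≤ 2 / LF`, and `4 C₀` for the error in the second bound
  refine ⟨4 * B₀ + 2 * C₀ / LF + 4 * C₀ + 1, by positivity, ?_⟩
  intro c₁ c₂ α hc₁ hc₂ hα hα' K r q s hK hr hq hs u0 hu0 Ω mΩ Pr _ ζ ξ ξt w0 H hw0 hw0Y u hu
  have hLFr : (0 : ℝ) < LF := hLF0
  have hK0 : (0 : ℝ) < K := by exact_mod_cast hK
  have hLΨ : 0 < (LF : ℝ) + c₁ * Lgap + c₂ * Lpen := by positivity
  have hαL : α * (LF + c₁ * Lgap + c₂ * Lpen) ≤ 1 / 2 := by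
    rw [lt_div_iff₀ (by positivity)] at hα'
    linarith
  have huU : ∀ k ω, u k ω ∈ P.U := fun k ω => by
    rw [hu]; exact hP.iterates_mem η ρ c₁ c₂ α r q s hu0 _ _ _ _ k
  have hup : ∀ k, Measurable[past ζ ξ ξt k] (u k) := fun k => by
    rw [funext (hu k)]
    exact hP.measurable_iterates hOf.measurable hOg.measurable η hρ c₁ c₂ α r q s hu0 hw0 hw0Y k
  have hum : ∀ k, Measurable (u k) := fun k => (hup k).mono (H.hist_le _) le_rfl
  have hu0' : ∀ ω, u 0 ω = u0 := fun ω => hu 0 ω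
  have hV := fun k => hP.integrable_Psi_comp (Pr := Pr) hF c₁ c₂ (hum k) (huU k)
  have hD := fun k => hP.integrable_norm_sub_sq (Pr := Pr) (hum k) (hum (k + 1)) (huU k)
    (huU (k + 1))
  set e : ℝ := 1 / r + c₁ ^ 2 / q + c₁ ^ 2 / s with he
  have he0 : 0 ≤ e := by positivity
  choose N hN hNe hNb using fun k => herr Ω mΩ Pr ζ ξ ξt H k (u k) (w0 k) (hup k) (hw0 k) (huU k)
    (hw0Y k) c₁ c₂ r q s hr hq hs
  have hdescent : ∀ k ω, 1 / (4 * α) * ‖u (k + 1) ω - u k ω‖ ^ 2 ≤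
      P.Psi c₁ c₂ (u k ω) - P.Psi c₁ c₂ (u (k + 1) ω) + α * N k ω := by
    intro k ω
    have h1 := projected_step_le (d := P.direction c₁ c₂ r q (u k ω)
        (P.salm η ρ (u k ω).fst.fst (u k ω).snd (w0 k ω) (fun j => ξ k j ω) s).1
        (P.salm η ρ (u k ω).fst.fst (u k ω).snd (w0 k ω) (fun j => ξ k j ω) s).2
        (fun j => ζ k j ω) (fun j => ξt k j ω)) hP.convex_U hP.isCompact_U.isClosed (huU k ω) hα hαL
      (fun v hv => hP.Psi_sub_sub_inner_le hF hLF hgap hpen hc₁ hc₂ (huU k ω) hv)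
    have h2 : u (k + 1) ω = proj P.U (u k ω - α • P.direction c₁ c₂ r q (u k ω)
        (P.salm η ρ (u k ω).fst.fst (u k ω).snd (w0 k ω) (fun j => ξ k j ω) s).1
        (P.salm η ρ (u k ω).fst.fst (u k ω).snd (w0 k ω) (fun j => ξ k j ω) s).2
        (fun j => ζ k j ω) (fun j => ξt k j ω)) := by
      rw [hu (k + 1), iterates_succ, ← hu k]
    rw [← h2] at h1
    exact h1.trans (by gcongr; exact hNb k ω)
  have hsum := sum_integral_le_of_descent hα.le hV hD hN hNe hdescent K
  have hV0 : ∫ ω, P.Psi c₁ c₂ (u 0 ω) ∂Pr = P.Psi c₁ c₂ u0 := by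
    simp only [hu0', integral_const, probReal_univ, one_smul]
  rw [hV0] at hsum
  set S : ℝ := ∑ k ∈ Finset.range K, ∫ ω, ‖u (k + 1) ω - u k ω‖ ^ 2 ∂Pr with hS
  set W : ℝ := P.Psi c₁ c₂ u0 - ∫ ω, P.Psi c₁ c₂ (u K ω) ∂Pr with hW
  have hint : ∀ a : ℝ, ∫ ω, a * ∑ k ∈ Finset.range K, (1 / α) * ‖u (k + 1) ω - u k ω‖ ^ 2 ∂Pr
      = a * (1 / α * S) := by
    intro a
    rw [integral_const_mul, integral_finsetSum _ fun k _ => (hD k).const_mul _, hS]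
    simp only [integral_const_mul, Finset.mul_sum]
  have hdiff : ∫ ω, (P.Psi c₁ c₂ u0 - P.Psi c₁ c₂ (u K ω)) ∂Pr = W := by
    rw [integral_sub (integrable_const _) (hV K), integral_const, probReal_univ, one_smul]
  have hWB : α * W ≤ B₀ := by
    rw [← hdiff, ← integral_const_mul]
    refine (integral_mono (((integrable_const _).sub (hV K)).const_mul α)
      (integrable_const B₀) fun ω => ?_).trans_eq (by simp)
    exact hosc c₁ c₂ α hc₁ hc₂ hα hαL u0 hu0 _ (huU K ω)
  have hS' : 1 / α * S ≤ 4 * W + 4 * (α * (K * (C₀ * e))) := by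
    have : 1 / α * S = 4 * (1 / (4 * α) * S) := by field_simp
    linarith
  have hαF : α ≤ 1 / (2 * LF) := by
    rw [le_div_iff₀ (by positivity)]
    have : 0 ≤ α * (c₁ * Lgap + c₂ * Lpen) := by positivity
    linarith
  refine ⟨hD, hV K, ?_, ?_⟩
  · rw [hint]
    have h1 : 1 / (K : ℝ) * (1 / α * S) ≤ 4 * (α * W) / (α * K) + 4 * α * (C₀ * e) := by
      refine (mul_le_mul_of_nonneg_left hS' (by positivity)).trans_eq ?_
      field_simp
    have h2 : 4 * (α * W) / (α * K) ≤ 4 * B₀ * (1 / (α * K)) := by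
      rw [mul_one_div]; gcongr
    have h3 : 4 * α * (C₀ * e) ≤ 2 * C₀ / LF * e := by
      calc 4 * α * (C₀ * e) ≤ 4 * (1 / (2 * LF)) * (C₀ * e) := by gcongr
        _ = 2 * C₀ / LF * e := by field_simp; ring
    have h4 : 0 ≤ 1 / (α * K) := by positivity
    have h5 : 0 ≤ 2 * C₀ / (LF : ℝ) := by positivity
    have h6 : 1 / (α * K) + 1 / r + c₁ ^ 2 / q + c₁ ^ 2 / s = 1 / (α * K) + e := by
      rw [he]; ring
    rw [h6]
    have h7 : 0 ≤ (2 * C₀ / LF + 4 * C₀ + 1) * (1 / (α * K)) := by positivity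
    have h8 : 0 ≤ (4 * B₀ + 4 * C₀ + 1) * e := by positivity
    linarith
  · rw [hint, hdiff]
    have h1 : 1 / (K * α) * (1 / α * S) ≤ 4 / (α * K) * W + 4 * C₀ * e := by
      refine (mul_le_mul_of_nonneg_left hS' (by positivity)).trans_eq ?_
      field_simp
    have h2 : 0 ≤ (4 * B₀ + 2 * C₀ / LF + 1) * e := by positivity
    linarith

end Standing

end Problem

end SALVF

end

theorem theorem4 {m n p : ℕ} {Zt Xi : Type*} [MeasurableSpace Zt] [MeasurableSpace Xi]
    (Dζ : Measure Zt) (Dξ : Measure Xi) [IsProbabilityMeasure Dζ] [IsProbabilityMeasure Dξ]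
    (P : SALVF.Problem m n p Zt Xi)
    (hXconv : Convex ℝ P.X) (hXcomp : IsCompact P.X)
    (hYconv : Convex ℝ P.Y) (hYcomp : IsCompact P.Y)
    (hγ₁ : 0 < P.γ₁) (hγ₂ : 0 < P.γ₂) (hB : 0 ≤ P.B)
    (LF LG LH : ℝ≥0) (hLF : 0 < LF) (hLip : P.LipschitzGradients LF LG LH)
    (μG : ℝ) (hμG : 0 < μG) (hconv : P.Convexity μG)
    (MG MH0 MH1 : ℝ) (hbdd : P.Bounded MG MH0 MH1)
    (σf σg : ℝ) (horacle : P.StochasticOracle Dζ Dξ σf σg)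
    (hslater : P.Slater) (σ₀ : ℝ) (hlicq : P.LICQ σ₀)
    (η ρ : ℝ) (hη : 1 / μG ≤ η) (hρ : 1 / P.γ₂ ≤ ρ) :
    -- `gapGradient` is the gradient of `gap` on `P.U`, and it is Lipschitz there, as is the
    -- gradient of the constraint penalty
    (∀ u ∈ P.U, HasGradientWithinAt P.gap (P.gapGradient u) P.U u) ∧
    (∃ Lgap : ℝ≥0, LipschitzOnWith Lgap P.gapGradient P.U) ∧
    (∃ Lpen : ℝ≥0, LipschitzOnWith Lpen P.penaltyGradient P.domXY) ∧
    -- the rate, with `LΨ = LF + c₁ Lgap + c₂ Lpen` and a constant `C` that does not depend on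
    -- `c₁`, `c₂`, `α`, `K`, `r`, `q`, `s`, the starting points or the samples
    ∀ Lgap Lpen : ℝ≥0, 0 < Lgap → 0 < Lpen →
      LipschitzOnWith Lgap P.gapGradient P.U →
      LipschitzOnWith Lpen P.penaltyGradient P.domXY →
      ∃ C : ℝ, 0 < C ∧
        ∀ (c₁ c₂ α : ℝ), 0 < c₁ → 0 < c₂ → 0 < α →
          α < 1 / (2 * (LF + c₁ * Lgap + c₂ * Lpen)) →
        ∀ (K r q s : ℕ), 1 ≤ K → 1 ≤ r → 1 ≤ q → 1 ≤ s →
        ∀ u0 ∈ P.U,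
        ∀ (Ω : Type*) [MeasurableSpace Ω] (Pr : Measure Ω) [IsProbabilityMeasure Pr]
          (ζ : ℕ → ℕ → Ω → Zt) (ξ ξt : ℕ → ℕ → Ω → Xi) (w0 : ℕ → Ω → SALVF.Vec n),
          SALVF.IIDSamples Pr Dζ Dξ ζ ξ ξt →
          (∀ k, Measurable[SALVF.past ζ ξ ξt k] (w0 k)) →
          (∀ k ω, w0 k ω ∈ P.Y) →
          let u : ℕ → Ω → SALVF.XYZ m n p := fun k ω =>
            P.iterates η ρ c₁ c₂ α r q s u0 (fun k => w0 k ω) (fun k j => ζ k j ω)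
              (fun k j => ξ k j ω) (fun k j => ξt k j ω) k
          (∀ k, Integrable (fun ω => ‖u (k + 1) ω - u k ω‖ ^ 2) Pr) ∧
          Integrable (fun ω => P.Psi c₁ c₂ (u K ω)) Pr ∧
          ∫ ω, (1 / (K : ℝ)) * ∑ k ∈ Finset.range K, (1 / α) * ‖u (k + 1) ω - u k ω‖ ^ 2 ∂Pr
            ≤ C * (1 / (α * K) + 1 / r + c₁ ^ 2 / q + c₁ ^ 2 / s) ∧
          ∫ ω, (1 / (K * α)) * ∑ k ∈ Finset.range K, (1 / α) * ‖u (k + 1) ω - u k ω‖ ^ 2 ∂Pr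
            ≤ 4 / (α * K) * ∫ ω, (P.Psi c₁ c₂ u0 - P.Psi c₁ c₂ (u K ω)) ∂Pr
              + C * (1 / r + c₁ ^ 2 / q + c₁ ^ 2 / s) := by
  have hP : P.Standing LG LH μG |MG| |MH0| |MH1| :=
    { convX := hXconv, compX := hXcomp, convY := hYconv, compY := hYcomp, γ₁_pos := hγ₁
      γ₂_pos := hγ₂, B_nonneg := hB, diffG := hLip.2.1.1, lipG := hLip.2.1.2
      diffH := fun i => (hLip.2.2 i).1, lipH := fun i => (hLip.2.2 i).2, μ_pos := hμG
      convexity := hconv, MG_nonneg := abs_nonneg _, M0_nonneg := abs_nonneg _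
      M1_nonneg := abs_nonneg _
      bounded := fun v hv => ⟨(hbdd v hv).1.trans (le_abs_self _), fun i =>
        ⟨((hbdd v hv).2 i).1.trans (le_abs_self _), ((hbdd v hv).2 i).2.trans (le_abs_self _)⟩⟩ }
  have hOf : SALVF.IsOracle Dζ P.gradf (∇ P.F) P.domXY σf :=
    ⟨horacle.1, SALVF.measurable_gradient _, fun v hv => (horacle.2.2 v hv).1.1,
      fun v hv => (horacle.2.2 v hv).1.2.1, fun v hv => (horacle.2.2 v hv).1.2.2⟩
  have hOg : SALVF.IsOracle Dξ P.gradg (∇ P.G) P.domXY σg :=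
    ⟨horacle.2.1, SALVF.measurable_gradient _, fun v hv => (horacle.2.2 v hv).2.1,
      fun v hv => (horacle.2.2 v hv).2.2.1, fun v hv => (horacle.2.2 v hv).2.2.2⟩
  refine ⟨fun u hu => hP.hasGradientWithinAt_gap hu, hP.exists_lipschitzOnWith_gapGradient,
    hP.exists_lipschitzOnWith_penaltyGradient, ?_⟩
  intro Lgap Lpen hLgap hLpen hgap hpen
  rcases P.U.eq_empty_or_nonempty with hU | hU
  · exact ⟨1, one_pos, fun _ _ _ _ _ _ _ _ _ _ _ _ _ _ _ u0 hu0 => by simp [hU] at hu0⟩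
  obtain ⟨C, hC, h⟩ := hP.exists_rate hU hOf hOg hη hρ hLip.1.1 hLip.1.2 hgap hpen hLF hLgap hLpen
  refine ⟨C, hC, ?_⟩
  intro c₁ c₂ α hc₁ hc₂ hα hα' K r q s hK hr hq hs u0 hu0 Ω mΩ Pr _ ζ ξ ξt w0 H hw0 hw0Y u
  exact h c₁ c₂ α hc₁ hc₂ hα hα' K r q s hK hr hq hs u0 hu0 Ω mΩ Pr ζ ξ ξt w0 H hw0 hw0Y u
    fun _ _ => rfl
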